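/- Let $n>0$, $0<\alpha\le 0.2$, and write $z_p=\Phi^{-1}(1-p)$, where $\Phi$ is the standard normal distribution function. Observe either the white noise model $dY(t)=f(t)\,dt+n^{-1/2}dW(t)$, $-\tfrac12\le t\le\tfrac12$, with $W$ a standard Brownian motion, or the sequence model $Y(i)=f(i)+n^{-1/2}z_i$, $i\in\mathcal M$, with $\mathcal M$ finite or countably infinite and $z_i$ i.i.d. standard normal. Let $\|\cdot\|_2$ be the norm of $L^2(-\tfrac12,\tfrac12)$, respectively of $\ell^2(\mathcal M)$, and let $T$ be a linear functional (not assumed bounded). For classes $\mathcal F,\mathcal G$ of square integrable (summable) $f$ put $$\omega(\varepsilon,\mathcal F,\mathcal G)=\sup\{Tg-Tf:\ \|g-f\|_2\le\varepsilon,\ f\in\mathcal F,\ g\in\mathcal G\},\qquad \omega_+(\varepsilon,\mathcal F,\mathcal G)=\sup\{|Tg-Tf|:\ \|g-f\|_2\le\varepsilon,\ f\in\mathcal F,\ g\in\mathcal G\}.$$ Let $\mathcal I_{\alpha,\mathcal F}$ be the set of intervals $CI$ depending measurably on the data with $P_f(Tf\in CI)\ge 1-\alpha$ for all $f\in\mathcal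 F$, let $L(CI,\mathcal G)=\sup_{f\in\mathcal G}E_f(\text{length of }CI)$, and let $L^*_\alpha(\mathcal G,\mathcal F)=\inf_{CI\in\mathcal I_{\alpha,\mathcal F}}L(CI,\mathcal G)$. Let $\mathcal F_1\subseteq\mathcal F_2\subseteq\dots\subseteq\mathcal F_k$ be convex classes of square integrable (summable) functions, where $1\le k\le\infty$ and $\mathcal F_\infty=\bigcup_{i\ge 1}\mathcal F_i$ if $k=\infty$. Set $\xi_j=\omega_+(z_{\alpha/2}/\sqrt n,\mathcal F_j,\mathcal F_k)$ for $1\le j\le k$, and assume $\xi_1>0$ and $\xi_j<\infty$ for all finite $j\le k$. Write $\omega_{i,j}=\omega(z_{\alpha/2}/\sqrt n,\mathcal F_i,\mathcal F_j)$. The following construction is considered. (a) For every $j$ with $1\le j\le k$ and $\xi_j<\infty$, and for $(i,l)=(j,k)$ and $(i,l)=(k,j)$, $\hat T_{i,l}$ is a linear (i.e. affine) estimator with $$\operatorname{Var}(\hat T_{i,l})\le \omega_{i,l}^2/z_{\alpha/2}^2,\qquad \inf_{f\in\mathcal F_l}(E_f\hat T_{i,l}-Tf)\ge-\tfrac12\omega_{i,l},\qquad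 \sup_{f\in\mathcal F_i}(E_f\hat T_{i,l}-Tf)\le\tfrac12\omega_{i,l},$$ and $CI_j^*$ is the closed interval with centre $\tfrac12(\hat T_{j,k}+\hat T_{k,j})$ and half-length $(\hat T_{j,k}-\hat T_{k,j})_++2\xi_j$. (b) $j_1<j_2<\cdots$ are indices with $\xi_{j_i}<\infty$ such that $\xi_{j_i}\ge2\xi_{j_{i-1}}$ and $\xi_{j_i}<2\xi_j$ for all $j_{i-1}<j<j_i$ (with $j_0=0$, $\xi_0=0$); the sequence ends with $j_m=k$ if $\xi_k<\infty$, and it is infinite if $\xi_k=\infty$. (c) $\hat j$ is a (measurable) index of a shortest interval among the $CI^*_{j_i}$, and $CI^*=CI^*_{\hat j}$. Then such estimators, such a subsequence and such an index exist, and for every choice of them $CI^*\in\mathcal I_{\alpha,\mathcal F_k}$, i.e. $CI^*$ has coverage probability at least $1-\alpha$ for every $f\in\mathcal F_k$. Moreover, simultaneously for all $1\le j\le k$, $$L^*_\alpha(\mathcal F_j,\mathcal F_k)\le L(CI^*,\mathcal F_j)\le\frac{16\,z_{\alpha/2}}{(1/2-\alpha)\,z_\alpha}\,L^*_\alpha(\mathcal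 F_j,\mathcal F_k),$$ $$L(CI^*,\mathcal F_{j_i})\le 8\,\omega_+\!\left(\frac{z_{\alpha/2}}{\sqrt n},\mathcal F_{j_i},\mathcal F_k\right)\quad\text{for every index } j_i \text{ of the subsequence},$$ $$L(CI^*,\mathcal F_j)\le 16\,\omega_+\!\left(\frac{z_{\alpha/2}}{\sqrt n},\mathcal F_j,\mathcal F_k\right)\quad\text{for all }1\le j\le k.$$ -/

import Mathlib

open MeasureTheory ProbabilityTheory Filter Topology
open scoped ENNReal NNReal

noncomputable section

/-- The upper `p`-quantile `z_p = Φ⁻¹(1 - p)` of the standard normal distribution,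
`Φ` being its cumulative distribution function. -/
def upperQuantile (p : ℝ) : ℝ := sInf {x : ℝ | 1 - p ≤ cdf (gaussianReal 0 1) x}

/-- A family of observation models: the unknown parameter is a function `f` on `Idx`,
the data are `Y = (Y t)`, `t` in `Idx`, with law `law f` (for the product σ-algebra), and `ref` is
the reference measure on `Idx` which defines the norm `‖·‖₂`. -/
structure Experiment where
  Idx : Type
  [mIdx : MeasurableSpace Idx]
  ref : Measure Idx
  law : (Idx → ℝ) → Measure (Idx → ℝ)

attribute [instance] Experiment.mIdx

/-- Functions on the index set; parameters as well as observed data are of this type. -/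
abbrev Experiment.Fn (E : Experiment) : Type := E.Idx → ℝ

/-- The white noise model `dY(t) = f(t) dt + n^{-1/2} dW(t)`, `-1/2 ≤ t ≤ 1/2`: one observes the path
`Y(t) = ∫_{-1/2}^t f(s) ds + n^{-1/2} W(t)`, where `W(t) = B(t + 1/2)`. The norm is that of
`L²(-1/2, 1/2)`. -/
def whiteNoiseModel (n : ℝ) {Ω : Type} [MeasurableSpace Ω] (P : Measure Ω) (B : ℝ≥0 → Ω → ℝ) :
    Experiment where
  Idx := Set.Icc (-(1 / 2) : ℝ) (1 / 2)
  ref := (volume : Measure ℝ).comap Subtype.val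
  law f := P.map fun ω t =>
    (∫ s in Set.Iic t, f s ∂((volume : Measure ℝ).comap Subtype.val)) +
      (√n)⁻¹ * B (Real.toNNReal ((t : ℝ) + 1 / 2)) ω

/-- The sequence model `Y(i) = f(i) + n^{-1/2} z_i`, `i ∈ M`, with independent standard normal `z_i`.
The norm is the `ℓ²` norm. -/
def sequenceModel (n : ℝ) (M : Type) : Experiment where
  Idx := M
  mIdx := ⊤
  ref := @Measure.count M ⊤
  law f := Measure.infinitePi fun i => gaussianReal (f i) (Real.toNNReal (1 / n))

/-- The two Gaussian models with noise level `n^{-1/2}`: white noise with drift, driven by a standard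
Brownian motion, and the sequence model over a finite or countably infinite index set. -/
inductive IsGaussianModel (n : ℝ) : Experiment → Prop
  | whiteNoise {Ω : Type} [MeasurableSpace Ω] (P : Measure Ω) (B : ℝ≥0 → Ω → ℝ)
      (hmeas : ∀ t, Measurable (B t)) (hB : IsBrownianReal B P) :
      IsGaussianModel n (whiteNoiseModel n P B)
  | sequence (M : Type) [Countable M] : IsGaussianModel n (sequenceModel n M)

/-- An interval `[lo Y, hi Y]` depending on the data `Y` (empty when `hi Y < lo Y`). -/
structure DataInterval (E : Experiment) where
  lo : E.Fn → ℝ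
  hi : E.Fn → ℝ

/-- The length of the interval. -/
def DataInterval.length {E : Experiment} (C : DataInterval E) (y : E.Fn) : ℝ≥0∞ :=
  ENNReal.ofReal (C.hi y - C.lo y)

/-- The class `I_{α,F}` of confidence intervals for `T f` with coverage probability at least `1 - α`
at every `f ∈ F`. -/
def confidenceIntervals (E : Experiment) (T : E.Fn →ₗ[ℝ] ℝ) (α : ℝ) (F : Set E.Fn) :
    Set (DataInterval E) :=
  {C | Measurable C.lo ∧ Measurable C.hi ∧
    ∀ f ∈ F, ENNReal.ofReal (1 - α) ≤ E.law f {y | T f ∈ Set.Icc (C.lo y) (C.hi y)}}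

/-- The maximum expected length `L(C, G) = sup_{f ∈ G} E_f (L(C))`. -/
def maxLength {E : Experiment} (C : DataInterval E) (G : Set E.Fn) : ℝ≥0∞ :=
  ⨆ f ∈ G, ∫⁻ y, C.length y ∂(E.law f)

/-- The benchmark `L*_α(G, F) = inf {L(C, G) : C ∈ I_{α,F}}`. -/
def optimalLength (E : Experiment) (T : E.Fn →ₗ[ℝ] ℝ) (α : ℝ) (G F : Set E.Fn) : ℝ≥0∞ :=
  ⨅ C ∈ confidenceIntervals E T α F, maxLength C G

/-- The ordered modulus `ω(ε, F, G) = sup {T g - T f : ‖g - f‖₂ ≤ ε, f ∈ F, g ∈ G}`. -/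
def orderedModulus (E : Experiment) (T : E.Fn →ₗ[ℝ] ℝ) (ε : ℝ) (F G : Set E.Fn) : EReal :=
  ⨆ f ∈ F, ⨆ g ∈ G, ⨆ _ : eLpNorm (g - f) 2 E.ref ≤ ENNReal.ofReal ε, ((T g - T f : ℝ) : EReal)

/-- The between class modulus `ω₊(ε, F, G) = sup {|T g - T f| : ‖g - f‖₂ ≤ ε, f ∈ F, g ∈ G}`. -/
def betweenModulus (E : Experiment) (T : E.Fn →ₗ[ℝ] ℝ) (ε : ℝ) (F G : Set E.Fn) : ℝ≥0∞ :=
  ⨆ f ∈ F, ⨆ g ∈ G, ⨆ _ : eLpNorm (g - f) 2 E.ref ≤ ENNReal.ofReal ε,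
    ENNReal.ofReal |T g - T f|

/-- Linear (that is, affine) estimators: the statistics `c + ∫ a dY`, respectively `c + ∑ a_i Y(i)`,
with square integrable (summable) weights `a`. They are the measurable functions of the data that
are, at every square integrable `f`, the limit in mean square of one and the same sequence of affine
combinations of finitely many observations. -/
def IsLinearEstimator (E : Experiment) (τ : E.Fn → ℝ) : Prop :=
  Measurable τ ∧ ∃ (c : ℕ → ℝ) (w : ℕ → E.Idx →₀ ℝ), ∀ f : E.Fn, MemLp f 2 E.ref →
    Tendsto (fun m => eLpNorm (fun y => τ y - (c m + (w m).sum fun t a => a * y t)) 2 (E.law f))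
      atTop (𝓝 0)

/-- A linear estimator of `T f` attached to the ordered pair `(F, G)`: with
`ω = ω(z_{α/2}/√n, F, G)` its variance is at most `ω² / z_{α/2}²`, its bias is at least `-ω/2`
over `G` and at most `ω/2` over `F`. -/
structure IsOrderedEstimator (E : Experiment) (T : E.Fn →ₗ[ℝ] ℝ) (n α : ℝ) (F G : Set E.Fn)
    (τ : E.Fn → ℝ) : Prop where
  linear : IsLinearEstimator E τ
  variance_le : ∀ f : E.Fn, MemLp f 2 E.ref → variance τ (E.law f) ≤
    1 / upperQuantile (α / 2) ^ 2 *
      (orderedModulus E T (upperQuantile (α / 2) / √n) F G).toReal ^ 2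
  bias_ge : ∀ f ∈ G, -(1 / 2) * (orderedModulus E T (upperQuantile (α / 2) / √n) F G).toReal ≤
    (∫ y, τ y ∂(E.law f)) - T f
  bias_le : ∀ f ∈ F, (∫ y, τ y ∂(E.law f)) - T f ≤
    1 / 2 * (orderedModulus E T (upperQuantile (α / 2) / √n) F G).toReal

/-- `ξ_j = ω₊(z_{α/2}/√n, F_j, F_k)`. -/
def xi (E : Experiment) (T : E.Fn →ₗ[ℝ] ℝ) (n α : ℝ) (k : ℕ∞) (F : ℕ∞ → Set E.Fn) (j : ℕ∞) : ℝ≥0∞ :=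
  betweenModulus E T (upperQuantile (α / 2) / √n) (F j) (F k)

/-- The interval `CI_j*` with centre `(T̂_{j,k} + T̂_{k,j}) / 2` and half-length
`(T̂_{j,k} - T̂_{k,j})₊ + 2 ξ_j`; here `τ i j` is the estimator `T̂_{i,j}`. -/
def ciStep (E : Experiment) (T : E.Fn →ₗ[ℝ] ℝ) (n α : ℝ) (k : ℕ∞) (F : ℕ∞ → Set E.Fn)
    (τ : ℕ∞ → ℕ∞ → E.Fn → ℝ) (j : ℕ∞) : DataInterval E where
  lo y := (τ j k y + τ k j y) / 2 - (max (τ j k y - τ k j y) 0 + 2 * (xi E T n α k F j).toReal)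
  hi y := (τ j k y + τ k j y) / 2 + (max (τ j k y - τ k j y) 0 + 2 * (xi E T n α k F j).toReal)

/-- `S` is the index set `{j_1 < j_2 < ⋯}` of a subsequence of `(x_j)`, `1 ≤ j ≤ k`, that is
geometrically spaced: `x_{j_i} ≥ 2 x_{j_{i-1}}`, and `x_{j_i} < 2 x_j` whenever `j_{i-1} < j < j_i`
(with `j_0 = 0`). It runs through indices with `x_j < ∞` and is cofinal in these: it ends with
`j_m = k` if `x_k < ∞`, and it is infinite if `k = ∞` and `x_k = ∞` while `x_j < ∞` for `j < k`. -/
structure IsDoublingSubsequence (k : ℕ∞) (x : ℕ∞ → ℝ≥0∞) (S : Set ℕ∞) : Prop where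
  mem_range : ∀ j ∈ S, 1 ≤ j ∧ j ≤ k ∧ x j ≠ ∞
  cofinal : ∀ j, 1 ≤ j → j ≤ k → x j ≠ ∞ → ∃ b ∈ S, j ≤ b
  spaced : ∀ a ∈ S, ∀ b ∈ S, a < b → 2 * x a ≤ x b
  between : ∀ b ∈ S, ∀ j, 1 ≤ j → j < b → (∀ a ∈ S, a < b → a < j) → x b < 2 * x j

/-- The ingredients of the adaptive interval: linear estimators `T̂_{j,k}`, `T̂_{k,j}` with the required
variance and bias bounds, a geometrically spaced subsequence `S`, and a data dependent index
`J ∈ S` for which `CI_J*` is the shortest of the intervals `CI_j*`, `j ∈ S`. -/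
structure IsAdaptiveConstruction (E : Experiment) (T : E.Fn →ₗ[ℝ] ℝ) (n α : ℝ) (k : ℕ∞)
    (F : ℕ∞ → Set E.Fn) (τ : ℕ∞ → ℕ∞ → E.Fn → ℝ) (S : Set ℕ∞) (J : E.Fn → ℕ∞) : Prop where
  estimators : ∀ j, 1 ≤ j → j ≤ k → xi E T n α k F j ≠ ∞ →
    IsOrderedEstimator E T n α (F j) (F k) (τ j k) ∧ IsOrderedEstimator E T n α (F k) (F j) (τ k j)
  subsequence : IsDoublingSubsequence k (xi E T n α k F) S
  measurable_index : Measurable J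
  index_mem : ∀ y, J y ∈ S
  shortest : ∀ y, ∀ j ∈ S,
    (ciStep E T n α k F τ (J y)).length y ≤ (ciStep E T n α k F τ j).length y

/-- The adaptive interval `CI* = CI_J*`. -/
def ciStar (E : Experiment) (T : E.Fn →ₗ[ℝ] ℝ) (n α : ℝ) (k : ℕ∞) (F : ℕ∞ → Set E.Fn)
    (τ : ℕ∞ → ℕ∞ → E.Fn → ℝ) (J : E.Fn → ℕ∞) : DataInterval E where
  lo y := (ciStep E T n α k F τ (J y)).lo y
  hi y := (ciStep E T n α k F τ (J y)).hi y

end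

/-!
Both models are instances of one structure, `IsGaussianShift`: finite linear combinations of the
data are normal, with means given by inner products with `f` and variances by norms in `L²`.
Everything below uses this structure only.

*Existence.* The estimators come from a separation argument in `L² × ℝ`: for convex classes the
increments `T g - T f - ω` lie below the cone `(ω / ε) ‖g - f‖`, so a continuous linear functional
of norm at most `ω / ε` lies in between, and integrating it against the data gives the required
bias and variance (`IsGaussianShift.exists_isOrderedEstimator`). The geometrically spaced
subsequence is built backwards from its last term; when it has no last term, finite chains are
glued along an ultrafilter (`exists_isDoublingSubsequence`).

*Coverage.* Write `A_s`, `B_s` for the two estimators of index `s`, `x_s` for the modulus, `d_s`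
for the mean of `A_s - B_s`. The miss event is split according to the selected index `s`. If `d_s`
is large compared with `x_s`, then the interval is longer than needed and rarely misses `T f`; if
`x_s` is large compared with the scale of a competing index `l`, then `s` is rarely selected.
Taking for `l` a minimizer of `2 x_s + (d_s)₊` makes one of the two alternatives hold for every
`s`, with a margin growing geometrically in `x_s / x_l` or `x_l / x_s`. Since the `x_s` at least
double from each index to the next, every dyadic interval contains at most one of them, and the
resulting series of normal tails is at most `2 (1 - Φ(z_{α/2})) = α` (`measure_selectedMiss_le`).
The numerical input is `z_{α/2} ≥ 5/4`, which is where `α ≤ 1/5` enters.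

*Length.* `CI*` is no longer than any `CI_s*` with `s` in the subsequence, and the expected length
of the latter over `F_s` is at most `8 ξ_s`; any other index `j` is compared with the next index
of the subsequence, whose modulus is less than `2 ξ_j` (`IsAdaptiveConstruction.maxLength_le`).

*Lower bound.* By the Neyman–Pearson lemma, an event of probability `1 - α` at `g` has probability
at least `1 / 2` at each `f` within `z_α / √n` of `g` (`IsGaussianShift.half_le_law`), so at `f`
an interval covers `T f` and `T g` together with probability at least `1 / 2 - α`. Convexity turns
the radius `z_α / √n` into `z_{α/2} / √n` (`IsGaussianShift.betweenModulus_le_optimalLength`).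
-/

/-! ### Gaussian shift experiments -/

/-- The linear statistic `∑ t, v t * y t` of finitely many observations. -/
def finObs {ι : Type*} (v : ι →₀ ℝ) (y : ι → ℝ) : ℝ := v.sum fun t c => c * y t

@[fun_prop]
lemma measurable_finObs {ι : Type*} (v : ι →₀ ℝ) : Measurable (finObs v) := by
  unfold finObs Finsupp.sum
  fun_prop

lemma finObs_add {ι : Type*} (v w : ι →₀ ℝ) (y : ι → ℝ) :
    finObs (v + w) y = finObs v y + finObs w y := by
  classical
  unfold finObs
  rw [Finsupp.sum_add_index'] <;> intros <;> ring

lemma finObs_smul {ι : Type*} (c : ℝ) (v : ι →₀ ℝ) (y : ι → ℝ) :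
    finObs (c • v) y = c * finObs v y := by
  unfold finObs
  rw [Finsupp.sum_smul_index (by simp), Finsupp.mul_sum]
  simp only [mul_assoc]

lemma finObs_sub {ι : Type*} (v w : ι →₀ ℝ) (y : ι → ℝ) :
    finObs (v - w) y = finObs v y - finObs w y := by
  rw [sub_eq_add_neg, ← neg_one_smul ℝ w, finObs_add, finObs_smul]; ring

/-- The common structure of the white noise and of the sequence model: the coordinate `y t` of the
data is the value at `a t ∈ L²` of an isonormal process with noise level `n^{-1/2}`, shifted by
`⟪a t, f⟫`; this is expressed by the laws of all finite linear combinations. The vectors `a t` are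
total in `L²`. -/
structure IsGaussianShift (n : ℝ) (E : Experiment) (a : E.Idx → Lp ℝ 2 E.ref) : Prop where
  isProbabilityMeasure : ∀ f : E.Fn, MemLp f 2 E.ref → IsProbabilityMeasure (E.law f)
  map_finObs : ∀ (f : E.Fn) (hf : MemLp f 2 E.ref) (v : E.Idx →₀ ℝ),
    (E.law f).map (finObs v) =
      gaussianReal (inner ℝ (Finsupp.linearCombination ℝ a v) (hf.toLp f))
        (‖Finsupp.linearCombination ℝ a v‖ ^ 2 / n).toNNReal
  total : ∀ g : Lp ℝ 2 E.ref, (∀ t, inner ℝ (a t) g = 0) → g = 0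

/-- Finite linear combinations of a shifted centred Gaussian process whose covariance is
`⟪a s, a t⟫ / n` are Gaussian, with the variance `‖∑ v t a t‖² / n`. -/
lemma map_finObs_of_isGaussianProcess {Ω T H : Type*} [MeasurableSpace Ω] {P : Measure Ω}
    [NormedAddCommGroup H] [InnerProductSpace ℝ H] (n : ℝ) {W : T → Ω → ℝ}
    (hW : IsGaussianProcess W P) (a : T → H) (m : H) (h0 : ∀ t, P[W t] = 0)
    (hcov : ∀ s t, cov[W s, W t; P] = inner ℝ (a s) (a t) / n) (v : T →₀ ℝ) :
    P.map (fun ω => finObs v fun t => inner ℝ (a t) m + W t ω) =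
      gaussianReal (inner ℝ (Finsupp.linearCombination ℝ a v) m)
        (‖Finsupp.linearCombination ℝ a v‖ ^ 2 / n).toNNReal := by
  classical
  have hprob : IsProbabilityMeasure P := hW.isProbabilityMeasure
  have hlp : ∀ t, MemLp (W t) 2 P := fun t => (hW.hasGaussianLaw_eval t).memLp_two
  have hG : HasGaussianLaw (fun ω => ∑ t ∈ v.support, v t * W t ω) P :=
    (hW.smul v).hasGaussianLaw_fun_sum
  have hmean : ∫ ω, ∑ t ∈ v.support, v t * W t ω ∂P = 0 := by
    rw [integral_finsetSum _ fun t _ => ((hlp t).integrable (by norm_num)).const_mul _]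
    exact Finset.sum_eq_zero fun t _ => by rw [integral_const_mul, h0, mul_zero]
  have hvar : Var[fun ω => ∑ t ∈ v.support, v t * W t ω; P] =
      ‖Finsupp.linearCombination ℝ a v‖ ^ 2 / n := by
    rw [← covariance_self hG.aemeasurable,
      covariance_fun_sum_fun_sum' (fun t _ => (hlp t).const_mul _)
        (fun t _ => (hlp t).const_mul _), ← real_inner_self_eq_norm_sq,
      Finsupp.linearCombination_apply, Finsupp.sum, sum_inner, Finset.sum_div]
    refine Finset.sum_congr rfl fun s _ => ?_
    rw [inner_sum, Finset.sum_div]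
    refine Finset.sum_congr rfl fun t _ => ?_
    rw [covariance_const_mul_left, covariance_const_mul_right, hcov, real_inner_smul_left,
      real_inner_smul_right]
    ring
  have h1 : (fun ω => finObs v fun t => inner ℝ (a t) m + W t ω) =
      (fun x => inner ℝ (Finsupp.linearCombination ℝ a v) m + x) ∘
        fun ω => ∑ t ∈ v.support, v t * W t ω := by
    funext ω
    simp only [finObs, Finsupp.sum, Function.comp, Finsupp.linearCombination_apply, sum_inner,
      real_inner_smul_left, mul_add, Finset.sum_add_distrib]
  rw [h1, ← AEMeasurable.map_map_of_aemeasurable (by fun_prop) hG.aemeasurable,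
    hG.map_eq_gaussianReal, hmean, hvar, gaussianReal_map_const_add, zero_add]

/-- The centred coordinates of a product of normal laws form a white noise. -/
lemma gaussianNoise_infinitePi {M : Type*} [DecidableEq M] (f : M → ℝ) (s : ℝ≥0) :
    IsGaussianProcess (fun (i : M) (y : M → ℝ) => y i - f i)
        (Measure.infinitePi fun i => gaussianReal (f i) s) ∧
      (∀ i, ∫ y, (y i - f i) ∂(Measure.infinitePi fun i => gaussianReal (f i) s) = 0) ∧
      ∀ i j, cov[fun y => y i - f i, fun y => y j - f j;
        Measure.infinitePi fun i => gaussianReal (f i) s] = if i = j then (s : ℝ) else 0 := by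
  set P : Measure (M → ℝ) := Measure.infinitePi fun i => gaussianReal (f i) s with hP
  have hm : ∀ i : M, Measurable fun y : M → ℝ => y i - f i := fun i => by fun_prop
  have hlaw : ∀ i, P.map (fun y => y i - f i) = gaussianReal 0 s := by
    intro i
    have h1 : (fun y : M → ℝ => y i - f i) = (fun x => x - f i) ∘ fun y => y i := rfl
    rw [h1, ← Measure.map_map (by fun_prop) (by fun_prop)]
    have h2 : P.map (fun y => y i) = gaussianReal (f i) s :=
      Measure.infinitePi_map_eval (fun i : M => gaussianReal (f i) s) i
    rw [h2, gaussianReal_map_sub_const, sub_self]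
  have hG : ∀ i, HasGaussianLaw (fun y : M → ℝ => y i - f i) P := fun i =>
    ⟨by rw [hlaw i]; infer_instance⟩
  have hind : iIndepFun (fun (i : M) (y : M → ℝ) => y i - f i) P :=
    iIndepFun_infinitePi (P := fun i : M => gaussianReal (f i) s)
      (X := fun i x => x - f i) (fun i => by fun_prop)
  refine ⟨⟨fun I => iIndepFun.hasGaussianLaw (fun i : I => hG i)
        (hind.precomp (g := ((↑) : I → M)) Subtype.val_injective)⟩, fun i => ?_, fun i j => ?_⟩
  · have := integral_map (μ := P) (φ := fun y => y i - f i) (f := fun x => x)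
      (hm i).aemeasurable (by fun_prop)
    rw [← this, hlaw i]
    exact integral_id_gaussianReal
  · split_ifs with hij
    · subst hij
      rw [covariance_self (hm i).aemeasurable]
      have := variance_map (μ := P) (X := fun x : ℝ => x) (Y := fun y => y i - f i)
        (by fun_prop) (hm i).aemeasurable
      rw [hlaw i] at this
      exact this.symm.trans variance_id_gaussianReal
    · exact (hind.indepFun hij).covariance_eq_zero (hG i).memLp_two (hG j).memLp_two

lemma isGaussianShift_sequenceModel {n : ℝ} (hn : 0 < n) (M : Type) [Countable M] :
    ∃ a, IsGaussianShift n (sequenceModel n M) a := by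
  classical
  let mM : MeasurableSpace M := ⊤
  let μ : Measure M := Measure.count
  have hfin : ∀ i : M, μ {i} ≠ ∞ := fun i => by simp [μ]
  let a : M → Lp ℝ 2 μ := fun i => indicatorConstLp 2 (measurableSet_singleton i) (hfin i) 1
  have hinner : ∀ i (g : Lp ℝ 2 μ), inner ℝ (a i) g = g i := by
    intro i g
    rw [L2.inner_indicatorConstLp_one (measurableSet_singleton i) (hfin i) g, integral_singleton]
    simp [Measure.real, μ]
  have hae : ∀ {p : M → Prop}, (∀ᵐ i ∂μ, p i) → ∀ i, p i := by
    intro p hp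
    simpa [μ, Measure.ae_count_iff] using hp
  have hmap : ∀ (f : M → ℝ) (hf : MemLp f 2 μ) (v : M →₀ ℝ),
      (Measure.infinitePi fun i => gaussianReal (f i) (1 / n).toNNReal).map (finObs v) =
        gaussianReal (inner ℝ (Finsupp.linearCombination ℝ a v) (hf.toLp f))
          (‖Finsupp.linearCombination ℝ a v‖ ^ 2 / n).toNNReal := by
    intro f hf v
    obtain ⟨hproc, h0, hcov⟩ := gaussianNoise_infinitePi f (1 / n).toNNReal
    have hcov' : ∀ i j : M, cov[fun y => y i - f i, fun y => y j - f j;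
        Measure.infinitePi fun i => gaussianReal (f i) (1 / n).toNNReal] =
        inner ℝ (a i) (a j) / n := by
      intro i j
      rw [L2.real_inner_indicatorConstLp_one_indicatorConstLp_one (measurableSet_singleton i)
        (measurableSet_singleton j) (hfin i) (hfin j), hcov]
      split_ifs with hij
      · subst hij
        rw [Real.coe_toNNReal _ (by positivity), Set.inter_self]
        simp [Measure.real, μ]
      · rw [Set.singleton_inter_eq_empty.2 (by simpa using hij)]
        simp
    have key := map_finObs_of_isGaussianProcess n hproc a (hf.toLp f) h0 hcov' v
    rw [← key]
    congr 1
    funext y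
    congr 1
    funext i
    rw [hinner, hae hf.coeFn_toLp i]
    ring
  refine ⟨a, fun f _ => ?_, fun f hf v => hmap f hf v, fun g hg => ?_⟩
  · exact (gaussianNoise_infinitePi (M := M) f (1 / n).toNNReal).1.isProbabilityMeasure
  · refine Lp.ext (μ := μ) (Filter.Eventually.of_forall fun i => ?_)
    refine ((hinner i g).symm.trans (hg i)).trans ?_
    exact (hae (Lp.coeFn_zero ℝ 2 μ) i).symm

/-- The time interval of the white noise model. -/
abbrev TimeInterval : Type := Set.Icc (-(1 / 2) : ℝ) (1 / 2)

/-- Lebesgue measure on the time interval. -/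
noncomputable abbrev timeMeasure : Measure TimeInterval := (volume : Measure ℝ).comap Subtype.val

lemma timeMeasure_apply (s : Set TimeInterval) :
    timeMeasure s = volume (Subtype.val '' s : Set ℝ) :=
  (MeasurableEmbedding.subtype_coe measurableSet_Icc).comap_apply _ _

instance isFiniteMeasure_timeMeasure : IsFiniteMeasure timeMeasure := by
  refine ⟨?_⟩
  rw [timeMeasure_apply]
  refine (measure_mono (t := Set.Icc (-(1 / 2) : ℝ) (1 / 2)) ?_).trans_lt (by simp)
  rintro _ ⟨x, -, rfl⟩
  exact x.2

lemma timeMeasure_real_Iic (t : TimeInterval) : timeMeasure.real (Set.Iic t) = t.1 + 1 / 2 := by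
  have h1 : (Subtype.val '' Set.Iic t : Set ℝ) = Set.Icc (-(1 / 2)) t.1 := by
    ext x
    constructor
    · rintro ⟨y, hy, rfl⟩
      exact ⟨y.2.1, hy⟩
    · rintro ⟨hx1, hx2⟩
      exact ⟨⟨x, hx1, hx2.trans t.2.2⟩, hx2, rfl⟩
  rw [Measure.real, timeMeasure_apply, h1, Real.volume_Icc,
    ENNReal.toReal_ofReal (by linarith [t.2.1])]
  ring

lemma ae_eq_zero_of_forall_setIntegral_Iic {g : TimeInterval → ℝ} (hg : Integrable g timeMeasure)
    (h0 : ∀ t, ∫ s in Set.Iic t, g s ∂timeMeasure = 0) : g =ᵐ[timeMeasure] 0 := by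
  have huniv : ∫ s, g s ∂timeMeasure = 0 := by
    have h1 := h0 ⟨1 / 2, by norm_num⟩
    have h2 : (Set.Iic (⟨1 / 2, by norm_num⟩ : TimeInterval)) = Set.univ :=
      Set.eq_univ_of_forall fun x => x.2.2
    rwa [h2, setIntegral_univ] at h1
  refine hg.ae_eq_zero_of_forall_setIntegral_eq_zero fun s hs _ => ?_
  induction s, hs using MeasurableSpace.induction_on_inter
    ((BorelSpace.measurable_eq (α := TimeInterval)).trans (borel_eq_generateFrom_Iic _))
    isPiSystem_Iic with
  | empty => simp
  | basic t ht =>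
    obtain ⟨x, rfl⟩ := ht
    exact h0 x
  | compl t ht ih => rw [setIntegral_compl ht hg, huniv, ih (measure_lt_top _ _), sub_zero]
  | iUnion f hd hf ih =>
    rw [integral_iUnion hf hd hg.integrableOn]
    simp [ih]

lemma isGaussianShift_whiteNoiseModel {n : ℝ} (hn : 0 < n) {Ω : Type} [MeasurableSpace Ω]
    (P : Measure Ω) (B : ℝ≥0 → Ω → ℝ) (hmeas : ∀ t, Measurable (B t)) (hB : IsBrownianReal B P) :
    ∃ a, IsGaussianShift n (whiteNoiseModel n P B) a := by
  let a : TimeInterval → Lp ℝ 2 timeMeasure := fun t =>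
    indicatorConstLp 2 (measurableSet_Iic (a := t)) (measure_ne_top _ _) 1
  have hinner : ∀ t (g : Lp ℝ 2 timeMeasure),
      inner ℝ (a t) g = ∫ s in Set.Iic t, g s ∂timeMeasure := fun t g =>
    L2.inner_indicatorConstLp_one measurableSet_Iic (measure_ne_top _ _) g
  have hP : IsProbabilityMeasure P := hB.isGaussianProcess.isProbabilityMeasure
  let W : TimeInterval → Ω → ℝ := fun t ω => (√n)⁻¹ * B (Real.toNNReal (t.1 + 1 / 2)) ω
  have hW : IsGaussianProcess W P :=
    (hB.isGaussianProcess.comp_right fun t : TimeInterval => Real.toNNReal (t.1 + 1 / 2)).smul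
      fun _ => (√n)⁻¹
  have hW0 : ∀ t, ∫ ω, W t ω ∂P = 0 := fun t => by
    simp only [W]
    rw [integral_const_mul, hB.integral_eval, mul_zero]
  have hmono : ∀ s t : TimeInterval, s ≤ t → cov[W s, W t; P] = inner ℝ (a s) (a t) / n := by
    intro s t hst
    have hst' : (s.1 : ℝ) ≤ t.1 := hst
    simp only [W]
    rw [covariance_const_mul_left, covariance_const_mul_right, hB.covariance_fun_eval,
      L2.real_inner_indicatorConstLp_one_indicatorConstLp_one measurableSet_Iic measurableSet_Iic
        (measure_ne_top _ _) (measure_ne_top _ _), Set.Iic_inter_Iic, min_eq_left hst,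
      timeMeasure_real_Iic, min_eq_left (Real.toNNReal_le_toNNReal (by linarith)),
      Real.coe_toNNReal _ (by linarith [s.2.1]), ← mul_assoc, ← mul_inv, Real.mul_self_sqrt hn.le]
    ring
  have hcov : ∀ s t, cov[W s, W t; P] = inner ℝ (a s) (a t) / n := by
    intro s t
    rcases le_total s t with h | h
    · exact hmono s t h
    · rw [covariance_comm, real_inner_comm]
      exact hmono t s h
  have hXm : ∀ f : TimeInterval → ℝ,
      Measurable fun ω (t : TimeInterval) => (∫ s in Set.Iic t, f s ∂timeMeasure) + W t ω :=
    fun f => measurable_pi_lambda _ fun t => ((hmeas _).const_mul _).const_add _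
  have hlaw : ∀ f : TimeInterval → ℝ, (whiteNoiseModel n P B).law f =
      P.map fun ω (t : TimeInterval) => (∫ s in Set.Iic t, f s ∂timeMeasure) + W t ω := fun f => rfl
  refine ⟨a, fun f _ => ?_, fun f hf v => ?_, fun g hg => ?_⟩
  · exact Measure.isProbabilityMeasure_map (hXm f).aemeasurable
  · have key := map_finObs_of_isGaussianProcess n hW a (hf.toLp f) hW0 hcov v
    refine Eq.trans ?_ key
    refine (Measure.map_map (measurable_finObs v) (hXm f)).trans ?_
    congr 1
    funext ω
    refine congrArg (finObs v) (funext fun t => ?_)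
    rw [hinner, setIntegral_congr_ae measurableSet_Iic
      ((MemLp.coeFn_toLp (μ := timeMeasure) hf).mono fun s hs _ => hs)]
  · have hg1 : Integrable g timeMeasure := (Lp.memLp (μ := timeMeasure) g).integrable (by norm_num)
    refine (Lp.eq_zero_iff_ae_eq_zero (μ := timeMeasure)).2
      (ae_eq_zero_of_forall_setIntegral_Iic hg1 fun t => ?_)
    exact (hinner t g).symm.trans (hg t)

/-- Both models are Gaussian shift experiments. -/
lemma IsGaussianModel.exists_isGaussianShift {n : ℝ} (hn : 0 < n) {E : Experiment}
    (hE : IsGaussianModel n E) : ∃ a, IsGaussianShift n E a := by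
  cases hE with
  | whiteNoise P B hmeas hB => exact isGaussianShift_whiteNoiseModel hn P B hmeas hB
  | sequence M => exact isGaussianShift_sequenceModel hn M

/-! ### Mean-square limits of Gaussian variables -/

section MeanSquare

variable {Ω : Type*} [MeasurableSpace Ω] {P : Measure Ω} {X : Ω → ℝ} {Y : ℕ → Ω → ℝ}

lemma memLp_two_of_tendsto (hX : AEStronglyMeasurable X P) (hY : ∀ m, MemLp (Y m) 2 P)
    (h : Tendsto (fun m => eLpNorm (X - Y m) 2 P) atTop (𝓝 0)) : MemLp X 2 P := by
  obtain ⟨m, hm⟩ := (h.eventually_lt_const ENNReal.zero_lt_top).exists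
  have h1 : MemLp (X - Y m) 2 P := ⟨hX.sub (hY m).1, hm⟩
  simpa using h1.add (hY m)

lemma integral_sq_eq_norm_toLp_sq (hX : MemLp X 2 P) : ∫ ω, X ω ^ 2 ∂P = ‖hX.toLp X‖ ^ 2 := by
  rw [← real_inner_self_eq_norm_sq, L2.inner_def]
  refine integral_congr_ae ?_
  filter_upwards [hX.coeFn_toLp] with ω hω
  rw [hω, real_inner_self_eq_norm_sq, Real.norm_eq_abs, sq_abs]

variable [IsProbabilityMeasure P]

lemma tendsto_integral_of_tendsto_two (hX : AEStronglyMeasurable X P) (hY : ∀ m, MemLp (Y m) 2 P)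
    (h : Tendsto (fun m => eLpNorm (X - Y m) 2 P) atTop (𝓝 0)) :
    Tendsto (fun m => ∫ ω, Y m ω ∂P) atTop (𝓝 (∫ ω, X ω ∂P)) := by
  refine tendsto_integral_of_L1' X hX
    (Eventually.of_forall fun m => (hY m).integrable (by norm_num)) ?_
  refine tendsto_of_tendsto_of_tendsto_of_le_of_le tendsto_const_nhds h (fun _ => zero_le)
    fun m => ?_
  rw [eLpNorm_sub_comm]
  exact eLpNorm_le_eLpNorm_of_exponent_le (by norm_num) (hX.sub (hY m).1)

lemma tendsto_variance_of_tendsto_two (hX : AEStronglyMeasurable X P) (hY : ∀ m, MemLp (Y m) 2 P)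
    (h : Tendsto (fun m => eLpNorm (X - Y m) 2 P) atTop (𝓝 0)) :
    Tendsto (fun m => Var[Y m; P]) atTop (𝓝 Var[X; P]) := by
  have hX2 := memLp_two_of_tendsto hX hY h
  have h1 : Tendsto (fun m => (hY m).toLp (Y m)) atTop (𝓝 (hX2.toLp X)) := by
    rw [Lp.tendsto_Lp_iff_tendsto_eLpNorm'']
    simpa only [eLpNorm_sub_comm] using h
  have h2 := (h1.norm.pow 2).sub ((tendsto_integral_of_tendsto_two hX hY h).pow 2)
  rw [variance_eq_sub hX2]
  simp only [Pi.pow_apply]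
  rw [integral_sq_eq_norm_toLp_sq hX2]
  refine h2.congr fun m => ?_
  rw [variance_eq_sub (hY m)]
  simp only [Pi.pow_apply]
  rw [integral_sq_eq_norm_toLp_sq (hY m)]

lemma tendsto_charFun_of_tendsto_two (hX : AEMeasurable X P) (hY : ∀ m, MemLp (Y m) 2 P)
    (h : Tendsto (fun m => eLpNorm (X - Y m) 2 P) atTop (𝓝 0)) (t : ℝ) :
    Tendsto (fun m => charFun (P.map (Y m)) t) atTop (𝓝 (charFun (P.map X) t)) := by
  have hYm : ∀ m, AEMeasurable (Y m) P := fun m => (hY m).1.aemeasurable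
  have hint : ∀ {Z : Ω → ℝ}, AEMeasurable Z P →
      charFun (P.map Z) t = ∫ ω, Complex.exp (Complex.I * ((t * Z ω : ℝ) : ℂ)) ∂P := by
    intro Z hZ
    rw [charFun_apply_real, integral_map hZ (by fun_prop)]
    refine integral_congr_ae (Eventually.of_forall fun ω => ?_)
    simp only
    congr 1
    push_cast
    ring
  rw [hint hX]
  simp only [hint (hYm _)]
  have hmeas : ∀ {Z : Ω → ℝ}, AEMeasurable Z P →
      AEStronglyMeasurable (fun ω => Complex.exp (Complex.I * ((t * Z ω : ℝ) : ℂ))) P := by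
    intro Z hZ
    exact (by fun_prop : Measurable fun x : ℝ =>
      Complex.exp (Complex.I * ((t * x : ℝ) : ℂ))).comp_aemeasurable hZ |>.aestronglyMeasurable
  refine tendsto_integral_of_L1' _ (hmeas hX) (Eventually.of_forall fun m => ?_) ?_
  · refine Integrable.of_bound (hmeas (hYm m)) 1 (Eventually.of_forall fun ω => ?_)
    rw [mul_comm, Complex.norm_exp_ofReal_mul_I]
  · have hlim : Tendsto (fun m => ENNReal.ofReal |t| * eLpNorm (X - Y m) 2 P) atTop (𝓝 0) := by
      simpa using ENNReal.Tendsto.const_mul h (Or.inr ENNReal.ofReal_ne_top)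
    refine tendsto_of_tendsto_of_tendsto_of_le_of_le tendsto_const_nhds hlim
      (fun _ => zero_le) fun m => ?_
    refine le_trans ?_ (mul_le_mul_right (eLpNorm_le_eLpNorm_of_exponent_le (p := 1)
      (by norm_num) (hX.aestronglyMeasurable.sub (hY m).1)) _)
    refine eLpNorm_le_mul_eLpNorm_of_ae_le_mul (Eventually.of_forall fun ω => ?_) 1
    simp only [Pi.sub_apply]
    have e1 : Complex.exp (Complex.I * ((t * Y m ω : ℝ) : ℂ)) -
        Complex.exp (Complex.I * ((t * X ω : ℝ) : ℂ)) =
        Complex.exp (Complex.I * ((t * X ω : ℝ) : ℂ)) *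
          (Complex.exp (Complex.I * ((t * (Y m ω - X ω) : ℝ) : ℂ)) - 1) := by
      rw [mul_sub, ← Complex.exp_add, mul_one]
      congr 2
      push_cast
      ring
    rw [e1, norm_mul, mul_comm Complex.I, Complex.norm_exp_ofReal_mul_I, one_mul]
    refine Real.norm_exp_I_mul_ofReal_sub_one_le.trans ?_
    rw [norm_mul, Real.norm_eq_abs, norm_sub_rev]

/-- A mean-square limit of Gaussian variables is Gaussian. -/
lemma hasGaussianLaw_of_tendsto_two (hX : AEMeasurable X P) (hY : ∀ m, HasGaussianLaw (Y m) P)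
    (h : Tendsto (fun m => eLpNorm (X - Y m) 2 P) atTop (𝓝 0)) : HasGaussianLaw X P := by
  have hY2 : ∀ m, MemLp (Y m) 2 P := fun m => (hY m).memLp_two
  rw [hasGaussianLaw_iff_charFun_map_eq hX]
  intro t
  refine tendsto_nhds_unique (tendsto_charFun_of_tendsto_two hX hY2 h t) ?_
  have hmul : ∀ Z : Ω → ℝ, (fun ω => inner ℝ t (Z ω)) = fun ω => t * Z ω := fun Z =>
    funext fun ω => by simp [mul_comm]
  have h1 := ((tendsto_integral_of_tendsto_two hX.aestronglyMeasurable hY2 h).const_mul t)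
  have h2 := ((tendsto_variance_of_tendsto_two hX.aestronglyMeasurable hY2 h).const_mul (t ^ 2))
  simp only [hmul, integral_const_mul, variance_const_mul]
  have h3 : Tendsto (fun m => Complex.exp (((t * ∫ ω, Y m ω ∂P : ℝ) : ℂ) * Complex.I -
      ((t ^ 2 * Var[Y m; P] : ℝ) : ℂ) / 2)) atTop (𝓝 (Complex.exp
      (((t * ∫ ω, X ω ∂P : ℝ) : ℂ) * Complex.I - ((t ^ 2 * Var[X; P] : ℝ) : ℂ) / 2))) := by
    refine (Complex.continuous_exp.tendsto _).comp ?_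
    refine Tendsto.sub (Tendsto.mul_const _ ?_) (Tendsto.div_const ?_ _)
    · exact (Complex.continuous_ofReal.tendsto _).comp h1
    · exact (Complex.continuous_ofReal.tendsto _).comp h2
  refine h3.congr fun m => ?_
  rw [(hasGaussianLaw_iff_charFun_map_eq (hY m).aemeasurable).1 (hY m) t]
  simp only [hmul, integral_const_mul, variance_const_mul]

end MeanSquare

/-! ### Linear estimators -/

section ShiftExperiment

variable {n : ℝ} {E : Experiment} {a : E.Idx → Lp ℝ 2 E.ref}

lemma IsGaussianShift.hasGaussianLaw_finObs (h : IsGaussianShift n E a) {f : E.Fn}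
    (hf : MemLp f 2 E.ref) (v : E.Idx →₀ ℝ) : HasGaussianLaw (finObs v) (E.law f) :=
  ⟨by rw [h.map_finObs f hf v]; infer_instance⟩

lemma IsGaussianShift.integral_finObs (h : IsGaussianShift n E a) {f : E.Fn}
    (hf : MemLp f 2 E.ref) (v : E.Idx →₀ ℝ) :
    ∫ y, finObs v y ∂(E.law f) = inner ℝ (Finsupp.linearCombination ℝ a v) (hf.toLp f) := by
  have := integral_map (μ := E.law f) (φ := finObs v) (f := fun x => x)
    (measurable_finObs v).aemeasurable (by fun_prop)
  rw [h.map_finObs f hf v] at this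
  exact this.symm.trans integral_id_gaussianReal

lemma IsGaussianShift.variance_finObs (hn : 0 < n) (h : IsGaussianShift n E a) {f : E.Fn}
    (hf : MemLp f 2 E.ref) (v : E.Idx →₀ ℝ) :
    Var[finObs v; E.law f] = ‖Finsupp.linearCombination ℝ a v‖ ^ 2 / n := by
  have := variance_map (μ := E.law f) (X := fun x : ℝ => x) (Y := finObs v)
    (by fun_prop) (measurable_finObs v).aemeasurable
  rw [h.map_finObs f hf v] at this
  refine this.symm.trans (variance_fun_id_gaussianReal.trans ?_)
  exact Real.coe_toNNReal _ (by positivity)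

lemma IsGaussianShift.eLpNorm_finObs_le (hn : 0 < n) (h : IsGaussianShift n E a) {f : E.Fn}
    (hf : MemLp f 2 E.ref) (v : E.Idx →₀ ℝ) :
    eLpNorm (finObs v) 2 (E.law f) ≤ ENNReal.ofReal
      (‖Finsupp.linearCombination ℝ a v‖ * √(‖hf.toLp f‖ ^ 2 + 1 / n)) := by
  have := h.isProbabilityMeasure f hf
  have hm : MemLp (finObs v) 2 (E.law f) := (h.hasGaussianLaw_finObs hf v).memLp_two
  have h1 := variance_eq_sub hm
  simp only [Pi.pow_apply] at h1
  rw [integral_sq_eq_norm_toLp_sq hm, h.variance_finObs hn hf, h.integral_finObs hf] at h1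
  have h2 : eLpNorm (finObs v) 2 (E.law f) = ENNReal.ofReal ‖hm.toLp (finObs v)‖ := by
    rw [Lp.norm_toLp, ENNReal.ofReal_toReal hm.2.ne]
  rw [h2]
  refine ENNReal.ofReal_le_ofReal ?_
  refine abs_le_of_sq_le_sq' ?_ (by positivity) |>.2
  rw [mul_pow, Real.sq_sqrt (by positivity)]
  have h3 := abs_real_inner_le_norm (Finsupp.linearCombination ℝ a v) (hf.toLp f)
  have h4 := sq_le_sq' (abs_le.1 h3).1 (abs_le.1 h3).2
  have h5 : ‖hm.toLp (finObs v)‖ ^ 2 = ‖Finsupp.linearCombination ℝ a v‖ ^ 2 / n +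
    inner ℝ (Finsupp.linearCombination ℝ a v) (hf.toLp f) ^ 2 := by linarith
  rw [h5]
  calc _ ≤ ‖Finsupp.linearCombination ℝ a v‖ ^ 2 / n +
      (‖Finsupp.linearCombination ℝ a v‖ * ‖hf.toLp f‖) ^ 2 := by linarith
    _ = _ := by ring

/-- Finite linear combinations of the vectors `a t` are dense. -/
lemma IsGaussianShift.exists_norm_sub_lt (h : IsGaussianShift n E a) (u : Lp ℝ 2 E.ref) {ε : ℝ}
    (hε : 0 < ε) : ∃ v, ‖Finsupp.linearCombination ℝ a v - u‖ < ε := by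
  have h1 : (Finsupp.linearCombination ℝ a).range.topologicalClosure = ⊤ := by
    rw [Submodule.topologicalClosure_eq_top_iff, Submodule.eq_bot_iff]
    intro g hg
    refine h.total g fun t => ?_
    refine (Submodule.mem_orthogonal _ _).1 hg _ ⟨Finsupp.single t 1, ?_⟩
    simp
  have h2 : u ∈ closure ((Finsupp.linearCombination ℝ a).range : Set (Lp ℝ 2 E.ref)) := by
    rw [← Submodule.topologicalClosure_coe, h1]
    trivial
  obtain ⟨_, ⟨v, rfl⟩, hv⟩ := Metric.mem_closure_iff.1 h2 ε hε
  exact ⟨v, by rwa [← dist_eq_norm, dist_comm]⟩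

/-- The stochastic integral `∫ u dY` of a square integrable `u`, as a measurable function of the
data: one approximating sequence of finite linear combinations serves for all `f ∈ L²`, because it
converges so fast that it converges almost surely under each of the laws. -/
lemma IsGaussianShift.exists_integral (hn : 0 < n) (h : IsGaussianShift n E a)
    (u : Lp ℝ 2 E.ref) : ∃ (τ : E.Fn → ℝ) (v : ℕ → E.Idx →₀ ℝ), Measurable τ ∧
      Tendsto (fun m => Finsupp.linearCombination ℝ a (v m)) atTop (𝓝 u) ∧
      ∀ f : E.Fn, MemLp f 2 E.ref →
        Tendsto (fun m => eLpNorm (τ - finObs (v m)) 2 (E.law f)) atTop (𝓝 0) := by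
  choose v hv using fun m : ℕ => h.exists_norm_sub_lt u (pow_pos (half_pos one_pos) m : (0:ℝ) < _)
  refine ⟨fun y => limsup (fun m => finObs (v m) y) atTop, v,
    Measurable.limsup fun m => measurable_finObs _, ?_, fun f hf => ?_⟩
  · rw [tendsto_iff_norm_sub_tendsto_zero]
    exact squeeze_zero (fun _ => norm_nonneg _) (fun m => (hv m).le)
      (tendsto_pow_atTop_nhds_zero_of_lt_one (by norm_num) (by norm_num))
  · have := h.isProbabilityMeasure f hf
    set K : ℝ := √(‖hf.toLp f‖ ^ 2 + 1 / n) with hK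
    let B : ℕ → ℝ≥0∞ := fun N => ENNReal.ofReal (2 * (K + 1) * (1 / 2 : ℝ) ^ N)
    have hK0 : 0 ≤ K := Real.sqrt_nonneg _
    have hB : ∑' N, B N ≠ ∞ := by
      have hs : Summable fun N : ℕ => 2 * (K + 1) * (1 / 2 : ℝ) ^ N :=
        (summable_geometric_of_lt_one (by norm_num) (by norm_num)).mul_left _
      rw [← ENNReal.ofReal_tsum_of_nonneg (fun N => by positivity) hs]
      exact ENNReal.ofReal_ne_top
    have hcau : ∀ N m l : ℕ, N ≤ m → N ≤ l →
        eLpNorm (finObs (v m) - finObs (v l)) 2 (E.law f) < B N := by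
      intro N m l hm hl
      have e : finObs (v m) - finObs (v l) = finObs (v m - v l) :=
        funext fun y => (finObs_sub _ _ _).symm
      rw [e]
      refine (h.eLpNorm_finObs_le hn hf _).trans_lt ?_
      refine (ENNReal.ofReal_lt_ofReal_iff (by positivity)).2 ?_
      have hd : ‖Finsupp.linearCombination ℝ a (v m - v l)‖ ≤ 2 * (1 / 2 : ℝ) ^ N := by
        have e2 : Finsupp.linearCombination ℝ a (v m - v l) =
            (Finsupp.linearCombination ℝ a (v m) - u) -
              (Finsupp.linearCombination ℝ a (v l) - u) := by
          rw [map_sub]; abel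
        rw [e2]
        have p1 : (1 / 2 : ℝ) ^ m ≤ (1 / 2 : ℝ) ^ N :=
          pow_le_pow_of_le_one (by norm_num) (by norm_num) hm
        have p2 : (1 / 2 : ℝ) ^ l ≤ (1 / 2 : ℝ) ^ N :=
          pow_le_pow_of_le_one (by norm_num) (by norm_num) hl
        linarith [norm_sub_le (Finsupp.linearCombination ℝ a (v m) - u)
          (Finsupp.linearCombination ℝ a (v l) - u), hv m, hv l]
      have hp : (0 : ℝ) < (1 / 2) ^ N := by positivity
      calc _ ≤ 2 * (1 / 2 : ℝ) ^ N * K := mul_le_mul_of_nonneg_right hd hK0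
        _ < _ := by nlinarith
    have hsm : ∀ m, AEStronglyMeasurable (finObs (v m)) (E.law f) := fun m =>
      (measurable_finObs _).aestronglyMeasurable
    have hlim := Lp.ae_tendsto_of_cauchy_eLpNorm hsm (by norm_num) hB hcau
    have hlim' : ∀ᵐ y ∂(E.law f), Tendsto (fun m => finObs (v m) y) atTop
        (𝓝 (limsup (fun m => finObs (v m) y) atTop)) := by
      filter_upwards [hlim] with y hy
      obtain ⟨l, hl⟩ := hy
      rwa [hl.limsup_eq]
    have key := Lp.cauchy_tendsto_of_tendsto hsm _ hB hcau hlim'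
    refine key.congr fun m => ?_
    rw [eLpNorm_sub_comm]

lemma IsLinearEstimator.tendsto_finObs {τ : E.Fn → ℝ} (hτ : IsLinearEstimator E τ) :
    ∃ (c : ℕ → ℝ) (w : ℕ → E.Idx →₀ ℝ), ∀ f : E.Fn, MemLp f 2 E.ref →
      Tendsto (fun m => eLpNorm (τ - fun y => c m + finObs (w m) y) 2 (E.law f)) atTop (𝓝 0) :=
  hτ.2

lemma IsGaussianShift.hasGaussianLaw_const_add_finObs (h : IsGaussianShift n E a) {f : E.Fn}
    (hf : MemLp f 2 E.ref) (c : ℝ) (v : E.Idx →₀ ℝ) :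
    HasGaussianLaw (fun y => c + finObs v y) (E.law f) := by
  constructor
  have e : (fun y => c + finObs v y) = (fun x => c + x) ∘ finObs v := rfl
  rw [e, ← Measure.map_map (by fun_prop) (measurable_finObs v), h.map_finObs f hf v,
    gaussianReal_map_const_add]
  infer_instance

lemma IsLinearEstimator.hasGaussianLaw (h : IsGaussianShift n E a) {τ : E.Fn → ℝ}
    (hτ : IsLinearEstimator E τ) {f : E.Fn} (hf : MemLp f 2 E.ref) :
    HasGaussianLaw τ (E.law f) := by
  have := h.isProbabilityMeasure f hf
  obtain ⟨c, w, hcw⟩ := hτ.tendsto_finObs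
  exact hasGaussianLaw_of_tendsto_two hτ.1.aemeasurable
    (fun m => h.hasGaussianLaw_const_add_finObs hf (c m) (w m)) (hcw f hf)

lemma IsLinearEstimator.add {τ σ : E.Fn → ℝ} (hτ : IsLinearEstimator E τ)
    (hσ : IsLinearEstimator E σ) : IsLinearEstimator E (fun y => τ y + σ y) := by
  obtain ⟨c, w, hcw⟩ := hτ.tendsto_finObs
  obtain ⟨d, x, hdx⟩ := hσ.tendsto_finObs
  refine ⟨hτ.1.add hσ.1, fun m => c m + d m, fun m => w m + x m, fun f hf => ?_⟩
  have h0 := (hcw f hf).add (hdx f hf)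
  rw [add_zero] at h0
  refine tendsto_of_tendsto_of_tendsto_of_le_of_le tendsto_const_nhds h0 (fun _ => zero_le)
    fun m => ?_
  have e : (fun y => τ y + σ y - (c m + d m + finObs (w m + x m) y)) =
      (τ - fun y => c m + finObs (w m) y) + (σ - fun y => d m + finObs (x m) y) := by
    funext y
    simp only [Pi.add_apply, Pi.sub_apply, finObs_add]
    ring
  have hm : ∀ {ρ : E.Fn → ℝ} (r : ℝ) (z : E.Idx →₀ ℝ), Measurable ρ →
      AEStronglyMeasurable (ρ - fun y => r + finObs z y) (E.law f) := fun r z hρ =>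
    (hρ.sub ((measurable_finObs z).const_add r)).aestronglyMeasurable
  refine (le_of_eq (congrArg (fun g => eLpNorm g 2 (E.law f)) e)).trans ?_
  exact eLpNorm_add_le (hm _ _ hτ.1) (hm _ _ hσ.1) (by norm_num)

lemma IsLinearEstimator.const_mul {τ : E.Fn → ℝ} (hτ : IsLinearEstimator E τ) (r : ℝ) :
    IsLinearEstimator E (fun y => r * τ y) := by
  obtain ⟨c, w, hcw⟩ := hτ.tendsto_finObs
  refine ⟨hτ.1.const_mul r, fun m => r * c m, fun m => r • w m, fun f hf => ?_⟩
  have h0 := ENNReal.Tendsto.const_mul (a := ‖r‖ₑ) (hcw f hf) (Or.inr enorm_ne_top)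
  rw [mul_zero] at h0
  refine h0.congr fun m => ?_
  have e : (fun y => r * τ y - (r * c m + finObs (r • w m) y)) =
      r • (τ - fun y => c m + finObs (w m) y) := by
    funext y
    simp only [Pi.smul_apply, Pi.sub_apply, finObs_smul, smul_eq_mul]
    ring
  refine Eq.trans ?_ (congrArg (fun g => eLpNorm g 2 (E.law f)) e).symm
  rw [eLpNorm_const_smul]

end ShiftExperiment

/-! ### Normal tails and quantiles -/

/-- The upper tail `Q t = 1 - Φ t` of the standard normal distribution. -/
noncomputable def gaussianTail (t : ℝ) : ℝ := (gaussianReal 0 1).real (Set.Ioi t)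

lemma gaussianTail_nonneg (t : ℝ) : 0 ≤ gaussianTail t := measureReal_nonneg

lemma ofReal_gaussianTail (t : ℝ) :
    ENNReal.ofReal (gaussianTail t) = gaussianReal 0 1 (Set.Ioi t) := by
  rw [gaussianTail, Measure.real, ENNReal.ofReal_toReal (measure_ne_top _ _)]

lemma gaussianTail_anti : Antitone gaussianTail := fun _ _ h =>
  measureReal_mono (Set.Ioi_subset_Ioi h)

lemma one_sub_cdf_gaussianReal (t : ℝ) : 1 - cdf (gaussianReal 0 1) t = gaussianTail t := by
  rw [cdf_eq_real, gaussianTail, ← Set.compl_Iic, probReal_compl_eq_one_sub measurableSet_Iic]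

lemma gaussianTail_eq_integral (t : ℝ) :
    gaussianTail t = ∫ x in Set.Ioi t, gaussianPDFReal 0 1 x := by
  rw [gaussianTail, Measure.real, gaussianReal_apply_eq_integral _ one_ne_zero,
    ENNReal.toReal_ofReal (integral_nonneg fun x => gaussianPDFReal_nonneg 0 1 x)]

lemma gaussianPDFReal_std (x : ℝ) :
    gaussianPDFReal 0 1 x = (√(2 * Real.pi))⁻¹ * Real.exp (-x ^ 2 / 2) := by
  simp [gaussianPDFReal]

lemma gaussianTail_sub {x y : ℝ} (h : x ≤ y) :
    gaussianTail x - gaussianTail y = ∫ t in x..y, gaussianPDFReal 0 1 t := by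
  have hi : Integrable (gaussianPDFReal 0 1) := integrable_gaussianPDFReal 0 1
  rw [gaussianTail_eq_integral, gaussianTail_eq_integral, ← Set.Ioc_union_Ioi_eq_Ioi h,
    setIntegral_union (Set.Ioc_disjoint_Ioi le_rfl) measurableSet_Ioi hi.integrableOn
      hi.integrableOn, intervalIntegral.integral_of_le h]
  ring

lemma inv_sqrt_two_pi_lt : (√(2 * Real.pi))⁻¹ < 0.3994 := by
  have h : (2.504 : ℝ) < √(2 * Real.pi) := by
    rw [Real.lt_sqrt (by norm_num)]
    nlinarith [Real.pi_gt_d2]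
  calc (√(2 * Real.pi))⁻¹ < (2.504 : ℝ)⁻¹ := inv_strictAnti₀ (by norm_num) h
    _ < 0.3994 := by norm_num

lemma exp_neg_le_quadratic {u : ℝ} (hu : 0 ≤ u) : Real.exp (-u) ≤ 1 - u + u ^ 2 / 2 := by
  rw [Real.exp_neg]
  have h1 := Real.quadratic_le_exp_of_nonneg hu
  have h2 : 0 < 1 - u + u ^ 2 / 2 := by nlinarith [sq_nonneg (u - 1)]
  rw [inv_le_comm₀ (Real.exp_pos u) h2]
  refine le_trans ?_ h1
  rw [inv_le_iff_one_le_mul₀ h2]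
  nlinarith [sq_nonneg (u ^ 2)]

lemma gaussianTail_sub_le {x y : ℝ} (h : x ≤ y) : gaussianTail x - gaussianTail y ≤ y - x := by
  rw [gaussianTail_sub h]
  have h1 : ∫ t in x..y, gaussianPDFReal 0 1 t ≤ ∫ _t in x..y, (1 : ℝ) := by
    refine intervalIntegral.integral_mono_on h
      (integrable_gaussianPDFReal 0 1).intervalIntegrable (by simp) fun t _ => ?_
    rw [gaussianPDFReal_std]
    have h2 := inv_sqrt_two_pi_lt
    have h3 : Real.exp (-t ^ 2 / 2) ≤ 1 := Real.exp_le_one_iff.2 (by nlinarith [sq_nonneg t])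
    have h4 := Real.exp_pos (-t ^ 2 / 2)
    have h5 : 0 ≤ (√(2 * Real.pi))⁻¹ := by positivity
    nlinarith
  simpa using h1

lemma continuous_gaussianTail : Continuous gaussianTail := by
  refine LipschitzWith.continuous (K := 1) (LipschitzWith.of_le_add fun x y => ?_)
  rcases le_total x y with h | h
  · have := gaussianTail_sub_le h
    rw [Real.dist_eq, abs_sub_comm, abs_of_nonneg (by linarith)]
    linarith
  · linarith [gaussianTail_anti h, dist_nonneg (x := x) (y := y)]

lemma gaussianTail_zero : gaussianTail 0 = 1 / 2 := by
  have h1 : gaussianReal 0 1 (Set.Ioi 0) = gaussianReal 0 1 (Set.Iio 0) := by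
    conv_lhs => rw [← neg_zero, ← gaussianReal_map_neg (μ := 0) (v := 1), neg_zero]
    rw [Measure.map_apply measurable_neg measurableSet_Ioi]
    congr 1
    ext x
    simp
  have : NullSingletonClass (gaussianReal 0 1) := nullSingletonClass_gaussianReal one_ne_zero
  have h2 : gaussianReal 0 1 (Set.Iio 0) = gaussianReal 0 1 (Set.Iic 0) :=
    measure_congr Iio_ae_eq_Iic
  have h3 := one_sub_cdf_gaussianReal 0
  rw [cdf_eq_real, Measure.real, ← h2, ← h1] at h3
  change 1 - gaussianTail 0 = gaussianTail 0 at h3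
  linarith

/-- The numerical fact behind `z_p ≥ 5/4` for `p ≤ 1/10`. -/
lemma gaussianTail_five_fourths : 1 / 10 < gaussianTail (5 / 4) := by
  have h := gaussianTail_sub (x := 0) (y := 5 / 4) (by norm_num)
  rw [gaussianTail_zero] at h
  have h1 : ∫ t in (0:ℝ)..(5 / 4), gaussianPDFReal 0 1 t ≤
      ∫ t in (0:ℝ)..(5 / 4), 0.3994 * (1 - t ^ 2 / 2 + t ^ 4 / 8) := by
    refine intervalIntegral.integral_mono_on (by norm_num)
      (integrable_gaussianPDFReal 0 1).intervalIntegrable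
      (Continuous.intervalIntegrable (by fun_prop) _ _) fun t _ => ?_
    rw [gaussianPDFReal_std]
    have e1 : Real.exp (-t ^ 2 / 2) ≤ 1 - t ^ 2 / 2 + t ^ 4 / 8 := by
      have := exp_neg_le_quadratic (u := t ^ 2 / 2) (by positivity)
      calc _ = Real.exp (-(t ^ 2 / 2)) := by ring_nf
        _ ≤ _ := this
        _ = _ := by ring
    exact mul_le_mul inv_sqrt_two_pi_lt.le e1 (Real.exp_pos _).le (by norm_num)
  have h2 : ∫ t in (0:ℝ)..(5 / 4), 0.3994 * (1 - t ^ 2 / 2 + t ^ 4 / 8) =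
      0.3994 * (5 / 4 - (5 / 4) ^ 3 / 6 + (5 / 4) ^ 5 / 40) := by
    rw [intervalIntegral.integral_const_mul, intervalIntegral.integral_add
      (Continuous.intervalIntegrable (by fun_prop) _ _)
      (Continuous.intervalIntegrable (by fun_prop) _ _), intervalIntegral.integral_sub
      (Continuous.intervalIntegrable (by fun_prop) _ _)
      (Continuous.intervalIntegrable (by fun_prop) _ _)]
    simp only [intervalIntegral.integral_div, integral_pow, intervalIntegral.integral_const]
    norm_num
  rw [h2] at h1
  norm_num at h1 h ⊢
  linarith

/-- A shift of the argument by `δ` costs at least the factor `exp (-z δ - δ² / 2)`. -/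
lemma gaussianTail_add_le (z : ℝ) {δ : ℝ} (hδ : 0 ≤ δ) :
    gaussianTail (z + δ) ≤ Real.exp (-(z * δ) - δ ^ 2 / 2) * gaussianTail z := by
  have hi : Integrable (gaussianPDFReal 0 1) := integrable_gaussianPDFReal 0 1
  have h1 : gaussianTail (z + δ) = ∫ x in Set.Ioi z, gaussianPDFReal 0 1 (x + δ) := by
    rw [gaussianTail_eq_integral]
    have h2 := (measurePreserving_add_right (volume : Measure ℝ) δ).setIntegral_preimage_emb
      (measurableEmbedding_addRight δ) (gaussianPDFReal 0 1) (Set.Ioi (z + δ))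
    rw [← h2]
    congr 2
    ext x
    simp
  rw [h1, gaussianTail_eq_integral, ← integral_const_mul]
  refine setIntegral_mono_on (hi.comp_add_right δ).integrableOn
    (hi.const_mul _).integrableOn measurableSet_Ioi fun x hx => ?_
  rw [gaussianPDFReal_std, gaussianPDFReal_std, ← mul_assoc, mul_comm (Real.exp _), mul_assoc,
    ← Real.exp_add]
  refine mul_le_mul_of_nonneg_left (Real.exp_le_exp.2 ?_) (by positivity)
  have : z < x := hx
  nlinarith

lemma tendsto_gaussianTail_atTop : Tendsto gaussianTail atTop (𝓝 0) := by
  have := (tendsto_cdf_atTop (gaussianReal 0 1)).const_sub 1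
  simpa [one_sub_cdf_gaussianReal] using this

lemma tendsto_gaussianTail_atBot : Tendsto gaussianTail atBot (𝓝 1) := by
  have := (tendsto_cdf_atBot (gaussianReal 0 1)).const_sub 1
  simpa [one_sub_cdf_gaussianReal] using this

/-- `z_p` is the upper `p`-quantile. -/
lemma gaussianTail_upperQuantile {p : ℝ} (hp0 : 0 < p) (hp1 : p < 1) :
    gaussianTail (upperQuantile p) = p := by
  have hset : {x : ℝ | 1 - p ≤ cdf (gaussianReal 0 1) x} = {x | gaussianTail x ≤ p} := by
    ext x
    simp only [Set.mem_ofPred_eq, ← one_sub_cdf_gaussianReal]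
    constructor <;> intro h <;> linarith
  have hz : upperQuantile p = sInf {x | gaussianTail x ≤ p} := by rw [upperQuantile, hset]
  have hne : {x | gaussianTail x ≤ p}.Nonempty :=
    (tendsto_gaussianTail_atTop.eventually_le_const hp0).exists
  obtain ⟨b, hb⟩ := (tendsto_gaussianTail_atBot.eventually_const_lt hp1).exists
  have hbdd : BddBelow {x | gaussianTail x ≤ p} := by
    refine ⟨b, fun x hx => ?_⟩
    by_contra hxb
    have := gaussianTail_anti (not_le.1 hxb).le
    exact absurd (hb.trans_le this) (not_lt.2 hx)
  have hmem : gaussianTail (upperQuantile p) ≤ p := by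
    rw [hz]
    exact (isClosed_le continuous_gaussianTail continuous_const).csInf_mem hne hbdd
  refine le_antisymm hmem ?_
  have ht : Tendsto gaussianTail (𝓝[<] upperQuantile p) (𝓝 (gaussianTail (upperQuantile p))) :=
    continuous_gaussianTail.continuousAt.tendsto.mono_left nhdsWithin_le_nhds
  refine ge_of_tendsto ht ?_
  filter_upwards [self_mem_nhdsWithin] with x hx
  by_contra hxp
  have h1 : upperQuantile p ≤ x := by rw [hz]; exact csInf_le hbdd (not_le.1 hxp).le
  exact absurd hx (not_lt.2 h1)

lemma upperQuantile_pos {p : ℝ} (hp0 : 0 < p) (hp1 : p < 1 / 2) : 0 < upperQuantile p := by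
  by_contra h
  have := gaussianTail_anti (not_lt.1 h)
  rw [gaussianTail_zero, gaussianTail_upperQuantile hp0 (by linarith)] at this
  linarith

lemma upperQuantile_le_upperQuantile {p q : ℝ} (hp : 0 < p) (hpq : p < q) (hq : q < 1) :
    upperQuantile q ≤ upperQuantile p := by
  by_contra h
  have := gaussianTail_anti (not_le.1 h).le
  rw [gaussianTail_upperQuantile hp (by linarith),
    gaussianTail_upperQuantile (hp.trans hpq) hq] at this
  linarith

lemma five_fourths_le_upperQuantile {p : ℝ} (hp0 : 0 < p) (hp1 : p ≤ 1 / 10) :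
    5 / 4 ≤ upperQuantile p := by
  by_contra h
  have := gaussianTail_anti (not_le.1 h).le
  rw [gaussianTail_upperQuantile hp0 (by linarith)] at this
  linarith [gaussianTail_five_fourths]

/-- Tail bound for a Gaussian variable, possibly degenerate, with standard deviation at most `σ`. -/
lemma HasGaussianLaw.measure_ge_le {Ω : Type*} [MeasurableSpace Ω] {P : Measure Ω} {X : Ω → ℝ}
    (hX : HasGaussianLaw X P) {σ t c : ℝ} (hσ : 0 < σ) (ht : 0 < t) (hvar : Var[X; P] ≤ σ ^ 2)
    (hc : (∫ ω, X ω ∂P) + t * σ ≤ c) : P {ω | c ≤ X ω} ≤ ENNReal.ofReal (gaussianTail t) := by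
  have hmap := hX.map_eq_gaussianReal
  set m := ∫ ω, X ω ∂P
  set v := Var[X; P].toNNReal with hv
  have h1 : P {ω | c ≤ X ω} = gaussianReal m v (Set.Ici c) := by
    rw [← hmap, Measure.map_apply_of_aemeasurable hX.aemeasurable measurableSet_Ici]
    rfl
  rw [h1]
  by_cases hv0 : v = 0
  · rw [hv0, gaussianReal_zero_var, Measure.dirac_apply' _ measurableSet_Ici]
    have : m ∉ Set.Ici c := by
      simp only [Set.mem_Ici, not_le]
      nlinarith [mul_pos ht hσ]
    simp [this]
  · have hvpos : (0 : ℝ) < v := by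
      have : 0 < v := pos_iff_ne_zero.2 hv0
      exact_mod_cast this
    have hsd : √(v : ℝ) ≤ σ := by
      rw [Real.sqrt_le_left hσ.le, hv, Real.coe_toNNReal _ (variance_nonneg _ _)]
      exact hvar
    have hsd0 : 0 < √(v : ℝ) := Real.sqrt_pos.2 hvpos
    have h2 : gaussianReal m v = (gaussianReal 0 1).map (fun x => m + √(v : ℝ) * x) := by
      have e : (fun x => m + √(v : ℝ) * x) = (fun x => m + x) ∘ fun x => √(v : ℝ) * x := rfl
      rw [e, ← Measure.map_map (by fun_prop) (by fun_prop), gaussianReal_map_const_mul,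
        gaussianReal_map_const_add]
      congr 1
      · simp
      · ext
        simp [Real.sq_sqrt hvpos.le]
    have : NullSingletonClass (gaussianReal 0 1) := nullSingletonClass_gaussianReal one_ne_zero
    rw [h2, Measure.map_apply (by fun_prop) measurableSet_Ici, ofReal_gaussianTail,
      measure_congr (Ioi_ae_eq_Ici (μ := gaussianReal 0 1) (a := t))]
    refine measure_mono fun x hx => ?_
    have hx' : c ≤ m + √(v : ℝ) * x := hx
    rw [Set.mem_Ici]
    by_contra hxt
    push Not at hxt
    nlinarith

/-! ### Change of the parameter in one direction -/

/-- Finite measures on a product space are determined by the laws of the finite linear combinations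
of the coordinates. -/
lemma ext_of_map_finObs {ι : Type*} {μ ν : Measure (ι → ℝ)} [IsFiniteMeasure μ] [IsFiniteMeasure ν]
    (h : ∀ v : ι →₀ ℝ, μ.map (finObs v) = ν.map (finObs v)) : μ = ν := by
  classical
  refine IsProjectiveLimit.unique (P := fun I => μ.map I.restrict) (fun I => rfl) fun I => ?_
  refine (Measure.ext_of_charFunDual (funext fun L => ?_)).symm
  have hL : L ∘ I.restrict = finObs (∑ i : I, Finsupp.single (i : ι) (L (Pi.single i 1))) := by
    funext y
    have h1 : ∀ s : Finset I, finObs (∑ i ∈ s, Finsupp.single (i : ι) (L (Pi.single i 1))) y =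
        ∑ i ∈ s, L (Pi.single i 1) * y i := by
      intro s
      induction s using Finset.induction_on with
      | empty => simp [finObs]
      | insert i s hi ih =>
        rw [Finset.sum_insert hi, Finset.sum_insert hi, finObs_add, ih]
        simp [finObs]
    rw [h1, Function.comp_apply]
    conv_lhs => rw [← Finset.univ_sum_single (I.restrict y)]
    rw [map_sum]
    refine Finset.sum_congr rfl fun i _ => ?_
    have : (Pi.single i (I.restrict y i) : I → ℝ) = y i • (Pi.single i 1 : I → ℝ) := by
      rw [← Pi.single_smul, smul_eq_mul, mul_one]
      rfl
    rw [this, map_smul, smul_eq_mul, mul_comm]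
  rw [charFunDual_eq_charFun_map_one, charFunDual_eq_charFun_map_one,
    Measure.map_map (by fun_prop) (by fun_prop), Measure.map_map (by fun_prop) (by fun_prop), hL,
    h]

section ShiftExperiment

variable {n : ℝ} {E : Experiment} {a : E.Idx → Lp ℝ 2 E.ref}

/-- `τ` is the stochastic integral `∫ u dY`: a mean-square limit, at every `f ∈ L²`, of finite
linear combinations of the data whose coefficient vectors converge to `u`. -/
def IsStochasticIntegral (a : E.Idx → Lp ℝ 2 E.ref) (u : Lp ℝ 2 E.ref) (τ : E.Fn → ℝ) : Prop :=
  Measurable τ ∧ ∃ v : ℕ → E.Idx →₀ ℝ,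
    Tendsto (fun m => Finsupp.linearCombination ℝ a (v m)) atTop (𝓝 u) ∧
      ∀ f : E.Fn, MemLp f 2 E.ref →
        Tendsto (fun m => eLpNorm (τ - finObs (v m)) 2 (E.law f)) atTop (𝓝 0)

lemma IsGaussianShift.exists_isStochasticIntegral (hn : 0 < n) (h : IsGaussianShift n E a)
    (u : Lp ℝ 2 E.ref) : ∃ τ, IsStochasticIntegral a u τ := by
  obtain ⟨τ, v, h1, h2, h3⟩ := h.exists_integral hn u
  exact ⟨τ, h1, v, h2, h3⟩

lemma IsStochasticIntegral.isLinearEstimator {u : Lp ℝ 2 E.ref} {τ : E.Fn → ℝ}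
    (hτ : IsStochasticIntegral a u τ) (c : ℝ) : IsLinearEstimator E (fun y => c + τ y) := by
  obtain ⟨h1, v, -, h3⟩ := hτ
  refine ⟨h1.const_add c, fun _ => c, v, fun f hf => (h3 f hf).congr fun m => ?_⟩
  congr 1
  funext y
  simp only [Pi.sub_apply, finObs]
  ring

/-- Joint Gaussian law of finitely many observations and a stochastic integral. -/
lemma IsStochasticIntegral.map_finObs_add (hn : 0 < n) (h : IsGaussianShift n E a)
    {u : Lp ℝ 2 E.ref} {τ : E.Fn → ℝ} (hτ : IsStochasticIntegral a u τ) {f : E.Fn}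
    (hf : MemLp f 2 E.ref) (w : E.Idx →₀ ℝ) (r : ℝ) :
    (E.law f).map (fun y => finObs w y + r * τ y) =
      gaussianReal (inner ℝ (Finsupp.linearCombination ℝ a w + r • u) (hf.toLp f))
        (‖Finsupp.linearCombination ℝ a w + r • u‖ ^ 2 / n).toNNReal := by
  have := h.isProbabilityMeasure f hf
  obtain ⟨h1, v, h2, h3⟩ := hτ
  have hm : Measurable fun y => finObs w y + r * τ y := (measurable_finObs w).add (h1.const_mul r)
  have hlim : Tendsto (fun m => eLpNorm ((fun y => finObs w y + r * τ y) - finObs (w + r • v m)) 2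
      (E.law f)) atTop (𝓝 0) := by
    have h0 := ENNReal.Tendsto.const_mul (a := ‖r‖ₑ) (h3 f hf) (Or.inr enorm_ne_top)
    rw [mul_zero] at h0
    refine h0.congr fun m => ?_
    rw [← eLpNorm_const_smul]
    congr 1
    funext y
    simp only [Pi.smul_apply, Pi.sub_apply, finObs_add, finObs_smul, smul_eq_mul]
    ring
  have hY := fun m => h.hasGaussianLaw_finObs hf (w + r • v m)
  have hG := hasGaussianLaw_of_tendsto_two hm.aemeasurable hY hlim
  have hA : Tendsto (fun m => Finsupp.linearCombination ℝ a (w + r • v m)) atTop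
      (𝓝 (Finsupp.linearCombination ℝ a w + r • u)) := by
    simp only [map_add, map_smul]
    exact (h2.const_smul r).const_add _
  have hmean := tendsto_nhds_unique
    (tendsto_integral_of_tendsto_two hm.aestronglyMeasurable (fun m => (hY m).memLp_two) hlim)
    ((hA.inner tendsto_const_nhds).congr fun m => (h.integral_finObs hf _).symm)
  have hvar := tendsto_nhds_unique
    (tendsto_variance_of_tendsto_two hm.aestronglyMeasurable (fun m => (hY m).memLp_two) hlim)
    (((hA.norm.pow 2).div_const n).congr fun m => (h.variance_finObs hn hf _).symm)
  rw [hG.map_eq_gaussianReal, hmean, hvar]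

lemma IsStochasticIntegral.map_eq (hn : 0 < n) (h : IsGaussianShift n E a)
    {u : Lp ℝ 2 E.ref} {τ : E.Fn → ℝ} (hτ : IsStochasticIntegral a u τ) {f : E.Fn}
    (hf : MemLp f 2 E.ref) :
    (E.law f).map τ = gaussianReal (inner ℝ u (hf.toLp f)) (‖u‖ ^ 2 / n).toNNReal := by
  have := hτ.map_finObs_add hn h hf 0 1
  simpa [finObs] using this

/-- Resolution of the data along a unit vector `e`: if `f - g` is a multiple of `e`, then the law at
`f` is that of `X e + R`, where `X` is normal with mean `⟪e, f⟫` and `R`, independent of `X`,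
is distributed as the part orthogonal to `e` of the data at `g`. -/
lemma IsGaussianShift.law_eq_map_prod (hn : 0 < n) (h : IsGaussianShift n E a)
    {e : Lp ℝ 2 E.ref} (he : ‖e‖ = 1) {τ : E.Fn → ℝ} (hτ : IsStochasticIntegral a e τ)
    {f g : E.Fn} (hf : MemLp f 2 E.ref) (hg : MemLp g 2 E.ref) {s : ℝ}
    (hfg : hf.toLp f = hg.toLp g + s • e) :
    E.law f = ((gaussianReal (inner ℝ e (hf.toLp f)) (1 / n).toNNReal).prod
      ((E.law g).map fun y t => y t - τ y * inner ℝ (a t) e)).map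
        fun p t => p.1 * inner ℝ (a t) e + p.2 t := by
  have := h.isProbabilityMeasure f hf
  have := h.isProbabilityMeasure g hg
  have hmR : Measurable fun (y : E.Fn) (t : E.Idx) => y t - τ y * inner ℝ (a t) e :=
    measurable_pi_lambda _ fun t => (measurable_pi_apply t).sub (hτ.1.mul_const _)
  have hmp : Measurable fun (p : ℝ × E.Fn) (t : E.Idx) => p.1 * inner ℝ (a t) e + p.2 t :=
    measurable_pi_lambda _ fun t =>
      (measurable_fst.mul_const _).add ((measurable_pi_apply t).comp measurable_snd)
  have hprobR : IsProbabilityMeasure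
      ((E.law g).map fun y t => y t - τ y * inner ℝ (a t) e) :=
    Measure.isProbabilityMeasure_map hmR.aemeasurable
  have hprobP := Measure.isProbabilityMeasure_map (μ := (gaussianReal (inner ℝ e (hf.toLp f))
    (1 / n).toNNReal).prod ((E.law g).map fun y t => y t - τ y * inner ℝ (a t) e)) hmp.aemeasurable
  refine ext_of_map_finObs fun v => ?_
  set u := Finsupp.linearCombination ℝ a v with hu
  set M : ℝ := inner ℝ u e with hM
  have hsum : ∀ r : ℝ, (finObs v fun t => r * inner ℝ (a t) e) = r * M := by
    intro r
    rw [hM, hu, finObs, Finsupp.sum, Finsupp.linearCombination_apply, Finsupp.sum, sum_inner,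
      Finset.mul_sum]
    refine Finset.sum_congr rfl fun t _ => ?_
    rw [real_inner_smul_left]
    ring
  have hadd : ∀ y z : E.Fn, finObs v (fun t => y t + z t) = finObs v y + finObs v z := by
    intro y z
    simp only [finObs, Finsupp.sum, mul_add, Finset.sum_add_distrib]
  have hcomp : (finObs v ∘ fun (p : ℝ × E.Fn) (t : E.Idx) => p.1 * inner ℝ (a t) e + p.2 t) =
      (fun q : ℝ × ℝ => q.1 + q.2) ∘ Prod.map (fun x => x * M) (finObs v) := by
    funext p
    simp only [Function.comp, Prod.map]
    rw [← hsum]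
    exact hadd _ _
  have hcompR : (finObs v ∘ fun (y : E.Fn) (t : E.Idx) => y t - τ y * inner ℝ (a t) e) =
      fun y => finObs v y + (-M) * τ y := by
    funext y
    have h1 := hadd y fun t => (-τ y) * inner ℝ (a t) e
    rw [hsum] at h1
    have e1 : (fun t => y t - τ y * inner ℝ (a t) e) =
      fun t => y t + (-τ y) * inner ℝ (a t) e := funext fun t => by ring
    simp only [Function.comp]
    rw [e1, h1]
    ring
  rw [h.map_finObs f hf v, Measure.map_map (measurable_finObs v) hmp, hcomp,
    ← Measure.map_map (by fun_prop) (by fun_prop),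
    ← Measure.map_prod_map _ _ (by fun_prop) (by fun_prop), gaussianReal_map_mul_const,
    Measure.map_map (measurable_finObs v) hmR, hcompR, hτ.map_finObs_add hn h hg]
  have hconv := gaussianReal_conv_gaussianReal (m₁ := M * inner ℝ e (hf.toLp f))
    (m₂ := inner ℝ (u + (-M) • e) (hg.toLp g))
    (v₁ := .mk (M ^ 2) (sq_nonneg _) * (1 / n).toNNReal)
    (v₂ := (‖u + (-M) • e‖ ^ 2 / n).toNNReal)
  rw [Measure.conv] at hconv
  rw [hconv]
  congr 1
  · rw [hfg, inner_add_right, inner_add_left, real_inner_smul_left, inner_add_right,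
      real_inner_smul_right, real_inner_smul_right, real_inner_self_eq_norm_sq, he]
    ring
  · ext
    rw [NNReal.coe_add, NNReal.coe_mul, Real.coe_toNNReal _ (by positivity),
      Real.coe_toNNReal _ (by positivity), Real.coe_toNNReal _ (by positivity), NNReal.coe_mk,
      norm_add_sq_real, norm_smul, he, real_inner_smul_right, ← hM]
    simp only [norm_neg, Real.norm_eq_abs, mul_one, sq_abs]
    ring

end ShiftExperiment

/-! ### The Neyman–Pearson bound -/

lemma gaussianPDFReal_eq_mul_exp (c δ : ℝ) {s : ℝ≥0} (x : ℝ) :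
    gaussianPDFReal c s x =
      Real.exp ((δ ^ 2 - 2 * δ * (x - c)) / (2 * s)) * gaussianPDFReal (c + δ) s x := by
  rw [gaussianPDFReal, gaussianPDFReal, mul_left_comm, ← Real.exp_add]
  congr 2
  ring

/-- The Neyman–Pearson lemma for the shift `c ↦ c + δ` of a normal law, in Lagrangian form: the
likelihood ratio is monotone, so half-lines are the optimal tests. -/
lemma gaussianReal_neymanPearson (c t : ℝ) {δ : ℝ} (hδ : 0 ≤ δ) {s : ℝ≥0} (hs : s ≠ 0) {B : Set ℝ}
    (hB : MeasurableSet B) :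
    gaussianReal c s (Set.Ioi t) +
        ENNReal.ofReal (Real.exp ((δ ^ 2 - 2 * δ * (t - c)) / (2 * s))) * gaussianReal (c + δ) s B ≤
      gaussianReal c s B + ENNReal.ofReal (Real.exp ((δ ^ 2 - 2 * δ * (t - c)) / (2 * s))) *
        gaussianReal (c + δ) s (Set.Ioi t) := by
  set lam := ENNReal.ofReal (Real.exp ((δ ^ 2 - 2 * δ * (t - c)) / (2 * s))) with hlam
  have hspos : (0 : ℝ) < s := by
    have : 0 < s := pos_iff_ne_zero.2 hs
    exact_mod_cast this
  have hdens : ∀ x, gaussianPDF c s x =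
      ENNReal.ofReal (Real.exp ((δ ^ 2 - 2 * δ * (x - c)) / (2 * s))) *
        gaussianPDF (c + δ) s x := fun x => by
    rw [gaussianPDF, gaussianPDF, ← ENNReal.ofReal_mul (Real.exp_pos _).le,
      gaussianPDFReal_eq_mul_exp c δ]
  have hle : ∀ x, x ≤ t → lam * gaussianPDF (c + δ) s x ≤ gaussianPDF c s x := fun x hx => by
    rw [hdens x]
    refine mul_le_mul_left (ENNReal.ofReal_le_ofReal (Real.exp_le_exp.2 ?_)) _
    gcongr
  have hge : ∀ x, t ≤ x → gaussianPDF c s x ≤ lam * gaussianPDF (c + δ) s x := fun x hx => by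
    rw [hdens x]
    refine mul_le_mul_left (ENNReal.ofReal_le_ofReal (Real.exp_le_exp.2 ?_)) _
    gcongr
  have happ : ∀ (m : ℝ) {A : Set ℝ}, MeasurableSet A →
      gaussianReal m s A = ∫⁻ x, A.indicator (gaussianPDF m s) x := fun m A hA => by
    rw [gaussianReal_apply m hs, lintegral_indicator hA]
  have hmeas : ∀ (m : ℝ) {A : Set ℝ}, MeasurableSet A →
      Measurable (A.indicator (gaussianPDF m s)) := fun m A hA =>
    (measurable_gaussianPDF m s).indicator hA
  rw [happ c measurableSet_Ioi, happ _ hB, happ c hB, happ _ measurableSet_Ioi,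
    ← lintegral_const_mul _ (hmeas _ hB), ← lintegral_const_mul _ (hmeas _ measurableSet_Ioi),
    ← lintegral_add_left (hmeas _ measurableSet_Ioi), ← lintegral_add_left (hmeas _ hB)]
  refine lintegral_mono fun x => ?_
  by_cases h1 : x ∈ B <;> by_cases h2 : x ∈ Set.Ioi t
  · simp [h1, h2]
  · simpa [h1, h2] using hle x (not_lt.1 h2)
  · simpa [h1, h2] using hge x (le_of_lt h2)
  · simp [h1, h2]

lemma gaussianReal_Ioi (c t : ℝ) {σ : ℝ} (hσ : 0 < σ) :
    gaussianReal c (σ ^ 2).toNNReal (Set.Ioi t) = ENNReal.ofReal (gaussianTail ((t - c) / σ)) := by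
  have h2 : gaussianReal c (σ ^ 2).toNNReal = (gaussianReal 0 1).map (fun x => c + σ * x) := by
    have e : (fun x => c + σ * x) = (fun x => c + x) ∘ fun x => σ * x := rfl
    rw [e, ← Measure.map_map (by fun_prop) (by fun_prop), gaussianReal_map_const_mul,
      gaussianReal_map_const_add]
    congr 1
    · simp
    · ext
      simp [Real.coe_toNNReal _ (sq_nonneg σ)]
  rw [h2, Measure.map_apply (by fun_prop) measurableSet_Ioi, ofReal_gaussianTail]
  congr 1
  ext x
  simp only [Set.mem_preimage, Set.mem_Ioi]
  rw [div_lt_iff₀ hσ, sub_lt_iff_lt_add', mul_comm]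

/-- A test which depends on a normal observation with standard deviation `σ` and on an independent
randomization: if it has power at least `p` at `c + δ`, with `δ ≤ σ z_{1 - p}`, then it has level
at least `1 / 2` at `c`. -/
lemma half_le_prod_of_le {S : Type*} [MeasurableSpace S] (ρ : Measure S) [IsProbabilityMeasure ρ]
    (c : ℝ) {δ σ z p : ℝ} (hσ : 0 < σ) (hδ : 0 ≤ δ) (hδz : δ ≤ σ * z) (hp : gaussianTail (-z) ≤ p)
    {A : Set (ℝ × S)} (hA : MeasurableSet A)
    (hpow : ENNReal.ofReal p ≤ ((gaussianReal (c + δ) (σ ^ 2).toNNReal).prod ρ) A) :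
    1 / 2 ≤ ((gaussianReal c (σ ^ 2).toNNReal).prod ρ) A := by
  have hs : (σ ^ 2).toNNReal ≠ 0 := by
    rw [Ne, Real.toNNReal_eq_zero, not_le]
    positivity
  -- the half-line `(t, ∞)` has probability `gaussianTail (-z)` at `c + δ`, at least `1 / 2` at `c`
  set t := c + δ - σ * z with ht
  set lam := ENNReal.ofReal (Real.exp ((δ ^ 2 - 2 * δ * (t - c)) / (2 * (σ ^ 2).toNNReal)))
  have h1 : ∀ r, gaussianReal c (σ ^ 2).toNNReal (Set.Ioi t) +
      lam * gaussianReal (c + δ) (σ ^ 2).toNNReal ((fun x => (x, r)) ⁻¹' A) ≤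
      gaussianReal c (σ ^ 2).toNNReal ((fun x => (x, r)) ⁻¹' A) +
        lam * gaussianReal (c + δ) (σ ^ 2).toNNReal (Set.Ioi t) := fun r =>
    gaussianReal_neymanPearson c t hδ hs (measurable_prodMk_right hA)
  have h2 := lintegral_mono (μ := ρ) h1
  have hm : ∀ m : ℝ,
      Measurable fun r => gaussianReal m (σ ^ 2).toNNReal ((fun x => (x, r)) ⁻¹' A) :=
    fun m => measurable_measure_prodMk_right hA
  rw [lintegral_add_left measurable_const, lintegral_const_mul _ (hm _),
    lintegral_add_right _ measurable_const, lintegral_const, lintegral_const, measure_univ,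
    mul_one, mul_one, ← Measure.prod_apply_symm hA,
    ← Measure.prod_apply_symm hA] at h2
  have h3 : gaussianReal (c + δ) (σ ^ 2).toNNReal (Set.Ioi t) ≤
      ((gaussianReal (c + δ) (σ ^ 2).toNNReal).prod ρ) A := by
    refine le_trans ?_ hpow
    rw [gaussianReal_Ioi _ _ hσ]
    refine ENNReal.ofReal_le_ofReal (le_trans (le_of_eq ?_) hp)
    congr 1
    rw [ht]
    field_simp
    ring
  have h4 : (1 / 2 : ℝ≥0∞) ≤ gaussianReal c (σ ^ 2).toNNReal (Set.Ioi t) := by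
    rw [gaussianReal_Ioi _ _ hσ]
    have h5 : gaussianTail 0 ≤ gaussianTail ((t - c) / σ) :=
      gaussianTail_anti (div_nonpos_of_nonpos_of_nonneg (by linarith) hσ.le)
    rw [gaussianTail_zero] at h5
    refine le_trans (le_of_eq ?_) (ENNReal.ofReal_le_ofReal h5)
    rw [ENNReal.ofReal_div_of_pos (by norm_num)]
    simp
  have hfin : lam * gaussianReal (c + δ) (σ ^ 2).toNNReal (Set.Ioi t) ≠ ∞ :=
    ENNReal.mul_ne_top ENNReal.ofReal_ne_top (measure_ne_top _ _)
  refine (ENNReal.add_le_add_iff_right hfin).1 (le_trans ?_ h2)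
  exact add_le_add h4 (mul_le_mul_right h3 _)

lemma gaussianTail_neg (t : ℝ) : gaussianTail (-t) = 1 - gaussianTail t := by
  have h1 : gaussianReal 0 1 (Set.Ioi (-t)) = gaussianReal 0 1 (Set.Iio t) := by
    conv_lhs => rw [← neg_zero, ← gaussianReal_map_neg (μ := 0) (v := 1)]
    rw [Measure.map_apply measurable_neg measurableSet_Ioi]
    congr 1
    ext x
    simp
  have : NullSingletonClass (gaussianReal 0 1) := nullSingletonClass_gaussianReal one_ne_zero
  have h2 : gaussianReal 0 1 (Set.Iio t) = gaussianReal 0 1 (Set.Iic t) :=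
    measure_congr Iio_ae_eq_Iic
  rw [← one_sub_cdf_gaussianReal t, cdf_eq_real, gaussianTail, Measure.real, h1, h2, ← Measure.real]
  ring

/-- An event of probability at least `1 - α` at `g` has probability at least `1 / 2` at every `f`
with `‖f - g‖₂ ≤ z_α / √n`. -/
lemma IsGaussianShift.half_le_law {n : ℝ} {E : Experiment} {a : E.Idx → Lp ℝ 2 E.ref} (hn : 0 < n)
    (h : IsGaussianShift n E a) {α : ℝ} (hα0 : 0 < α) (hα1 : α < 1 / 2) {f g : E.Fn}
    (hf : MemLp f 2 E.ref) (hg : MemLp g 2 E.ref)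
    (hfg : ‖hg.toLp g - hf.toLp f‖ ≤ upperQuantile α / √n) {A : Set E.Fn} (hA : MeasurableSet A)
    (hgA : ENNReal.ofReal (1 - α) ≤ E.law g A) : 1 / 2 ≤ E.law f A := by
  have := h.isProbabilityMeasure f hf
  have := h.isProbabilityMeasure g hg
  set δ := ‖hg.toLp g - hf.toLp f‖ with hδ
  rcases (norm_nonneg (hg.toLp g - hf.toLp f)).eq_or_lt with h0 | h0
  · have heq : hf.toLp f = hg.toLp g := (sub_eq_zero.1 (norm_eq_zero.1 h0.symm)).symm
    have hlaw : E.law f = E.law g := ext_of_map_finObs fun v => by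
      rw [h.map_finObs f hf, h.map_finObs g hg, heq]
    rw [hlaw]
    refine le_trans ?_ hgA
    rw [← ENNReal.ofReal_ofNat, ← ENNReal.ofReal_one, ← ENNReal.ofReal_div_of_pos (by norm_num)]
    exact ENNReal.ofReal_le_ofReal (by linarith)
  · rw [← hδ] at h0
    set e := δ⁻¹ • (hg.toLp g - hf.toLp f) with he
    have hnorm : ‖e‖ = 1 := by
      rw [he, norm_smul, norm_inv, Real.norm_of_nonneg h0.le, ← hδ, inv_mul_cancel₀ h0.ne']
    have hge : hg.toLp g = hf.toLp f + δ • e := by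
      rw [he, smul_smul, mul_inv_cancel₀ h0.ne', one_smul]; abel
    have hff : hf.toLp f = hf.toLp f + (0 : ℝ) • e := by simp
    obtain ⟨τ, hτ⟩ := h.exists_isStochasticIntegral hn e
    have hlf := h.law_eq_map_prod hn hnorm hτ hf hf hff
    have hlg := h.law_eq_map_prod hn hnorm hτ hg hf hge
    have hmR : Measurable fun (y : E.Fn) (t : E.Idx) => y t - τ y * inner ℝ (a t) e :=
      measurable_pi_lambda _ fun t => (measurable_pi_apply t).sub (hτ.1.mul_const _)
    have hmp : Measurable fun (p : ℝ × E.Fn) (t : E.Idx) => p.1 * inner ℝ (a t) e + p.2 t :=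
      measurable_pi_lambda _ fun t =>
        (measurable_fst.mul_const _).add ((measurable_pi_apply t).comp measurable_snd)
    have hprobR : IsProbabilityMeasure
        ((E.law f).map fun y t => y t - τ y * inner ℝ (a t) e) :=
      Measure.isProbabilityMeasure_map hmR.aemeasurable
    have hmean : inner ℝ e (hg.toLp g) = inner ℝ e (hf.toLp f) + δ := by
      rw [hge, inner_add_right, real_inner_smul_right, real_inner_self_eq_norm_sq, hnorm]
      ring
    have hσ : 1 / n = ((√n)⁻¹) ^ 2 := by rw [inv_pow, Real.sq_sqrt hn.le, one_div]
    rw [hlg, Measure.map_apply hmp hA, hmean, hσ] at hgA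
    rw [hlf, Measure.map_apply hmp hA, hσ]
    refine half_le_prod_of_le _ _ (z := upperQuantile α) (p := 1 - α)
      (inv_pos.2 (Real.sqrt_pos.2 hn)) h0.le ?_ ?_ (hmp hA) hgA
    · rw [mul_comm, ← div_eq_mul_inv]
      exact hfg
    · rw [gaussianTail_neg, gaussianTail_upperQuantile hα0 (by linarith)]

/-! ### The lower bound for the expected length -/

lemma eLpNorm_sub_le_ofReal_iff {X : Type*} [MeasurableSpace X] {μ : Measure X} {f g : X → ℝ}
    (hf : MemLp f 2 μ) (hg : MemLp g 2 μ) {ε : ℝ} (hε : 0 ≤ ε) :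
    eLpNorm (g - f) 2 μ ≤ ENNReal.ofReal ε ↔ ‖hg.toLp g - hf.toLp f‖ ≤ ε := by
  rw [← MemLp.toLp_sub hg hf, Lp.norm_toLp, ENNReal.le_ofReal_iff_toReal_le (hg.sub hf).2.ne hε]

/-- A confidence interval must, at `f`, cover both `T f` and `T g` with probability at least
`1 / 2 - α` when `f` and `g` are too close to be told apart. -/
lemma IsGaussianShift.ofReal_mul_abs_le_lintegral_length {n : ℝ} {E : Experiment}
    {a : E.Idx → Lp ℝ 2 E.ref} (hn : 0 < n) (h : IsGaussianShift n E a) {α : ℝ} (hα0 : 0 < α)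
    (hα1 : α < 1 / 2) (T : E.Fn →ₗ[ℝ] ℝ) {G : Set E.Fn} {C : DataInterval E}
    (hC : C ∈ confidenceIntervals E T α G) {f g : E.Fn} (hfG : f ∈ G) (hgG : g ∈ G)
    (hf : MemLp f 2 E.ref) (hg : MemLp g 2 E.ref)
    (hfg : ‖hg.toLp g - hf.toLp f‖ ≤ upperQuantile α / √n) :
    ENNReal.ofReal ((1 / 2 - α) * |T g - T f|) ≤ ∫⁻ y, C.length y ∂(E.law f) := by
  obtain ⟨hlo, hhi, hcov⟩ := hC
  have := h.isProbabilityMeasure f hf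
  have hmeas : ∀ r : ℝ, MeasurableSet {y : E.Fn | r ∈ Set.Icc (C.lo y) (C.hi y)} := fun r =>
    (measurableSet_le hlo measurable_const).inter (measurableSet_le measurable_const hhi)
  set A := {y : E.Fn | T f ∈ Set.Icc (C.lo y) (C.hi y)} with hA
  set B := {y : E.Fn | T g ∈ Set.Icc (C.lo y) (C.hi y)} with hB
  have hPA : ENNReal.ofReal (1 - α) ≤ E.law f A := hcov f hfG
  have hPB : 1 / 2 ≤ E.law f B :=
    h.half_le_law hn hα0 hα1 hf hg hfg (hmeas _) (hcov g hgG)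
  have hAB : ENNReal.ofReal (1 / 2 - α) ≤ E.law f (A ∩ B) := by
    have h1 := measureReal_union_add_inter (μ := E.law f) (s := A) (hmeas (T g))
    have h2 : (E.law f).real (A ∪ B) ≤ 1 := measureReal_le_one
    have h3 : 1 - α ≤ (E.law f).real A :=
      (ENNReal.ofReal_le_iff_le_toReal (measure_ne_top _ _)).1 hPA
    have h4 : 1 / 2 ≤ (E.law f).real B := by
      refine (ENNReal.ofReal_le_iff_le_toReal (measure_ne_top _ _)).1 (le_trans (le_of_eq ?_) hPB)
      rw [ENNReal.ofReal_div_of_pos (by norm_num)]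
      simp
    rw [ENNReal.ofReal_le_iff_le_toReal (measure_ne_top _ _)]
    change 1 / 2 - α ≤ (E.law f).real (A ∩ B)
    linarith
  calc ENNReal.ofReal ((1 / 2 - α) * |T g - T f|)
      = ENNReal.ofReal |T g - T f| * ENNReal.ofReal (1 / 2 - α) := by
        rw [mul_comm, ENNReal.ofReal_mul (abs_nonneg _)]
    _ ≤ ENNReal.ofReal |T g - T f| * E.law f (A ∩ B) := mul_le_mul_right hAB _
    _ = ∫⁻ _ in A ∩ B, ENNReal.ofReal |T g - T f| ∂(E.law f) := by rw [setLIntegral_const]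
    _ ≤ ∫⁻ y in A ∩ B, C.length y ∂(E.law f) := by
        refine setLIntegral_mono' ((hmeas _).inter (hmeas _)) fun y hy => ?_
        refine ENNReal.ofReal_le_ofReal (abs_le.2 ⟨?_, ?_⟩)
        · linarith [hy.1.2, hy.2.1]
        · linarith [hy.1.1, hy.2.2]
    _ ≤ _ := setLIntegral_le_lintegral _ _

/-- The between class modulus at `z_{α/2} / √n` bounds the optimal length from below; convexity is
used to pass from the radius `z_α / √n` of indistinguishable pairs to `z_{α/2} / √n`. -/
lemma IsGaussianShift.betweenModulus_le_optimalLength {n : ℝ} {E : Experiment}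
    {a : E.Idx → Lp ℝ 2 E.ref} (hn : 0 < n) (h : IsGaussianShift n E a) {α : ℝ} (hα0 : 0 < α)
    (hα1 : α < 1 / 2) (T : E.Fn →ₗ[ℝ] ℝ) {F G : Set E.Fn} (hFG : F ⊆ G) (hconv : Convex ℝ G)
    (hL2 : ∀ f ∈ G, MemLp f 2 E.ref) :
    betweenModulus E T (upperQuantile (α / 2) / √n) F G ≤
      ENNReal.ofReal (upperQuantile (α / 2) / ((1 / 2 - α) * upperQuantile α)) *
        optimalLength E T α F G := by
  have hz : 0 < upperQuantile α := upperQuantile_pos hα0 hα1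
  have hzz : upperQuantile α ≤ upperQuantile (α / 2) :=
    upperQuantile_le_upperQuantile (by linarith) (by linarith) (by linarith)
  have hz2 : 0 < upperQuantile (α / 2) := hz.trans_le hzz
  have hs : 0 < √n := Real.sqrt_pos.2 hn
  have hα2 : 0 < 1 / 2 - α := sub_pos.2 hα1
  set κ := upperQuantile (α / 2) / ((1 / 2 - α) * upperQuantile α) with hκ
  have hκ0 : 0 < κ := by positivity
  have hκ1 : ENNReal.ofReal κ ≠ 0 := by simpa using hκ0
  refine iSup₂_le fun f hf => iSup₂_le fun g hg => iSup_le fun hfg => ?_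
  rw [optimalLength, ENNReal.mul_iInf_of_ne hκ1 ENNReal.ofReal_ne_top]
  refine le_iInf fun C => ?_
  rw [ENNReal.mul_iInf_of_ne hκ1 ENNReal.ofReal_ne_top]
  refine le_iInf fun hC => ?_
  set r := upperQuantile α / upperQuantile (α / 2) with hr
  have hr0 : 0 < r := by positivity
  have hr1 : 0 ≤ 1 - r := sub_nonneg.2 ((div_le_one hz2).2 hzz)
  have hg' : (1 - r) • f + r • g ∈ G := hconv (hFG hf) hg hr1 hr0.le (by ring)
  have hlp := hL2 _ (hFG hf)
  have hd : (hL2 _ hg').toLp ((1 - r) • f + r • g) - hlp.toLp f =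
      r • ((hL2 g hg).toLp g - hlp.toLp f) := by
    rw [← MemLp.toLp_sub, ← MemLp.toLp_sub, ← MemLp.toLp_const_smul]
    congr 1
    module
  have hnorm : ‖(hL2 _ hg').toLp ((1 - r) • f + r • g) - hlp.toLp f‖ ≤ upperQuantile α / √n := by
    have h1 := (eLpNorm_sub_le_ofReal_iff hlp (hL2 g hg) (by positivity)).1 hfg
    rw [hd, norm_smul, Real.norm_of_nonneg hr0.le]
    refine (mul_le_mul_of_nonneg_left h1 hr0.le).trans (le_of_eq ?_)
    rw [hr]
    field_simp
  have key := h.ofReal_mul_abs_le_lintegral_length hn hα0 hα1 T hC (hFG hf) hg' hlp (hL2 _ hg')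
    hnorm
  have hT : T ((1 - r) • f + r • g) - T f = r * (T g - T f) := by
    simp only [map_add, map_smul, smul_eq_mul]
    ring
  have e1 : |T g - T f| = κ * ((1 / 2 - α) * |T ((1 - r) • f + r • g) - T f|) := by
    have e2 : κ * ((1 / 2 - α) * r) = 1 := by
      rw [hκ, hr, div_mul_eq_mul_div, div_eq_one_iff_eq (by positivity)]
      generalize 1 / 2 - α = β
      field_simp
    rw [hT, abs_mul, abs_of_pos hr0]
    linear_combination -|T g - T f| * e2
  rw [e1, ENNReal.ofReal_mul hκ0.le]
  refine mul_le_mul_right (key.trans ?_) _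
  exact le_iSup₂_of_le (f := fun f _ => ∫⁻ y, C.length y ∂(E.law f)) f hf le_rfl

/-! ### Existence of the linear estimators -/

/-- A convex set lying below the graph of `K ‖·‖` lies below the graph of a linear functional of
norm at most `K`. -/
lemma exists_inner_ge_of_le_mul_norm {V : Type*} [NormedAddCommGroup V] [InnerProductSpace ℝ V]
    [CompleteSpace V] {A : Set (V × ℝ)} (hA : Convex ℝ A) {K s : ℝ} (hK : 0 ≤ K)
    (hs : ((0 : V), s) ∈ A) (hle : ∀ p ∈ A, p.2 ≤ K * ‖p.1‖) :
    ∃ w : V, ‖w‖ ≤ K ∧ ∀ p ∈ A, p.2 ≤ inner ℝ w p.1 := by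
  let O : Set (V × ℝ) := {p | K * ‖p.1‖ < p.2}
  have hOo : IsOpen O := isOpen_lt (by fun_prop) (by fun_prop)
  have hOc : Convex ℝ O := by
    intro p hp q hq b c hb hc hbc
    have hp' : K * ‖p.1‖ < p.2 := hp
    have hq' : K * ‖q.1‖ < q.2 := hq
    change K * ‖b • p.1 + c • q.1‖ < b * p.2 + c * q.2
    have h1 : ‖b • p.1 + c • q.1‖ ≤ b * ‖p.1‖ + c * ‖q.1‖ := by
      refine (norm_add_le _ _).trans ?_
      rw [norm_smul, norm_smul, Real.norm_of_nonneg hb, Real.norm_of_nonneg hc]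
    have h2 := mul_le_mul_of_nonneg_left h1 hK
    rcases hb.eq_or_lt with rfl | hb'
    · have : c = 1 := by linarith
      subst this
      linarith
    · nlinarith [mul_lt_mul_of_pos_left hp' hb', mul_le_mul_of_nonneg_left hq'.le hc]
  have hdisj : Disjoint O A := Set.disjoint_left.2 fun p hp hpA => by
    have : K * ‖p.1‖ < p.2 := hp
    linarith [hle p hpA]
  obtain ⟨φ, u, hφO, hφA⟩ := geometric_hahn_banach_open hOc hOo hA hdisj
  have hsplit : ∀ x t, φ (x, t) = φ (x, 0) + t * φ (0, 1) := by
    intro x t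
    have : ((x, t) : V × ℝ) = (x, 0) + t • (0, 1) := by simp
    rw [this, map_add, map_smul, smul_eq_mul]
  set r := φ (0, 1) with hr
  have hφ0 : φ (0, 0) = 0 := map_zero φ
  have hO : ∀ x t, K * ‖x‖ < t → φ (x, 0) + t * r < u := fun x t ht => by
    rw [← hsplit]; exact hφO _ ht
  have hu : 0 ≤ u := by
    have : Tendsto (fun t : ℝ => t * r) (𝓝[>] 0) (𝓝 (0 * r)) :=
      (tendsto_id.mul_const r).mono_left nhdsWithin_le_nhds
    rw [zero_mul] at this
    refine le_of_tendsto this ?_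
    filter_upwards [self_mem_nhdsWithin] with t ht
    have := hO 0 t (by simpa using ht)
    rw [hφ0] at this
    linarith
  have hs' : u ≤ s * r := by
    have := hφA _ hs
    rwa [hsplit, hφ0, zero_add] at this
  have hrneg : r < 0 := by
    by_contra hr0
    push Not at hr0
    have h1 := hO 0 (max s 0 + 1) (by simp; positivity)
    rw [hφ0] at h1
    nlinarith [le_max_left s 0, le_max_right s 0]
  let ℓ : V →L[ℝ] ℝ := (-r)⁻¹ • (φ.comp (ContinuousLinearMap.inl ℝ V ℝ))
  have hℓ : ∀ x, ℓ x = (-r)⁻¹ * φ (x, 0) := fun x => rfl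
  have hr' : 0 < -r := by linarith
  have hℓA : ∀ p ∈ A, p.2 ≤ ℓ p.1 := by
    intro p hp
    have h1 := hφA p hp
    rw [hsplit] at h1
    rw [hℓ, inv_mul_eq_div, le_div_iff₀ hr']
    linarith
  have hℓb : ∀ x, ℓ x ≤ K * ‖x‖ + u / (-r) := by
    intro x
    refine le_of_forall_pos_le_add fun ε hε => ?_
    have h1 := hO x (K * ‖x‖ + ε) (by linarith)
    rw [hℓ, inv_mul_eq_div, div_le_iff₀ hr']
    have : (K * ‖x‖ + u / -r + ε) * -r = (K * ‖x‖ + ε) * -r + u := by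
      linear_combination div_mul_cancel₀ u hr'.ne'
    rw [this]
    linarith
  have hℓK : ∀ x, ℓ x ≤ K * ‖x‖ := by
    intro x
    by_contra hx
    push Not at hx
    have hd : 0 < ℓ x - K * ‖x‖ := by linarith
    obtain ⟨N, hN⟩ := exists_nat_gt (u / (-r) / (ℓ x - K * ‖x‖))
    rw [div_lt_iff₀ hd] at hN
    have h1 := hℓb ((N : ℝ) • x)
    rw [map_smul, norm_smul, Real.norm_of_nonneg (Nat.cast_nonneg N), smul_eq_mul] at h1
    linarith
  refine ⟨(InnerProductSpace.toDual ℝ V).symm ℓ, ?_, fun p hp => ?_⟩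
  · rw [LinearIsometryEquiv.norm_map]
    refine ℓ.opNorm_le_bound hK fun x => ?_
    rw [Real.norm_eq_abs, abs_le]
    refine ⟨?_, hℓK x⟩
    have := hℓK (-x)
    rw [map_neg, norm_neg] at this
    linarith
  · rw [InnerProductSpace.toDual_symm_apply]
    exact hℓA p hp

lemma sub_le_toReal_orderedModulus {E : Experiment} {T : E.Fn →ₗ[ℝ] ℝ} {ε : ℝ} {F G : Set E.Fn}
    (hfin : orderedModulus E T ε F G ≠ ⊤) {f g : E.Fn} (hf : f ∈ F) (hg : g ∈ G)
    (hfg : eLpNorm (g - f) 2 E.ref ≤ ENNReal.ofReal ε) :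
    T g - T f ≤ (orderedModulus E T ε F G).toReal := by
  have h1 : ((T g - T f : ℝ) : EReal) ≤ orderedModulus E T ε F G :=
    le_iSup₂_of_le f hf (le_iSup₂_of_le g hg (le_iSup_of_le hfg le_rfl))
  have := EReal.toReal_le_toReal h1 (EReal.coe_ne_bot _) hfin
  rwa [EReal.toReal_coe] at this

/-- For convex classes with a common element and a finite ordered modulus `ω`, there is an affine
estimator with standard deviation at most `ω / z_{α/2}` and bias bounds `± ω / 2`. Its weight is the
slope of a linear functional that separates the increments `T g - T f - ω` from
`√n ω / z_{α/2} * ‖g - f‖`. -/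
lemma IsGaussianShift.exists_isOrderedEstimator {n : ℝ} {E : Experiment}
    {a : E.Idx → Lp ℝ 2 E.ref} (hn : 0 < n) (h : IsGaussianShift n E a) {α : ℝ}
    (hz : 0 < upperQuantile (α / 2)) (T : E.Fn →ₗ[ℝ] ℝ) {F G : Set E.Fn} (hF : Convex ℝ F)
    (hG : Convex ℝ G) (hF2 : ∀ f ∈ F, MemLp f 2 E.ref) (hG2 : ∀ f ∈ G, MemLp f 2 E.ref)
    (hne : (F ∩ G).Nonempty) (hfin : orderedModulus E T (upperQuantile (α / 2) / √n) F G ≠ ⊤) :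
    ∃ τ, IsOrderedEstimator E T n α F G τ := by
  set z := upperQuantile (α / 2) with hzdef
  set ε := z / √n with hεdef
  have hsn : 0 < √n := Real.sqrt_pos.2 hn
  have hε : 0 < ε := div_pos hz hsn
  set ω := (orderedModulus E T ε F G).toReal with hω
  obtain ⟨p, hpF, hpG⟩ := hne
  have hω0 : 0 ≤ ω := by
    have := sub_le_toReal_orderedModulus hfin hpF hpG (by simp)
    simpa using this
  have hle : ∀ f (hf : f ∈ F) g (hg : g ∈ G), ‖(hG2 g hg).toLp g - (hF2 f hf).toLp f‖ ≤ ε →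
      T g - T f ≤ ω := fun f hf g hg hfg =>
    sub_le_toReal_orderedModulus hfin hf hg ((eLpNorm_sub_le_ofReal_iff _ _ hε.le).2 hfg)
  let A : Set (Lp ℝ 2 E.ref × ℝ) := {q | ∃ f, ∃ hf : f ∈ F, ∃ g, ∃ hg : g ∈ G,
    q = ((hG2 g hg).toLp g - (hF2 f hf).toLp f, T g - T f - ω)}
  have hAconv : Convex ℝ A := by
    rintro _ ⟨f, hf, g, hg, rfl⟩ _ ⟨f', hf', g', hg', rfl⟩ b c hb hc hbc
    refine ⟨b • f + c • f', hF hf hf' hb hc hbc, b • g + c • g', hG hg hg' hb hc hbc, ?_⟩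
    refine Prod.ext ?_ ?_
    · change b • ((hG2 g hg).toLp g - (hF2 f hf).toLp f) +
        c • ((hG2 g' hg').toLp g' - (hF2 f' hf').toLp f') = _
      have e1 : ∀ {u v : E.Fn} (hu : MemLp u 2 E.ref) (hv : MemLp v 2 E.ref)
          (huv : MemLp (b • u + c • v) 2 E.ref), huv.toLp (b • u + c • v) =
            b • hu.toLp u + c • hv.toLp v := fun hu hv huv => rfl
      rw [e1 (hG2 g hg) (hG2 g' hg'), e1 (hF2 f hf) (hF2 f' hf')]
      module
    · change b * (T g - T f - ω) + c * (T g' - T f' - ω) =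
        T (b • g + c • g') - T (b • f + c • f') - ω
      simp only [map_add, map_smul, smul_eq_mul]
      linear_combination -ω * hbc
  have hAp : ((0 : Lp ℝ 2 E.ref), -ω) ∈ A := ⟨p, hpF, p, hpG, by simp⟩
  have hAle : ∀ q ∈ A, q.2 ≤ (ω / ε) * ‖q.1‖ := by
    rintro _ ⟨f, hf, g, hg, rfl⟩
    simp only
    set x := (hG2 g hg).toLp g - (hF2 f hf).toLp f with hx
    have hK : 0 ≤ ω / ε := by positivity
    rcases le_or_gt ‖x‖ ε with hxε | hxε
    · linarith [hle f hf g hg hxε, mul_nonneg hK (norm_nonneg x)]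
    · -- the common element `p` is the centre of a contraction to distance `ε`
      have hx0 : 0 < ‖x‖ := hε.trans hxε
      set lam := ε / ‖x‖ with hlam
      have hlam0 : 0 < lam := by positivity
      have hlam1 : 0 ≤ 1 - lam := by
        rw [sub_nonneg, hlam, div_le_one hx0]; exact hxε.le
      have hf' : (1 - lam) • p + lam • f ∈ F := hF hpF hf hlam1 hlam0.le (by ring)
      have hg' : (1 - lam) • p + lam • g ∈ G := hG hpG hg hlam1 hlam0.le (by ring)
      have e1 : (hG2 _ hg').toLp _ - (hF2 _ hf').toLp _ = lam • x := by
        rw [← MemLp.toLp_sub, hx, ← MemLp.toLp_sub, ← MemLp.toLp_const_smul]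
        congr 1
        module
      have h1 := hle _ hf' _ hg' (by
        rw [e1, norm_smul, Real.norm_of_nonneg hlam0.le, hlam, div_mul_cancel₀ _ hx0.ne'])
      have h2 : lam * (T g - T f) ≤ ω := by
        simp only [map_add, map_smul, smul_eq_mul] at h1
        linarith
      have h3 : T g - T f ≤ ω / ε * ‖x‖ := by
        rw [hlam, div_mul_eq_mul_div, div_le_iff₀ hx0] at h2
        rw [div_mul_eq_mul_div, le_div_iff₀ hε]
        linarith
      linarith
  obtain ⟨w, hwK, hw⟩ := exists_inner_ge_of_le_mul_norm hAconv (by positivity) hAp hAle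
  -- the constant term of the estimator has to lie between the two bias constraints
  obtain ⟨c, hc1, hc2⟩ := exists_between_of_forall_le
    (s := {x | ∃ g, ∃ hg : g ∈ G, x = T g - inner ℝ w ((hG2 g hg).toLp g) - ω / 2})
    (t := {x | ∃ f, ∃ hf : f ∈ F, x = ω / 2 + T f - inner ℝ w ((hF2 f hf).toLp f)})
    ⟨_, p, hpG, rfl⟩ ⟨_, p, hpF, rfl⟩ (by
      rintro _ ⟨g, hg, rfl⟩ _ ⟨f, hf, rfl⟩
      have := hw _ ⟨f, hf, g, hg, rfl⟩
      simp only [inner_sub_right] at this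
      linarith)
  obtain ⟨τ, hτ⟩ := h.exists_isStochasticIntegral hn w
  have hmean : ∀ f (hf : MemLp f 2 E.ref),
      ∫ y, (c + τ y) ∂(E.law f) = c + inner ℝ w (hf.toLp f) := by
    intro f hf
    have := h.isProbabilityMeasure f hf
    have hG : HasGaussianLaw τ (E.law f) := ⟨by rw [hτ.map_eq hn h hf]; infer_instance⟩
    rw [integral_add (integrable_const c) hG.integrable, integral_const, probReal_univ, one_smul]
    have := integral_map (μ := E.law f) (φ := τ) (f := fun x => x)
      hτ.1.aemeasurable (by fun_prop)
    rw [← this, hτ.map_eq hn h hf]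
    exact congrArg _ integral_id_gaussianReal
  refine ⟨fun y => c + τ y, hτ.isLinearEstimator c, fun f hf => ?_, fun g hg => ?_, fun f hf => ?_⟩
  · have := h.isProbabilityMeasure f hf
    rw [variance_const_add hτ.1.aestronglyMeasurable]
    have h1 := variance_map (μ := E.law f) (X := fun x : ℝ => x) (Y := τ)
      (by fun_prop) hτ.1.aemeasurable
    rw [hτ.map_eq hn h hf] at h1
    refine (h1.symm.trans (variance_fun_id_gaussianReal.trans
      (Real.coe_toNNReal _ (by positivity)))).le.trans ?_
    change ‖w‖ ^ 2 / n ≤ 1 / z ^ 2 * ω ^ 2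
    have h2 : ‖w‖ ^ 2 ≤ (ω / ε) ^ 2 := pow_le_pow_left₀ (norm_nonneg w) hwK 2
    rw [div_le_iff₀ hn]
    refine h2.trans (le_of_eq ?_)
    rw [hεdef, div_pow, div_pow, Real.sq_sqrt hn.le]
    field_simp
  · rw [hmean g (hG2 g hg)]
    have := hc1 ⟨g, hg, rfl⟩
    change -(1 / 2) * ω ≤ _
    linarith
  · rw [hmean f (hF2 f hf)]
    have := hc2 ⟨f, hf, rfl⟩
    change _ ≤ 1 / 2 * ω
    linarith

/-! ### Geometrically spaced subsequences -/

/-- `S` is a geometrically spaced chain of indices in `[1, c]` that ends with `c`. -/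
structure IsDoublingChain (x : ℕ∞ → ℝ≥0∞) (c : ℕ∞) (S : Set ℕ∞) : Prop where
  last_mem : c ∈ S
  mem_range : ∀ j ∈ S, 1 ≤ j ∧ j ≤ c
  spaced : ∀ a ∈ S, ∀ b ∈ S, a < b → 2 * x a ≤ x b
  between : ∀ b ∈ S, ∀ j, 1 ≤ j → j < b → (∀ a ∈ S, a < b → a < j) → x b < 2 * x j

/-- Chains are built from their last element backwards: the predecessor of `c` has to be the largest
`a < c` with `2 x_a ≤ x_c`. -/
lemma exists_isDoublingChain {x : ℕ∞ → ℝ≥0∞} {k : ℕ∞}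
    (hmono : ∀ i j, 1 ≤ i → i ≤ j → j ≤ k → x i ≤ x j)
    (htop : k = ⊤ → x ⊤ ≠ ∞ → ∃ i : ℕ, 1 ≤ i ∧ x ⊤ < 2 * x i) :
    ∀ c, 1 ≤ c → c ≤ k → x c ≠ ∞ → ∃ S, IsDoublingChain x c S := by
  intro c
  induction c using WellFoundedLT.induction with
  | ind c ih =>
    intro hc1 hck hxc
    set Q : Set ℕ∞ := {a | 1 ≤ a ∧ a < c ∧ 2 * x a ≤ x c} with hQ
    rcases Q.eq_empty_or_nonempty with hQe | hQne
    · refine ⟨{c}, rfl, ?_, ?_, ?_⟩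
      · rintro j rfl; exact ⟨hc1, le_rfl⟩
      · rintro a rfl b rfl hab; exact absurd hab (lt_irrefl _)
      · rintro b rfl j hj hjb -
        by_contra hcon
        have : j ∈ Q := ⟨hj, hjb, not_lt.1 hcon⟩
        rw [hQe] at this
        exact this
    · have hbdd : ∃ N : ℕ, ∀ a ∈ Q, a ≤ N := by
        by_cases hct : c = ⊤
        · subst hct
          obtain ⟨i, hi1, hi⟩ := htop (top_le_iff.1 hck) hxc
          refine ⟨i, fun a ha => ?_⟩
          by_contra hai
          have h1 := hmono i a (by exact_mod_cast hi1) (not_le.1 hai).le (le_top.trans hck)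
          have h2 : x ⊤ < 2 * x a := hi.trans_le (mul_le_mul_right h1 _)
          exact absurd ha.2.2 (not_le.2 h2)
        · lift c to ℕ using hct
          exact ⟨c, fun a ha => ha.2.1.le⟩
      obtain ⟨N, hN⟩ := hbdd
      have hfin : Q.Finite := by
        refine Set.Finite.subset (s := ((↑) : ℕ → ℕ∞) '' Set.Iic N) ((Set.finite_Iic N).image _) ?_
        intro a ha
        have haN := hN a ha
        lift a to ℕ using ne_top_of_le_ne_top (ENat.natCast_ne_top N) haN
        exact ⟨a, by exact_mod_cast haN, rfl⟩
      obtain ⟨a, haQ, hamax⟩ := Set.exists_max_image Q id hfin hQne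
      obtain ⟨ha1, hac, hax⟩ := haQ
      have hxa : x a ≠ ∞ := by
        intro h
        rw [h, ENNReal.mul_top (by norm_num)] at hax
        exact hxc (top_le_iff.1 hax)
      obtain ⟨S, hS⟩ := ih a hac ha1 (hac.le.trans hck) hxa
      refine ⟨insert c S, Set.mem_insert _ _, ?_, ?_, ?_⟩
      · rintro j (rfl | hj)
        · exact ⟨hc1, le_rfl⟩
        · exact ⟨(hS.mem_range j hj).1, (hS.mem_range j hj).2.trans hac.le⟩
      · rintro p hp q hq hpq
        rcases hq with rfl | hq
        · rcases hp with rfl | hp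
          · exact absurd hpq (lt_irrefl _)
          · obtain ⟨hp1, hpa⟩ := hS.mem_range p hp
            exact (mul_le_mul_right (hmono p a hp1 hpa (hac.le.trans hck)) _).trans hax
        · rcases hp with rfl | hp
          · exact absurd (hpq.trans_le (hS.mem_range q hq).2) (not_lt.2 hac.le)
          · exact hS.spaced p hp q hq hpq
      · rintro b hb j hj hjb hall
        rcases hb with rfl | hb
        · by_contra hcon
          have hjQ : j ∈ Q := ⟨hj, hjb, not_lt.1 hcon⟩
          exact absurd (hall a (Set.mem_insert_of_mem _ hS.last_mem) hac) (not_lt.2 (hamax j hjQ))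
        · exact hS.between b hb j hj hjb fun a' ha' => hall a' (Set.mem_insert_of_mem _ ha')

/-- Existence of a geometrically spaced subsequence. If `x` is unbounded, the finite chains ending
at `m + 1` are glued along a nonprincipal ultrafilter on the `m`: an index `b` determines its
predecessor, the largest `a` with `2 x_a ≤ x_b`, but not its successor, so that a greedy choice of
successors may get stuck. -/
lemma exists_isDoublingSubsequence {x : ℕ∞ → ℝ≥0∞} {k : ℕ∞} (hk : 1 ≤ k)
    (hmono : ∀ i j, 1 ≤ i → i ≤ j → j ≤ k → x i ≤ x j) (hpos : 0 < x 1)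
    (hfin : ∀ j, 1 ≤ j → j ≤ k → j ≠ ⊤ → x j ≠ ∞)
    (htop : k = ⊤ → x ⊤ ≤ ⨆ (i : ℕ) (_ : 1 ≤ i), x i) :
    ∃ S, IsDoublingSubsequence k x S := by
  have htop' : k = ⊤ → x ⊤ ≠ ∞ → ∃ i : ℕ, 1 ≤ i ∧ x ⊤ < 2 * x i := by
    intro hk' hx
    have h1 : 0 < x ⊤ := hpos.trans_le (hmono 1 ⊤ le_rfl le_top hk'.ge)
    have h2 : x ⊤ / 2 < ⨆ (i : ℕ) (_ : 1 ≤ i), x i :=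
      (ENNReal.half_lt_self h1.ne' hx).trans_le (htop hk')
    obtain ⟨i, hi⟩ := lt_iSup_iff.1 h2
    obtain ⟨hi1, hi2⟩ := lt_iSup_iff.1 hi
    refine ⟨i, hi1, ?_⟩
    rw [ENNReal.div_lt_iff (Or.inl (by norm_num)) (Or.inl (by norm_num))] at hi2
    rwa [mul_comm]
  have hchain := exists_isDoublingChain hmono htop'
  by_cases hxk : x k = ∞
  · have hkt : k = ⊤ := by
      by_contra h
      exact hfin k hk le_rfl h hxk
    subst hkt
    have hc : ∀ m : ℕ, ∃ S, IsDoublingChain x ((m + 1 : ℕ) : ℕ∞) S := fun m =>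
      hchain _ (by exact_mod_cast Nat.succ_le_succ (Nat.zero_le m)) le_top
        (hfin _ (by exact_mod_cast Nat.succ_le_succ (Nat.zero_le m)) le_top (ENat.natCast_ne_top _))
    choose C hC using hc
    let U : Ultrafilter ℕ := hyperfilter ℕ
    set S : Set ℕ∞ := {j | ∀ᶠ m in (U : Filter ℕ), j ∈ C m} with hS
    -- on a finite window, the limit `S` agrees with some of the chains
    have hwindow : ∀ N : ℕ, ∀ᶠ m in (U : Filter ℕ), ∀ j ∈ Set.Iic (N : ℕ∞), (j ∈ S ↔ j ∈ C m) := by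
      intro N
      have hNf : (Set.Iic (N : ℕ∞)).Finite := by
        refine Set.Finite.subset (s := ((↑) : ℕ → ℕ∞) '' Set.Iic N) ((Set.finite_Iic N).image _) ?_
        intro a haN
        lift a to ℕ using ne_top_of_le_ne_top (ENat.natCast_ne_top N) haN
        exact ⟨a, by simpa using haN, rfl⟩
      refine (eventually_all_finite hNf).2 fun j _ => ?_
      by_cases hj : j ∈ S
      · filter_upwards [hj] with m hm
        exact ⟨fun _ => hm, fun _ => hj⟩
      · have : ∀ᶠ m in (U : Filter ℕ), ¬ j ∈ C m := Ultrafilter.eventually_not.2 hj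
        filter_upwards [this] with m hm
        exact ⟨fun h => absurd h hj, fun h => absurd h hm⟩
    have hmem : ∀ j ∈ S, 1 ≤ j ∧ j ≠ ⊤ := by
      intro j hj
      obtain ⟨m, hm⟩ := (show ∀ᶠ m in (U : Filter ℕ), j ∈ C m from hj).exists
      obtain ⟨h1, h2⟩ := (hC m).mem_range j hm
      exact ⟨h1, ne_top_of_le_ne_top (ENat.natCast_ne_top _) h2⟩
    refine ⟨S, fun j hj => ⟨(hmem j hj).1, le_top, hfin j (hmem j hj).1 le_top (hmem j hj).2⟩,
      fun j hj1 _ hxj => ?_, fun a ha b hb hab => ?_, fun b hb j hj hjb hall => ?_⟩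
    · -- the next element of a long chain cannot lie beyond an `N` with `x_N > 2 x_j`
      have hjt : j ≠ ⊤ := fun h => hxj (by rw [h, hxk])
      lift j to ℕ using hjt
      have h1 : 2 * x j < ⨆ (i : ℕ) (_ : 1 ≤ i), x i := by
        have hsup : (⨆ (i : ℕ) (_ : 1 ≤ i), x i) = ∞ := by
          have := htop rfl
          rw [hxk] at this
          exact top_le_iff.1 this
        rw [hsup]
        exact ENNReal.mul_lt_top (by norm_num) hxj.lt_top
      obtain ⟨N, hN⟩ := lt_iSup_iff.1 h1
      obtain ⟨hN1, hN2⟩ := lt_iSup_iff.1 hN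
      have hge : ∀ᶠ m in (U : Filter ℕ), j ≤ m :=
        (Nat.hyperfilter_le_atTop : (U : Filter ℕ) ≤ atTop) (eventually_ge_atTop j)
      obtain ⟨m, hm1, hm2⟩ := ((hwindow (max N j)).and hge).exists
      obtain ⟨b, ⟨hbC, hjb⟩, hbmin⟩ := WellFounded.has_min (wellFounded_lt (α := ℕ∞))
        {b | b ∈ C m ∧ (j : ℕ∞) ≤ b} ⟨((m + 1 : ℕ) : ℕ∞), (hC m).last_mem, by
          exact_mod_cast hm2.trans (Nat.le_succ m)⟩
      refine ⟨b, (hm1 b ?_).2 hbC, hjb⟩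
      rcases hjb.eq_or_lt with rfl | hlt
      · exact Set.mem_Iic.2 (by exact_mod_cast le_max_right N j)
      · have h3 := (hC m).between b hbC j hj1 hlt fun a ha hab => by
          by_contra hcon
          exact hbmin a ⟨ha, not_lt.1 hcon⟩ hab
        have h4 : b < N := by
          by_contra hcon
          have := hmono N b (by exact_mod_cast hN1) (not_lt.1 hcon) le_top
          exact absurd (h3.trans hN2) (not_lt.2 this)
        exact Set.mem_Iic.2 (h4.le.trans (by exact_mod_cast le_max_left N j))
    · obtain ⟨m, h1, h2⟩ := ((show ∀ᶠ m in (U : Filter ℕ), a ∈ C m from ha).and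
        (show ∀ᶠ m in (U : Filter ℕ), b ∈ C m from hb)).exists
      exact (hC m).spaced a h1 b h2 hab
    · have hbt := (hmem b hb).2
      lift b to ℕ using hbt
      obtain ⟨m, hm⟩ := (hwindow b).exists
      refine (hC m).between b ((hm _ (Set.mem_Iic.2 le_rfl)).1 hb) j hj hjb fun a ha hab => ?_
      exact hall a ((hm a (Set.mem_Iic.2 hab.le)).2 ha) hab
  · obtain ⟨S, hS⟩ := hchain k hk le_rfl hxk
    refine ⟨S, fun j hj => ?_, fun j _ hjk _ => ⟨k, hS.last_mem, hjk⟩, hS.spaced, hS.between⟩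
    obtain ⟨h1, h2⟩ := hS.mem_range j hj
    exact ⟨h1, h2, ne_top_of_le_ne_top hxk (hmono j k h1 h2 le_rfl)⟩

/-! ### Dyadic bins -/

section Bins

variable {S : Set ℕ∞} {x : ℕ∞ → ℝ}

/-- A doubling sequence has at most one term in each dyadic interval around a reference scale `c`,
so a sum over its indices is bounded by a sum over dyadic intervals. -/
lemma tsum_le_of_doubling (hx : ∀ s ∈ S, 0 < x s) (hd : ∀ s ∈ S, ∀ t ∈ S, s < t → 2 * x s ≤ x t)
    {c : ℝ} (hc : 0 < c) {p : S → ℝ≥0∞} {lo hi : ℕ → ℝ≥0∞}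
    (hlo : ∀ s : S, ∀ m : ℕ, x s ≤ c / 2 ^ m → c / 2 ^ (m + 1) < x s → p s ≤ lo m)
    (hhi : ∀ s : S, ∀ m : ℕ, c < x s → 2 ^ m * c ≤ x s → x s < 2 ^ (m + 1) * c → p s ≤ hi m) :
    ∑' s, p s ≤ ∑' m, lo m + ∑' m, hi m := by
  have hbin : ∀ s : S, ∃ e : ℕ ⊕ ℕ,
      (∀ m, e = .inl m → x s ≤ c / 2 ^ m ∧ c / 2 ^ (m + 1) < x s) ∧
      (∀ m, e = .inr m → c < x s ∧ 2 ^ m * c ≤ x s ∧ x s < 2 ^ (m + 1) * c) := by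
    intro s
    have hs := hx s s.2
    rcases le_or_gt (x s) c with h | h
    · obtain ⟨m, h1, h2⟩ := exists_nat_pow_near_of_lt_one (div_pos hs hc) ((div_le_one hc).2 h)
        (by norm_num : (0 : ℝ) < 1 / 2) (by norm_num)
      rw [div_pow, one_pow, div_lt_div_iff₀ (by positivity) hc] at h1
      rw [div_pow, one_pow, div_le_div_iff₀ hc (by positivity)] at h2
      refine ⟨.inl m, fun m' hm' => ?_, fun m' hm' => by cases hm'⟩
      cases hm'
      rw [le_div_iff₀ (by positivity), div_lt_iff₀ (by positivity)]
      constructor <;> linarith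
    · obtain ⟨m, h1, h2⟩ := exists_nat_pow_near ((one_le_div hc).2 h.le) (by norm_num : (1 : ℝ) < 2)
      rw [le_div_iff₀ hc] at h1
      rw [div_lt_iff₀ hc] at h2
      refine ⟨.inr m, fun m' hm' => by (cases hm'), fun m' hm' => ?_⟩
      cases hm'
      exact ⟨h, h1, h2⟩
  choose e he1 he2 using hbin
  have hne : ∀ s t : S, s.1 < t.1 → e s ≠ e t := by
    intro s t hst hee
    have h2 := hd s s.2 t t.2 hst
    rcases hes : e s with m | m
    · obtain ⟨-, h3⟩ := he1 s m hes
      obtain ⟨h4, -⟩ := he1 t m (hee ▸ hes)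
      have : c / 2 ^ m = 2 * (c / 2 ^ (m + 1)) := by
        rw [pow_succ]
        field_simp
      linarith
    · obtain ⟨-, h3, -⟩ := he2 s m hes
      obtain ⟨-, -, h4⟩ := he2 t m (hee ▸ hes)
      rw [pow_succ] at h4
      linarith
  have hinj : Function.Injective e := by
    intro s t hst
    rcases lt_trichotomy s.1 t.1 with h | h | h
    · exact absurd hst (hne s t h)
    · exact Subtype.ext h
    · exact absurd hst.symm (hne t s h)
  calc ∑' s, p s ≤ ∑' s, Sum.elim lo hi (e s) := by
        refine ENNReal.tsum_le_tsum fun s => ?_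
        rcases hes : e s with m | m
        · exact hlo s m (he1 s m hes).1 (he1 s m hes).2
        · exact hhi s m (he2 s m hes).1 (he2 s m hes).2.1 (he2 s m hes).2.2
    _ ≤ ∑' q, Sum.elim lo hi q := ENNReal.tsum_comp_le_tsum_of_injective hinj _
    _ = _ := by
        rw [Summable.tsum_sum (f := Sum.elim lo hi) ENNReal.summable ENNReal.summable]
        rfl

/-- A doubling sequence has finitely many terms below any bound. -/
lemma finite_sublevel_of_doubling (hx : ∀ s ∈ S, 0 < x s)
    (hd : ∀ s ∈ S, ∀ t ∈ S, s < t → 2 * x s ≤ x t) (C : ℝ) : {s | s ∈ S ∧ x s ≤ C}.Finite := by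
  rcases S.eq_empty_or_nonempty with rfl | hne
  · simp
  obtain ⟨b, hbS, hbmin⟩ := WellFounded.has_min (wellFounded_lt (α := ℕ∞)) S hne
  have hb : ∀ s ∈ S, x b ≤ x s := by
    intro s hs
    rcases (not_lt.1 (hbmin s hs)).eq_or_lt with rfl | h
    · exact le_rfl
    · linarith [hd b hbS s hs h, hx b hbS]
  obtain ⟨N, hN⟩ := pow_unbounded_of_one_lt (C / x b) (by norm_num : (1 : ℝ) < 2)
  rw [div_lt_iff₀ (hx b hbS)] at hN
  have hbin : ∀ s ∈ S, ∃ m : ℕ, 2 ^ m ≤ x s / x b ∧ x s / x b < 2 ^ (m + 1) := fun s hs =>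
    exists_nat_pow_near ((one_le_div (hx b hbS)).2 (hb s hs)) (by norm_num)
  choose! e he1 he2 using hbin
  refine Set.Finite.of_injOn (f := e) (t := Set.Iio N) ?_ ?_ (Set.finite_Iio N)
  · rintro s ⟨hs, hsC⟩
    by_contra hcon
    have h1 := he1 s hs
    rw [le_div_iff₀ (hx b hbS)] at h1
    have h2 : (2 : ℝ) ^ N ≤ 2 ^ e s := pow_le_pow_right₀ (by norm_num) (not_lt.1 hcon)
    nlinarith [hx b hbS]
  · have key : ∀ s ∈ S, ∀ t ∈ S, s < t → e s ≠ e t := by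
      intro s hs t ht hst hee
      have h1 := he1 s hs
      have h2 := he2 t ht
      rw [← hee, pow_succ] at h2
      have h3 : 2 * (x s / x b) ≤ x t / x b := by
        rw [mul_div_assoc', div_le_div_iff_of_pos_right (hx b hbS)]
        exact hd s hs t ht hst
      linarith
    rintro s ⟨hs, -⟩ t ⟨ht, -⟩ hst
    rcases lt_trichotomy s t with h | h | h
    · exact absurd hst (key s hs t ht h)
    · exact h
    · exact absurd hst.symm (key t ht s hs h)

/-- A function on a doubling sequence that dominates the sequence attains its minimum. -/
lemma exists_forall_le_of_doubling (hx : ∀ s ∈ S, 0 < x s)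
    (hd : ∀ s ∈ S, ∀ t ∈ S, s < t → 2 * x s ≤ x t) (hne : S.Nonempty) {φ : ℕ∞ → ℝ}
    (hφ : ∀ s ∈ S, x s ≤ φ s) : ∃ l ∈ S, ∀ s ∈ S, φ l ≤ φ s := by
  obtain ⟨b, hb⟩ := hne
  obtain ⟨l, ⟨hlS, hl⟩, hmin⟩ := Set.exists_min_image {s | s ∈ S ∧ φ s ≤ φ b} φ
    (Set.Finite.subset (finite_sublevel_of_doubling hx hd (φ b))
      fun s hs => ⟨hs.1, (hφ s hs.1).trans hs.2⟩) ⟨b, hb, le_rfl⟩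
  refine ⟨l, hlS, fun s hs => ?_⟩
  rcases le_total (φ s) (φ b) with h | h
  · exact hmin s ⟨hs, h⟩
  · exact hl.trans h

end Bins

/-- A measurable choice of a minimizing index. -/
lemma exists_measurable_argmin {Y : Type*} [MeasurableSpace Y] {S : Set ℕ∞}
    {L : ℕ∞ → Y → ℝ≥0∞} (hL : ∀ s ∈ S, Measurable (L s))
    (hmin : ∀ y, ∃ s ∈ S, ∀ t ∈ S, L s y ≤ L t y) :
    ∃ J : Y → ℕ∞, Measurable J ∧ (∀ y, J y ∈ S) ∧ ∀ y, ∀ t ∈ S, L (J y) y ≤ L t y := by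
  let A : Y → Set ℕ∞ := fun y => {s | s ∈ S ∧ ∀ t ∈ S, L s y ≤ L t y}
  have hA : ∀ y, (A y).Nonempty := fun y => by
    obtain ⟨s, h1, h2⟩ := hmin y
    exact ⟨s, h1, h2⟩
  have hJ : ∀ y, sInf (A y) ∈ A y := fun y => csInf_mem (hA y)
  have hmA : ∀ s, MeasurableSet {y | s ∈ A y} := by
    intro s
    by_cases hs : s ∈ S
    · have : {y | s ∈ A y} = ⋂ t ∈ S, {y | L s y ≤ L t y} := by
        ext y
        simp [A, hs]
      rw [this]
      exact MeasurableSet.biInter S.to_countable fun t ht => measurableSet_le (hL s hs) (hL t ht)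
    · have : {y | s ∈ A y} = ∅ := by
        ext y
        simp [A, hs]
      rw [this]
      exact MeasurableSet.empty
  refine ⟨fun y => sInf (A y), measurable_to_countable' fun s => ?_, fun y => (hJ y).1,
    fun y => (hJ y).2⟩
  have : (fun y => sInf (A y)) ⁻¹' {s} = {y | s ∈ A y} ∩ ⋂ t ∈ Set.Iio s, {y | t ∈ A y}ᶜ := by
    ext y
    simp only [Set.mem_preimage, Set.mem_singleton_iff, Set.mem_inter_iff, Set.mem_iInter]
    constructor
    · rintro rfl
      exact ⟨hJ y, fun t ht hty => absurd (sInf_le (show t ∈ A y from hty)) (not_le.2 ht)⟩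
    · rintro ⟨h1, h2⟩
      refine le_antisymm (sInf_le h1) ?_
      by_contra hcon
      exact h2 _ (not_le.1 hcon) (hJ y)
  rw [this]
  exact (hmA s).inter (MeasurableSet.biInter (Set.to_countable _) fun t _ => (hmA t).compl)

/-! ### Coverage of the shortest interval -/

/-- The constant `25 / 32` is `z² / 2` at the smallest admissible `z`. -/
lemma gaussianTail_mul_le {z t : ℝ} (hz : 5 / 4 ≤ z) (ht : 1 ≤ t) :
    gaussianTail (t * z) ≤ Real.exp (-(25 / 32 * (t ^ 2 - 1))) * gaussianTail z := by
  have h := gaussianTail_add_le z (δ := (t - 1) * z) (mul_nonneg (by linarith) (by linarith))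
  rw [show z + (t - 1) * z = t * z by ring] at h
  refine h.trans (mul_le_mul_of_nonneg_right (Real.exp_le_exp.2 ?_) (gaussianTail_nonneg z))
  have h1 : 25 / 16 ≤ z ^ 2 := by nlinarith
  have h2 : 0 ≤ t ^ 2 - 1 := by nlinarith
  nlinarith [mul_le_mul_of_nonneg_right h1 h2]

lemma exp_neg_le_pow {u : ℝ} (hu : 0 ≤ u) {N : ℕ} (hN : N ≠ 0) :
    Real.exp (-u) ≤ (1 - u / N + (u / N) ^ 2 / 2) ^ N := by
  have h : Real.exp (-u) = Real.exp (-(u / N)) ^ N := by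
    rw [← Real.exp_nat_mul]
    congr 1
    field_simp
  rw [h]
  exact pow_le_pow_left₀ (Real.exp_pos _).le (exp_neg_le_quadratic (by positivity)) N

lemma exp_neg_div_le : Real.exp (-(25 / 32)) ≤ 0.458 :=
  (exp_neg_le_pow (by norm_num) (by norm_num : 32 ≠ 0)).trans (by norm_num)

/-- Decay of the normal tail, in the form in which it is summed over dyadic scales. -/
lemma gaussianTail_mul_le_geom {z t : ℝ} (hz : 5 / 4 ≤ z) (ht : 1 ≤ t) {u m : ℕ}
    (h : u + 5 * m + 1 ≤ t ^ 2) :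
    gaussianTail (t * z) ≤ gaussianTail z * (0.458 ^ u * (1 / 40) ^ m) := by
  have h1 : Real.exp (-(25 / 32 * (t ^ 2 - 1))) ≤ 0.458 ^ u * (1 / 40) ^ m := by
    calc Real.exp (-(25 / 32 * (t ^ 2 - 1))) ≤ Real.exp ((u + 5 * m : ℕ) * -(25 / 32)) := by
          refine Real.exp_le_exp.2 ?_
          push_cast
          linarith
      _ = Real.exp (-(25 / 32)) ^ (u + 5 * m) := Real.exp_nat_mul _ _
      _ ≤ 0.458 ^ (u + 5 * m) := pow_le_pow_left₀ (Real.exp_pos _).le exp_neg_div_le _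
      _ = 0.458 ^ u * (0.458 ^ 5) ^ m := by rw [pow_add, pow_mul]
      _ ≤ _ := by gcongr; norm_num
  rw [mul_comm (gaussianTail z)]
  exact (gaussianTail_mul_le hz ht).trans (mul_le_mul_of_nonneg_right h1 (gaussianTail_nonneg z))

lemma gaussianTail_three_halves_le {z : ℝ} (hz : 5 / 4 ≤ z) :
    gaussianTail (3 / 2 * z) ≤ gaussianTail z * 0.3768 := by
  rw [mul_comm (gaussianTail z)]
  refine (gaussianTail_mul_le hz (by norm_num)).trans
    (mul_le_mul_of_nonneg_right ?_ (gaussianTail_nonneg z))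
  exact (exp_neg_le_pow (by norm_num) (by norm_num : 32 ≠ 0)).trans (by norm_num)

/-- A pair of jointly Gaussian estimators of `θ` at scale `x`: both have standard deviation at most
`x / z`, the upper one `A` has bias at least `-x/2` and the lower one `B` has bias at most `x/2`. -/
structure IsBracketingPair {Ω : Type*} [MeasurableSpace Ω] (P : Measure Ω) (z θ x : ℝ)
    (A B : Ω → ℝ) : Prop where
  pos : 0 < x
  gaussian : ∀ r q : ℝ, HasGaussianLaw (fun ω => r * A ω + q * B ω) P
  variance_upper : Var[A; P] ≤ (x / z) ^ 2
  variance_lower : Var[B; P] ≤ (x / z) ^ 2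
  upper : θ - x / 2 ≤ ∫ ω, A ω ∂P
  lower : ∫ ω, B ω ∂P ≤ θ + x / 2

/-- The samples for which the interval with centre `(A + B) / 2` and half-length `(A - B)₊ + 2 x`
misses `θ`. -/
def missSet {Ω : Type*} (θ x : ℝ) (A B : Ω → ℝ) : Set Ω :=
  {ω | θ ∉ Set.Icc ((A ω + B ω) / 2 - (max (A ω - B ω) 0 + 2 * x))
    ((A ω + B ω) / 2 + (max (A ω - B ω) 0 + 2 * x))}

section Pair

variable {Ω : Type*} [MeasurableSpace Ω] {P : Measure Ω} {z θ x : ℝ}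
  {A B : Ω → ℝ}

lemma variance_linear_comb_le [IsProbabilityMeasure P]
    {v : ℝ} (hA : MemLp A 2 P) (hB : MemLp B 2 P) (hv : Var[A; P] ≤ v)
    (hw : Var[B; P] ≤ v) (r q : ℝ) :
    Var[fun ω => r * A ω + q * B ω; P] ≤ (|r| + |q|) ^ 2 * v := by
  have h1 := variance_fun_add hA hB
  have h2 := variance_fun_sub hA hB
  have h3 := variance_fun_add (hA.const_mul r) (hB.const_mul q)
  rw [variance_const_mul, variance_const_mul, covariance_const_mul_left,
    covariance_const_mul_right] at h3
  have h4 := variance_nonneg (fun ω => A ω + B ω) P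
  have h5 := variance_nonneg (fun ω => A ω - B ω) P
  have hc : |cov[A, B; P]| ≤ v := abs_le.2 ⟨by linarith, by linarith⟩
  have h6 : r * (q * cov[A, B; P]) ≤ |r| * |q| * v := by
    rw [← mul_assoc]
    refine (le_abs_self _).trans ?_
    rw [abs_mul, abs_mul]
    gcongr
  rw [h3]
  nlinarith [mul_le_mul_of_nonneg_left hv (sq_nonneg r),
    mul_le_mul_of_nonneg_left hw (sq_nonneg q), sq_abs r, sq_abs q]

namespace IsBracketingPair

lemma memLp_upper (h : IsBracketingPair P z θ x A B) : MemLp A 2 P := by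
  simpa using (h.gaussian 1 0).memLp_two

lemma memLp_lower (h : IsBracketingPair P z θ x A B) : MemLp B 2 P := by
  simpa using (h.gaussian 0 1).memLp_two

lemma integral_comb [IsProbabilityMeasure P] (h : IsBracketingPair P z θ x A B) (r q : ℝ) :
    ∫ ω, (r * A ω + q * B ω) ∂P = r * ∫ ω, A ω ∂P + q * ∫ ω, B ω ∂P := by
  have hA := h.memLp_upper.integrable one_le_two
  have hB := h.memLp_lower.integrable one_le_two
  rw [integral_add (hA.const_mul r) (hB.const_mul q), integral_const_mul, integral_const_mul]

/-- Tail bound for a linear combination of the two estimators, in units of `(|r| + |q|) x`. -/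
lemma measure_le [IsProbabilityMeasure P] (h : IsBracketingPair P z θ x A B) (hz : 0 < z) {r q t c : ℝ}
    (ht : 0 < t)
    (hrq : 0 < |r| + |q|)
    (hc : r * ∫ ω, A ω ∂P + q * ∫ ω, B ω ∂P + t * ((|r| + |q|) * x) ≤ c) :
    P {ω | c ≤ r * A ω + q * B ω} ≤ ENNReal.ofReal (gaussianTail (t * z)) := by
  have hx := h.pos
  refine HasGaussianLaw.measure_ge_le (h.gaussian r q) (σ := (|r| + |q|) * (x / z))
    (by positivity) (by positivity) ?_ ?_
  · rw [mul_pow]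
    exact variance_linear_comb_le h.memLp_upper h.memLp_lower h.variance_upper h.variance_lower r q
  · rw [h.integral_comb]
    have : t * z * ((|r| + |q|) * (x / z)) = t * ((|r| + |q|) * x) := by field_simp
    linarith

lemma measure_missSet_le {U V : Set Ω} {p q : ℝ}
    (hU : ∀ ω, (A ω + B ω) / 2 + (max (A ω - B ω) 0 + 2 * x) < θ → ω ∈ U)
    (hV : ∀ ω, θ < (A ω + B ω) / 2 - (max (A ω - B ω) 0 + 2 * x) → ω ∈ V)
    (hp : P U ≤ ENNReal.ofReal p) (hq : P V ≤ ENNReal.ofReal q) (hp0 : 0 ≤ p) (hq0 : 0 ≤ q) :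
    P (missSet θ x A B) ≤ ENNReal.ofReal (p + q) := by
  rw [ENNReal.ofReal_add hp0 hq0]
  refine (measure_mono (t := U ∪ V) fun ω hω => ?_).trans
    ((measure_union_le U V).trans (add_le_add hp hq))
  have hω' : θ ∉ Set.Icc _ _ := hω
  rw [Set.mem_Icc, not_and_or, not_le, not_le] at hω'
  exact hω'.elim (fun h => Or.inr (hV ω h)) (fun h => Or.inl (hU ω h))

/-- If the interval misses `θ` then `A ≤ θ - 2x` or `B ≥ θ + 2x`. The two distances of the means
from these thresholds add up to `4 x + d`, where `d` is the mean of `A - B`. -/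
lemma measure_missSet_le_endpoints [IsProbabilityMeasure P]
    (h : IsBracketingPair P z θ x A B) (hz : 0 < z) {t : ℝ}
    (ht : 3 / 2 ≤ t) (htd : 2 * t * x ≤ 4 * x + (∫ ω, A ω ∂P - ∫ ω, B ω ∂P)) :
    P (missSet θ x A B) ≤
      ENNReal.ofReal (gaussianTail (3 / 2 * z) + gaussianTail (t * z)) := by
  have hx := h.pos
  have hup := h.upper
  have hlo := h.lower
  have key : ∀ t₁ t₂ : ℝ, 0 < t₁ → 0 < t₂ → t₁ * x ≤ 2 * x + (∫ ω, A ω ∂P - θ) →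
      t₂ * x ≤ 2 * x + (θ - ∫ ω, B ω ∂P) → P (missSet θ x A B) ≤
      ENNReal.ofReal (gaussianTail (t₁ * z) + gaussianTail (t₂ * z)) := by
    intro t₁ t₂ h₁ h₂ h₁' h₂'
    refine measure_missSet_le (U := {ω | 2 * x - θ ≤ -1 * A ω + 0 * B ω})
      (V := {ω | 2 * x + θ ≤ 0 * A ω + 1 * B ω}) (fun ω hω => ?_) (fun ω hω => ?_)
      (h.measure_le hz h₁ (by norm_num) ?_) (h.measure_le hz h₂ (by norm_num) ?_)
      (gaussianTail_nonneg _) (gaussianTail_nonneg _)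
    · change 2 * x - θ ≤ -1 * A ω + 0 * B ω
      linarith [le_max_left (A ω - B ω) 0, le_max_right (A ω - B ω) 0]
    · change 2 * x + θ ≤ 0 * A ω + 1 * B ω
      linarith [le_max_left (A ω - B ω) 0, le_max_right (A ω - B ω) 0]
    · norm_num
      linarith
    · norm_num
      linarith
  rcases le_total (t * x) (2 * x + (∫ ω, A ω ∂P - θ)) with h1 | h1
  · rw [add_comm]
    exact key t (3 / 2) (by linarith) (by norm_num) h1 (by linarith)
  · exact key (3 / 2) t (by norm_num) (by linarith) (by linarith) (by linarith)

/-- If the interval misses `θ` then `(A + B) / 2 + (A - B) ≤ θ - 2 x` or `(A + B) / 2 - (A - B) ≥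
θ + 2 x`; the means of both sides are on the other side of the threshold, by a margin that grows
with the mean `d` of `A - B`. -/
lemma measure_missSet_le_center [IsProbabilityMeasure P]
    (h : IsBracketingPair P z θ x A B) (hz : 0 < z) {t : ℝ}
    (ht : 0 < t) (htd : 4 * t * x ≤ 3 * x + (∫ ω, A ω ∂P - ∫ ω, B ω ∂P)) :
    P (missSet θ x A B) ≤ ENNReal.ofReal (gaussianTail (t * z) + gaussianTail (t * z)) := by
  have hx := h.pos
  have hup := h.upper
  have hlo := h.lower
  refine measure_missSet_le (U := {ω | 2 * x - θ ≤ -(3 / 2) * A ω + 1 / 2 * B ω})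
    (V := {ω | 2 * x + θ ≤ -(1 / 2) * A ω + 3 / 2 * B ω}) (fun ω hω => ?_) (fun ω hω => ?_)
    (h.measure_le hz ht (by positivity) ?_) (h.measure_le hz ht (by positivity) ?_)
    (gaussianTail_nonneg _) (gaussianTail_nonneg _)
  · change 2 * x - θ ≤ -(3 / 2) * A ω + 1 / 2 * B ω
    linarith [le_max_left (A ω - B ω) 0, le_max_right (A ω - B ω) 0]
  · change 2 * x + θ ≤ -(1 / 2) * A ω + 3 / 2 * B ω
    linarith [le_max_left (A ω - B ω) 0, le_max_right (A ω - B ω) 0]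
  · rw [abs_neg, abs_of_pos (by norm_num : (0 : ℝ) < 3 / 2),
      abs_of_pos (by norm_num : (0 : ℝ) < 1 / 2)]
    linarith
  · rw [abs_neg, abs_of_pos (by norm_num : (0 : ℝ) < 3 / 2),
      abs_of_pos (by norm_num : (0 : ℝ) < 1 / 2)]
    linarith

/-- The interval of scale `y > x` is unlikely to be preferred to the one of scale `x`. -/
lemma measure_preferred_le [IsProbabilityMeasure P]
    (h : IsBracketingPair P z θ x A B) (hz : 0 < z) {y t : ℝ} (hy : x < y)
    (ht : 0 < t) (htd : 2 * t * x ≤ 2 * (y - x) - (∫ ω, A ω ∂P - ∫ ω, B ω ∂P)) {D : Ω → ℝ} :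
    P {ω | 2 * y + max (D ω) 0 ≤ 2 * x + max (A ω - B ω) 0} ≤
      ENNReal.ofReal (gaussianTail (t * z)) := by
  refine (measure_mono fun ω hω => ?_).trans
    (h.measure_le hz (r := 1) (q := -1) (c := 2 * (y - x)) ht (by norm_num) ?_)
  · have hω' : 2 * y + max (D ω) 0 ≤ 2 * x + max (A ω - B ω) 0 := hω
    change 2 * (y - x) ≤ 1 * A ω + -1 * B ω
    have h1 := le_max_right (D ω) 0
    rcases max_cases (A ω - B ω) 0 with ⟨h2, -⟩ | ⟨h2, -⟩ <;> linarith
  · norm_num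
    linarith

end IsBracketingPair

end Pair

/-- The sequence `b₀, b₁, k, k r, k r², …`. -/
def headGeom (b₀ b₁ k r : ℝ) : ℕ → ℝ
  | 0 => b₀
  | 1 => b₁
  | m + 2 => k * r ^ m

lemma hasSum_headGeom (b₀ b₁ k : ℝ) {r : ℝ} (hr0 : 0 ≤ r) (hr1 : r < 1) :
    HasSum (headGeom b₀ b₁ k r) (b₀ + b₁ + k * (1 - r)⁻¹) := by
  rw [← hasSum_nat_add_iff' 2]
  simpa [Finset.sum_range_succ, headGeom] using (hasSum_geometric_of_lt_one hr0 hr1).mul_left k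

lemma tsum_ofReal_mul_le {G a : ℝ} {β : ℕ → ℝ} (hG : 0 ≤ G) (hβ : ∀ m, 0 ≤ β m)
    (h : HasSum β a) : ∑' m, ENNReal.ofReal (G * β m) = ENNReal.ofReal (G * a) := by
  rw [← ENNReal.ofReal_tsum_of_nonneg (fun m => mul_nonneg hG (hβ m)) (h.mul_left G).summable,
    (h.mul_left G).tsum_eq]

section Selection

variable {Ω : Type*} [MeasurableSpace Ω] {P : Measure Ω} [IsProbabilityMeasure P] {z θ : ℝ}
  {S : Set ℕ∞} {x : ℕ∞ → ℝ} {A B : ℕ∞ → Ω → ℝ} {J : Ω → ℕ∞}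

/-- The samples for which the interval of index `s` is chosen and misses `θ`. -/
def selectedMiss (θ : ℝ) (x : ℕ∞ → ℝ) (A B : ℕ∞ → Ω → ℝ) (J : Ω → ℕ∞) (s : ℕ∞) : Set Ω :=
  {ω | J ω = s ∧ ω ∈ missSet θ (x s) (A s) (B s)}


/-- The numerical bounds on the probability that the interval of index `s` is chosen and misses
`θ`; `d` is the mean of `A s - B s`. In units of `G = 1 - Φ(z)` the tails at `3/2 z`, `2 z`, `3 z`
are at most `0.3768`, `0.097`, `0.002`, and `0.7536 = 2 * 0.3768`, `0.4738 = 0.3768 + 0.097`,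
`0.3788 = 0.3768 + 0.002`. -/
structure MissBounds (G : ℝ) (p : ℝ≥0∞) (x d : ℝ) : Prop where
  always : p ≤ ENNReal.ofReal (G * 0.7536)
  of_nonneg : 0 ≤ d → p ≤ ENNReal.ofReal (G * 0.4738)
  of_two_mul_le : 2 * x ≤ d → p ≤ ENNReal.ofReal (G * 0.3788)
  of_pow_le : ∀ m : ℕ, (2 ^ (m + 3) - 2) * x ≤ d → p ≤ ENNReal.ofReal (G * (0.0882 * (1 / 40) ^ m))

lemma IsBracketingPair.missBounds {x : ℝ} {A B : Ω → ℝ} (h : IsBracketingPair P z θ x A B)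
    (hz : 5 / 4 ≤ z) {p : ℝ≥0∞} (hp : p ≤ P (missSet θ x A B)) :
    MissBounds (gaussianTail z) p x (∫ ω, A ω ∂P - ∫ ω, B ω ∂P) := by
  have hz0 : 0 < z := by linarith
  have hx := h.pos
  have hup := h.upper
  have hlo := h.lower
  have h15 := gaussianTail_three_halves_le hz
  have hG := gaussianTail_nonneg z
  refine ⟨?_, fun hd => ?_, fun hd => ?_, fun m hd => ?_⟩
  · refine hp.trans ((h.measure_missSet_le_endpoints hz0 le_rfl (by linarith)).trans ?_)
    exact ENNReal.ofReal_le_ofReal (by linarith)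
  · refine hp.trans ((h.measure_missSet_le_endpoints hz0 (t := 2) (by norm_num)
      (by linarith)).trans ?_)
    have := gaussianTail_mul_le_geom hz (t := 2) (u := 3) (m := 0) (by norm_num) (by norm_num)
    refine ENNReal.ofReal_le_ofReal ?_
    norm_num at this
    linarith
  · refine hp.trans ((h.measure_missSet_le_endpoints hz0 (t := 3) (by norm_num)
      (by linarith)).trans ?_)
    have := gaussianTail_mul_le_geom hz (t := 3) (u := 8) (m := 0) (by norm_num) (by norm_num)
    refine ENNReal.ofReal_le_ofReal ?_
    norm_num at this
    linarith
  · have h2 : (m : ℝ) + 1 ≤ 2 ^ m := by exact_mod_cast Nat.lt_two_pow_self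
    have hm : (0 : ℝ) ≤ m := m.cast_nonneg
    refine hp.trans ((h.measure_missSet_le_center hz0 (t := 1 / 4 + 2 * 2 ^ m) (by positivity)
      ?_).trans ?_)
    · rw [pow_add] at hd
      linarith
    · have := gaussianTail_mul_le_geom hz (t := 1 / 4 + 2 * 2 ^ m) (u := 4) (m := m)
        (by linarith) (by push_cast; nlinarith)
      refine ENNReal.ofReal_le_ofReal ?_
      have hr : (0 : ℝ) ≤ (1 / 40) ^ m := by positivity
      have h3 : (0.458 : ℝ) ^ 4 * (1 / 40) ^ m ≤ 0.0441 * (1 / 40) ^ m := by gcongr; norm_num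
      have h4 := mul_le_mul_of_nonneg_left h3 hG
      linarith

/-- The probability that the larger scale `y` is selected in the presence of the scale `xl`. -/
lemma IsBracketingPair.preferred_geom {xl : ℝ} {A B : Ω → ℝ} (h : IsBracketingPair P z θ xl A B)
    (hz : 5 / 4 ≤ z) {y t : ℝ} {D : Ω → ℝ} {p : ℝ≥0∞} (hy : xl < y)
    (hp : p ≤ P {ω | 2 * y + max (D ω) 0 ≤ 2 * xl + max (A ω - B ω) 0}) (ht : 1 ≤ t) {u m : ℕ}
    (hum : u + 5 * m + 1 ≤ t ^ 2)
    (htd : 2 * t * xl ≤ 2 * (y - xl) - (∫ ω, A ω ∂P - ∫ ω, B ω ∂P)) :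
    p ≤ ENNReal.ofReal (gaussianTail z * (0.458 ^ u * (1 / 40) ^ m)) :=
  hp.trans ((h.measure_preferred_le (by linarith) hy (by linarith) htd).trans
    (ENNReal.ofReal_le_ofReal (gaussianTail_mul_le_geom hz ht hum)))

/-- The shortest of the intervals with centres `(A s + B s) / 2` and half-lengths `(A s - B s)₊ +
2 x_s` covers `θ`, up to an event of probability at most `2 (1 - Φ(z))`. The event is split
according to the index chosen, and the indices are binned dyadically around the scale of the index
`l` that minimizes `2 x_s + (d_s)₊`, where `d_s` is the mean of `A s - B s`: for smaller scales
`d_s` is large compared with `x_s`, so that a miss is unlikely, and larger scales are unlikely to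
be preferred to `l`. -/
theorem measure_selectedMiss_le (hz : 5 / 4 ≤ z) (hne : S.Nonempty)
    (hpair : ∀ s ∈ S, IsBracketingPair P z θ (x s) (A s) (B s))
    (hd : ∀ s ∈ S, ∀ t ∈ S, s < t → 2 * x s ≤ x t) (hJ : ∀ ω, J ω ∈ S)
    (hmin : ∀ ω, ∀ l ∈ S, 2 * x (J ω) + max (A (J ω) ω - B (J ω) ω) 0 ≤
      2 * x l + max (A l ω - B l ω) 0) :
    P {ω | ω ∈ missSet θ (x (J ω)) (A (J ω)) (B (J ω))} ≤
      ENNReal.ofReal (2 * gaussianTail z) := by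
  have hx : ∀ s ∈ S, 0 < x s := fun s hs => (hpair s hs).pos
  have hG := gaussianTail_nonneg z
  set G := gaussianTail z with hGdef
  let p : S → ℝ≥0∞ := fun s => P (selectedMiss θ x A B J s)
  let d : ℕ∞ → ℝ := fun s => ∫ ω, A s ω ∂P - ∫ ω, B s ω ∂P
  let M : ℕ∞ → ℝ := fun s => 2 * x s + max (d s) 0
  have hsum : P {ω | ω ∈ missSet θ (x (J ω)) (A (J ω)) (B (J ω))} ≤ ∑' s, p s := by
    refine (measure_mono (t := ⋃ s : S, selectedMiss θ x A B J s) fun ω hω => ?_).trans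
      (measure_iUnion_le _)
    exact Set.mem_iUnion.2 ⟨⟨J ω, hJ ω⟩, rfl, hω⟩
  refine hsum.trans ?_
  have hmiss : ∀ s : S, MissBounds G (p s) (x s) (d s) := fun s =>
    (hpair s s.2).missBounds hz (measure_mono fun ω hω => hω.2)
  have hpref : ∀ (l s : S), x l < x s → ∀ (t : ℝ) (u m : ℕ), 1 ≤ t → u + 5 * m + 1 ≤ t ^ 2 →
      2 * t * x l ≤ 2 * (x s - x l) - d l →
      p s ≤ ENNReal.ofReal (G * (0.458 ^ u * (1 / 40) ^ m)) := by
    intro l s hls t u m ht hum htd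
    refine (hpair l l.2).preferred_geom hz hls (D := fun ω => A s ω - B s ω)
      (measure_mono fun ω hω => ?_) ht hum htd
    have := hmin ω l l.2
    rwa [hω.1] at this
  have hM : ∀ s, 2 * x s ≤ M s ∧ 2 * x s + d s ≤ M s := fun s =>
    ⟨le_add_of_nonneg_right (le_max_right _ _), add_le_add_right (le_max_left _ _) _⟩
  have hM' : ∀ s, M s = 2 * x s + d s ∨ (d s < 0 ∧ M s = 2 * x s) := fun s => by
    rcases max_cases (d s) 0 with ⟨h1, -⟩ | ⟨h1, h2⟩
    · exact Or.inl (by simp only [M, h1])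
    · exact Or.inr ⟨h2, by simp only [M, h1, add_zero]⟩
  obtain ⟨l₀, hl₀S, hl₀⟩ := exists_forall_le_of_doubling hx hd hne (φ := M)
    fun s hs => by linarith [(hM s).1, hx s hs]
  have hpow : ∀ m : ℕ, (m : ℝ) + 1 ≤ 2 ^ m := fun m => by exact_mod_cast Nat.lt_two_pow_self
  have hr : ∀ m : ℕ, (0 : ℝ) ≤ (1 / 40) ^ m := fun m => by positivity
  have hmono : ∀ {a b : ℝ}, a ≤ b → ENNReal.ofReal (G * a) ≤ ENNReal.ofReal (G * b) :=
    fun h => ENNReal.ofReal_le_ofReal (mul_le_mul_of_nonneg_left h hG)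
  have hbins : ∀ {c : ℝ} {lo hi : ℕ → ℝ} {a b : ℝ}, 0 < c → HasSum lo a → HasSum hi b →
      (∀ m, 0 ≤ lo m) → (∀ m, 0 ≤ hi m) → a + b ≤ 2 →
      (∀ s : S, ∀ m : ℕ, x s ≤ c / 2 ^ m → c / 2 ^ (m + 1) < x s →
        p s ≤ ENNReal.ofReal (G * lo m)) →
      (∀ s : S, ∀ m : ℕ, c < x s → 2 ^ m * c ≤ x s → x s < 2 ^ (m + 1) * c →
        p s ≤ ENNReal.ofReal (G * hi m)) →
      ∑' s, p s ≤ ENNReal.ofReal (2 * G) := by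
    intro c lo hi a b hc ha hb hlo0 hhi0 hab hlo hhi
    refine (tsum_le_of_doubling hx hd hc hlo hhi).trans ?_
    rw [tsum_ofReal_mul_le hG hlo0 ha, tsum_ofReal_mul_le hG hhi0 hb,
      ← ENNReal.ofReal_add (mul_nonneg hG (ha.nonneg hlo0)) (mul_nonneg hG (hb.nonneg hhi0))]
    refine ENNReal.ofReal_le_ofReal ?_
    nlinarith
  by_cases hcase : ∃ l ∈ S, (∀ s ∈ S, M l ≤ M s) ∧ d l ≤ 2 * x l
  · -- the minimum is essentially due to the scale `x l`, which is taken as the reference scale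
    obtain ⟨l, hlS, hl, hdl⟩ := hcase
    have hxl := hx l hlS
    have hnear : ∀ s : S, x l / 2 < x s → x s < 2 * x l → s.1 = l := by
      intro s h1 h2
      rcases lt_trichotomy s.1 l with h | h | h
      · linarith [hd s s.2 l hlS h]
      · exact h
      · linarith [hd l hlS s s.2 h]
    have hlow : ∀ s : S, x s < x l → 2 * x l - 2 * x s ≤ d s := by
      intro s hs
      have h1 := hl s s.2
      rcases hM' s with h2 | ⟨-, h2⟩ <;> linarith [(hM l).1]
    have hlo : ∀ b₀, (p ⟨l, hlS⟩ ≤ ENNReal.ofReal (G * b₀)) → ∀ s : S, ∀ m : ℕ,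
        x s ≤ x l / 2 ^ m → x l / 2 ^ (m + 1) < x s →
        p s ≤ ENNReal.ofReal (G * headGeom b₀ 0.3788 0.0882 (1 / 40) m) := by
      intro b₀ hb₀ s m h1 h2
      have hxs := hx s s.2
      rw [le_div_iff₀ (by positivity)] at h1
      match m with
      | 0 =>
        have : s = ⟨l, hlS⟩ := Subtype.ext (hnear s (by simpa using h2) (by
          simp only [pow_zero, mul_one] at h1
          linarith))
        rw [this]
        exact hb₀
      | 1 =>
        simp only [pow_one] at h1
        exact (hmiss s).of_two_mul_le (by linarith [hlow s (by linarith)])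
      | m + 2 =>
        have h3 := hpow m
        rw [pow_add] at h1
        refine (hmiss s).of_pow_le m ?_
        have h4 := hlow s (by nlinarith [(m.cast_nonneg : (0:ℝ) ≤ m)])
        rw [pow_add]
        linarith
    have hhi : ∀ b, (∀ s : S, ∀ m : ℕ, 2 ^ (m + 2) * x l ≤ x s → p s ≤ ENNReal.ofReal
        (G * (b * (1 / 40) ^ m))) → ∀ s : S, ∀ m : ℕ, x l < x s → 2 ^ m * x l ≤ x s →
        x s < 2 ^ (m + 1) * x l →
        p s ≤ ENNReal.ofReal (G * headGeom 0 0.7536 b (1 / 40) m) := by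
      intro b hb s m h1 h2 h3
      match m with
      | 0 =>
        have := hnear s (by linarith) (by norm_num at h3; linarith)
        rw [this] at h1
        exact absurd h1 (lt_irrefl _)
      | 1 => exact (hmiss s).always
      | m + 2 => exact hb s m h2
    have hnn : ∀ b₀ b₁ k : ℝ, 0 ≤ b₀ → 0 ≤ b₁ → 0 ≤ k → ∀ m, 0 ≤ headGeom b₀ b₁ k (1 / 40) m := by
      intro b₀ b₁ k h0 h1 hk m
      match m with
      | 0 => exact h0
      | 1 => exact h1
      | m + 2 => exact mul_nonneg hk (hr m)
    rcases lt_or_ge (d l) 0 with hneg | hnonneg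
    · refine hbins hxl (hasSum_headGeom 0.7536 0.3788 0.0882 (r := 1 / 40) (by norm_num)
        (by norm_num)) (hasSum_headGeom 0 0.7536 0.002 (r := 1 / 40) (by norm_num) (by norm_num))
        (hnn _ _ _ (by norm_num) (by norm_num) (by norm_num))
        (hnn _ _ _ (by norm_num) (by norm_num) (by norm_num)) (by norm_num)
        (hlo _ (hmiss ⟨l, hlS⟩).always) (hhi _ fun s m hs => ?_)
      have h3 := hpow m
      have hm : (0 : ℝ) ≤ m := m.cast_nonneg
      rw [pow_add] at hs
      refine (hpref ⟨l, hlS⟩ s (by change x l < x s; nlinarith) (4 * 2 ^ m - 1) 8 m (by linarith)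
        (by push_cast; nlinarith) ?_).trans (hmono ?_)
      · change 2 * (4 * 2 ^ m - 1) * x l ≤ 2 * (x s - x l) - d l
        linarith
      · gcongr
        norm_num
    · refine hbins hxl (hasSum_headGeom 0.4738 0.3788 0.0882 (r := 1 / 40) (by norm_num)
        (by norm_num)) (hasSum_headGeom 0 0.7536 0.097 (r := 1 / 40) (by norm_num) (by norm_num))
        (hnn _ _ _ (by norm_num) (by norm_num) (by norm_num))
        (hnn _ _ _ (by norm_num) (by norm_num) (by norm_num)) (by norm_num)
        (hlo _ ((hmiss ⟨l, hlS⟩).of_nonneg hnonneg)) (hhi _ fun s m hs => ?_)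
      have h3 := hpow m
      have hm : (0 : ℝ) ≤ m := m.cast_nonneg
      rw [pow_add] at hs
      refine (hpref ⟨l, hlS⟩ s (by change x l < x s; nlinarith) (4 * 2 ^ m - 2) 3 m (by linarith)
        (by push_cast; nlinarith) ?_).trans (hmono ?_)
      · change 2 * (4 * 2 ^ m - 2) * x l ≤ 2 * (x s - x l) - d l
        linarith
      · gcongr
        norm_num
  · -- the minimum of `M` is essentially due to the mean difference; it is taken as reference scale
    push Not at hcase
    have hdl := hcase l₀ hl₀S hl₀
    have hxl := hx l₀ hl₀S
    have hMl : M l₀ = 2 * x l₀ + d l₀ := by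
      rcases hM' l₀ with h | ⟨h, -⟩
      · exact h
      · linarith
    have hc : 0 < M l₀ := by linarith
    have hlow : ∀ s : S, x s ≤ M l₀ / 2 → M l₀ - 2 * x s ≤ d s := by
      intro s hs
      have h1 := hl₀ s s.2
      rcases hM' s with h2 | ⟨h2, h3⟩
      · linarith
      · -- a negative mean difference would make `s` another minimizer, of the other kind
        have := hcase s s.2 fun t ht => by linarith [hl₀ t ht]
        linarith [hx s s.2]
    refine hbins hc (lo := headGeom 0.7536 0.4738 0.3788 (1 / 4))
      (hi := fun m => 0.097 * (1 / 40) ^ m) (hasSum_headGeom _ _ _ (by norm_num) (by norm_num))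
      ((hasSum_geometric_of_lt_one (by norm_num) (by norm_num)).mul_left _) ?_
      (fun m => mul_nonneg (by norm_num) (hr m)) (by norm_num) ?_ ?_
    · intro m
      match m with
      | 0 => norm_num [headGeom]
      | 1 => norm_num [headGeom]
      | m + 2 => simp only [headGeom]; positivity
    · intro s m h1 h2
      have hxs := hx s s.2
      match m with
      | 0 => exact (hmiss s).always
      | 1 =>
        rw [pow_one] at h1
        exact (hmiss s).of_nonneg (by linarith [hlow s h1])
      | 2 =>
        have := hlow s (by linarith)
        refine ((hmiss s).of_two_mul_le (by linarith)).trans (hmono (by norm_num [headGeom]))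
      | m + 3 =>
        have h3 := hpow m
        have hm : (0 : ℝ) ≤ m := m.cast_nonneg
        rw [le_div_iff₀ (by positivity), pow_add] at h1
        have h4 := hlow s (by nlinarith)
        refine ((hmiss s).of_pow_le m (by rw [pow_add]; linarith)).trans (hmono ?_)
        have h5 : (1 / 40 : ℝ) ^ m ≤ (1 / 4) ^ m := by gcongr; norm_num
        have h6 : (0 : ℝ) ≤ (1 / 40) ^ m := hr m
        simp only [headGeom, pow_succ]
        linarith
    · intro s m h1 h2 _
      have h3 := hpow m
      have hm : (0 : ℝ) ≤ m := m.cast_nonneg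
      refine (hpref ⟨l₀, hl₀S⟩ s (by change x l₀ < x s; linarith) (4 * 2 ^ m - 2) 3 m (by linarith)
        (by push_cast; nlinarith) ?_).trans (hmono ?_)
      · change 2 * (4 * 2 ^ m - 2) * x l₀ ≤ 2 * (x s - x l₀) - d l₀
        nlinarith
      · gcongr
        norm_num

end Selection

/-! ### Expected length -/

/-- The expected length of the interval of scale `x`, from `2 D₊ ≤ D² / (4 x) + D + x`. -/
lemma IsBracketingPair.lintegral_length_le {Ω : Type*} [MeasurableSpace Ω] {P : Measure Ω}
    [IsProbabilityMeasure P] {z θ x : ℝ} {A B : Ω → ℝ} (h : IsBracketingPair P z θ x A B)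
    (hz : 5 / 4 ≤ z) (hd : ∫ ω, A ω ∂P - ∫ ω, B ω ∂P ≤ x) :
    ∫⁻ ω, ENNReal.ofReal (2 * (max (A ω - B ω) 0 + 2 * x)) ∂P ≤ ENNReal.ofReal (8 * x) := by
  have hx := h.pos
  have hup := h.upper
  have hlo := h.lower
  have hD : MemLp (fun ω => A ω - B ω) 2 P := h.memLp_upper.sub h.memLp_lower
  have hint : Integrable (fun ω => A ω - B ω) P := hD.integrable one_le_two
  have hsq : Integrable (fun ω => (A ω - B ω) ^ 2) P := hD.integrable_sq
  have hm : ∫ ω, (A ω - B ω) ∂P = ∫ ω, A ω ∂P - ∫ ω, B ω ∂P :=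
    integral_sub (h.memLp_upper.integrable one_le_two) (h.memLp_lower.integrable one_le_two)
  set d := ∫ ω, A ω ∂P - ∫ ω, B ω ∂P with hdd
  have hvar : Var[fun ω => A ω - B ω; P] ≤ 4 * (x / z) ^ 2 := by
    have := variance_linear_comb_le h.memLp_upper h.memLp_lower h.variance_upper
      h.variance_lower 1 (-1)
    norm_num at this
    simpa [sub_eq_add_neg] using this
  have hzx : (x / z) ^ 2 ≤ 16 / 25 * x ^ 2 := by
    rw [div_pow, div_le_iff₀ (by positivity)]
    nlinarith [mul_le_mul_of_nonneg_left (show 25 / 16 ≤ z ^ 2 by nlinarith) (sq_nonneg x)]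
  have hE : ∫ ω, (A ω - B ω) ^ 2 ∂P ≤ 89 / 25 * x ^ 2 := by
    have h1 := variance_eq_sub hD
    simp only [Pi.pow_apply] at h1
    rw [hm] at h1
    have h2 : d ^ 2 ≤ x ^ 2 := sq_le_sq' (by linarith) hd
    linarith
  have hintc : Integrable (fun ω => (A ω - B ω) ^ 2 / (4 * x) + (A ω - B ω)) P :=
    (hsq.div_const _).add hint
  have hintb : Integrable (fun ω => (A ω - B ω) ^ 2 / (4 * x) + (A ω - B ω) + 5 * x) P :=
    hintc.add (integrable_const _)
  have hpt : ∀ ω, 2 * (max (A ω - B ω) 0 + 2 * x) ≤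
      (A ω - B ω) ^ 2 / (4 * x) + (A ω - B ω) + 5 * x := by
    intro ω
    have h1 : (A ω - B ω) ^ 2 / (4 * x) * (4 * x) = (A ω - B ω) ^ 2 :=
      div_mul_cancel₀ _ (by positivity)
    set q := (A ω - B ω) ^ 2 / (4 * x)
    rcases max_cases (A ω - B ω) 0 with ⟨h2, -⟩ | ⟨h2, -⟩ <;> rw [h2]
    · nlinarith [sq_nonneg (A ω - B ω - 2 * x)]
    · nlinarith [sq_nonneg (A ω - B ω + 2 * x)]
  refine (lintegral_mono fun ω => ENNReal.ofReal_le_ofReal (hpt ω)).trans ?_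
  rw [← ofReal_integral_eq_lintegral_ofReal hintb
    (Eventually.of_forall fun ω => le_trans (by positivity) (hpt ω))]
  refine ENNReal.ofReal_le_ofReal ?_
  rw [integral_add hintc (integrable_const _),
    integral_add (hsq.div_const _) hint, integral_div, hm, integral_const, probReal_univ, one_smul]
  have : (∫ ω, (A ω - B ω) ^ 2 ∂P) / (4 * x) ≤ x := by
    rw [div_le_iff₀ (by positivity)]
    nlinarith
  linarith

/-! ### The two kinds of modulus -/

section Modulus

variable {E : Experiment} {T : E.Fn →ₗ[ℝ] ℝ} {ε : ℝ} {F G : Set E.Fn}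

lemma betweenModulus_mono {F' G' : Set E.Fn} (hF : F ⊆ F') (hG : G ⊆ G') :
    betweenModulus E T ε F G ≤ betweenModulus E T ε F' G' :=
  (biSup_mono hF).trans (iSup₂_mono fun _ _ => biSup_mono hG)

lemma orderedModulus_le_betweenModulus :
    orderedModulus E T ε F G ≤ (betweenModulus E T ε F G : EReal) := by
  refine iSup₂_le fun f hf => iSup₂_le fun g hg => iSup_le fun hfg => ?_
  calc ((T g - T f : ℝ) : EReal) ≤ ((ENNReal.ofReal |T g - T f| : ℝ≥0∞) : EReal) := by
        rw [EReal.coe_ennreal_ofReal, max_eq_left (abs_nonneg _)]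
        exact_mod_cast le_abs_self _
    _ ≤ _ := EReal.coe_ennreal_le_coe_ennreal_iff.2
        (le_iSup₂_of_le f hf (le_iSup₂_of_le g hg
          (le_iSup (fun _ : _ ≤ _ => ENNReal.ofReal |T g - T f|) hfg)))

lemma betweenModulus_comm : betweenModulus E T ε F G = betweenModulus E T ε G F := by
  rw [betweenModulus, iSup₂_comm]
  refine iSup_congr fun f => iSup_congr fun _ => iSup_congr fun g => iSup_congr fun _ => ?_
  rw [eLpNorm_sub_comm, abs_sub_comm]

lemma orderedModulus_nonneg (hne : (F ∩ G).Nonempty) : 0 ≤ orderedModulus E T ε F G := by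
  obtain ⟨f, hf, hg⟩ := hne
  refine le_iSup₂_of_le f hf (le_iSup₂_of_le f hg (le_iSup_of_le ?_ ?_)) <;> simp

lemma orderedModulus_ne_top (h : betweenModulus E T ε F G ≠ ∞) :
    orderedModulus E T ε F G ≠ ⊤ :=
  ne_top_of_le_ne_top (by simpa using h) orderedModulus_le_betweenModulus

lemma toReal_orderedModulus_le (hne : (F ∩ G).Nonempty) (h : betweenModulus E T ε F G ≠ ∞) :
    (orderedModulus E T ε F G).toReal ≤ (betweenModulus E T ε F G).toReal := by
  rw [← EReal.toReal_coe_ennreal]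
  exact EReal.toReal_le_toReal orderedModulus_le_betweenModulus
    (ne_bot_of_le_ne_bot (by simp) (orderedModulus_nonneg hne)) (by simpa using h)

end Modulus

/-- The estimators attached to `(F, G)` and `(G, F)`, for nested classes `F ⊆ G`, bracket `T f` at
the scale `ω₊(z_{α/2}/√n, F, G)`, for every `f` in the larger class. -/
lemma IsGaussianShift.isBracketingPair {n : ℝ} {E : Experiment} {a : E.Idx → Lp ℝ 2 E.ref}
    (h : IsGaussianShift n E a) {α : ℝ} (hz : 0 < upperQuantile (α / 2)) {T : E.Fn →ₗ[ℝ] ℝ}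
    {F G : Set E.Fn} (hFG : F ⊆ G) (hne : F.Nonempty) {A B : E.Fn → ℝ}
    (hA : IsOrderedEstimator E T n α F G A) (hB : IsOrderedEstimator E T n α G F B)
    (hpos : 0 < betweenModulus E T (upperQuantile (α / 2) / √n) F G)
    (hfin : betweenModulus E T (upperQuantile (α / 2) / √n) F G ≠ ∞) {f : E.Fn} (hf : f ∈ G)
    (hf2 : MemLp f 2 E.ref) :
    IsBracketingPair (E.law f) (upperQuantile (α / 2)) (T f)
      (betweenModulus E T (upperQuantile (α / 2) / √n) F G).toReal A B := by
  obtain ⟨f₀, hf₀⟩ := hne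
  have h1 : (F ∩ G).Nonempty := ⟨f₀, hf₀, hFG hf₀⟩
  have h2 : (G ∩ F).Nonempty := ⟨f₀, hFG hf₀, hf₀⟩
  have hfin' := hfin
  rw [betweenModulus_comm] at hfin'
  have hω := toReal_orderedModulus_le h1 hfin
  have hω' := toReal_orderedModulus_le h2 hfin'
  rw [betweenModulus_comm] at hω'
  have hω0 := EReal.toReal_nonneg (orderedModulus_nonneg (T := T)
    (ε := upperQuantile (α / 2) / √n) h1)
  have hω0' := EReal.toReal_nonneg (orderedModulus_nonneg (T := T)
    (ε := upperQuantile (α / 2) / √n) h2)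
  have hvar : ∀ {v w x : ℝ}, 0 ≤ w → w ≤ x → v ≤ 1 / upperQuantile (α / 2) ^ 2 * w ^ 2 →
      v ≤ (x / upperQuantile (α / 2)) ^ 2 := by
    intro v w x hw hwx hv
    refine hv.trans ?_
    rw [div_pow, div_mul_eq_mul_div, one_mul]
    gcongr
  refine ⟨ENNReal.toReal_pos hpos.ne' hfin, fun r q => ?_, hvar hω0 hω (hA.variance_le f hf2),
    hvar hω0' hω' (hB.variance_le f hf2), ?_, ?_⟩
  · exact ((hA.linear.const_mul r).add (hB.linear.const_mul q)).hasGaussianLaw h hf2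
  · linarith [hA.bias_ge f hf]
  · linarith [hB.bias_le f hf]

/-! ### The adaptive interval -/

lemma measurable_apply_index {Y : Type*} [MeasurableSpace Y] {S : Set ℕ∞} {J : Y → ℕ∞}
    (hJ : Measurable J) (hJS : ∀ y, J y ∈ S) {g : ℕ∞ → Y → ℝ} (hg : ∀ s ∈ S, Measurable (g s)) :
    Measurable fun y => g (J y) y := by
  intro U hU
  have : (fun y => g (J y) y) ⁻¹' U = ⋃ s ∈ S, J ⁻¹' {s} ∩ g s ⁻¹' U := by
    ext y
    simp [hJS y]
  rw [this]
  exact MeasurableSet.biUnion S.to_countable fun s hs =>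
    (hJ (measurableSet_singleton s)).inter (hg s hs hU)

section Adaptive

variable {n α : ℝ} {E : Experiment} {T : E.Fn →ₗ[ℝ] ℝ} {k : ℕ∞} {F : ℕ∞ → Set E.Fn}
  {τ : ℕ∞ → ℕ∞ → E.Fn → ℝ} {S : Set ℕ∞} {J : E.Fn → ℕ∞}

lemma ciStep_length (j : ℕ∞) (y : E.Fn) : (ciStep E T n α k F τ j).length y =
    ENNReal.ofReal (2 * (max (τ j k y - τ k j y) 0 + 2 * (xi E T n α k F j).toReal)) := by
  rw [DataInterval.length]
  congr 1
  simp only [ciStep]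
  ring

lemma ciStep_length_le_iff (i j : ℕ∞) (y : E.Fn) :
    (ciStep E T n α k F τ i).length y ≤ (ciStep E T n α k F τ j).length y ↔
      2 * (xi E T n α k F i).toReal + max (τ i k y - τ k i y) 0 ≤
        2 * (xi E T n α k F j).toReal + max (τ j k y - τ k j y) 0 := by
  have h : 0 ≤ (xi E T n α k F j).toReal := ENNReal.toReal_nonneg
  rw [ciStep_length, ciStep_length, ENNReal.ofReal_le_ofReal_iff (by positivity)]
  constructor <;> intro _ <;> linarith

lemma measurable_ciStep {j : ℕ∞} (h₁ : Measurable (τ j k)) (h₂ : Measurable (τ k j)) :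
    Measurable (ciStep E T n α k F τ j).lo ∧ Measurable (ciStep E T n α k F τ j).hi :=
  ⟨((h₁.add h₂).div_const 2).sub (((h₁.sub h₂).max measurable_const).add_const _),
    ((h₁.add h₂).div_const 2).add (((h₁.sub h₂).max measurable_const).add_const _)⟩

lemma xi_mono (hnest : ∀ i j, 1 ≤ i → i ≤ j → j ≤ k → F i ⊆ F j) (i j : ℕ∞) (hi : 1 ≤ i)
    (hij : i ≤ j) (hj : j ≤ k) : xi E T n α k F i ≤ xi E T n α k F j :=
  betweenModulus_mono (hnest i j hi hij hj) subset_rfl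

lemma nonempty_of_xi_pos {j : ℕ∞} (h : 0 < xi E T n α k F j) : (F j).Nonempty := by
  by_contra hne
  rw [Set.not_nonempty_iff_eq_empty] at hne
  simp [xi, betweenModulus, hne] at h

lemma xi_top_le (htop : F ⊤ = ⋃ (i : ℕ) (_ : 1 ≤ i), F i) :
    xi E T n α k F ⊤ ≤ ⨆ (i : ℕ) (_ : 1 ≤ i), xi E T n α k F i := by
  refine iSup₂_le fun f hf => ?_
  rw [htop] at hf
  simp only [Set.mem_iUnion] at hf
  obtain ⟨i, hi, hfi⟩ := hf
  exact le_iSup₂_of_le i hi (le_iSup₂_of_le f hfi le_rfl)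

/-- A geometrically spaced subsequence of finite positive numbers, in real form. -/
lemma IsDoublingSubsequence.toReal {x : ℕ∞ → ℝ≥0∞} (hS : IsDoublingSubsequence k x S)
    (hpos : ∀ j, 1 ≤ j → j ≤ k → 0 < x j) :
    (∀ s ∈ S, 0 < (x s).toReal) ∧
      ∀ s ∈ S, ∀ t ∈ S, s < t → 2 * (x s).toReal ≤ (x t).toReal := by
  refine ⟨fun s hs => ?_, fun s hs t ht hst => ?_⟩
  · obtain ⟨h1, h2, h3⟩ := hS.mem_range s hs
    exact ENNReal.toReal_pos (hpos s h1 h2).ne' h3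
  · have := ENNReal.toReal_mono (hS.mem_range t ht).2.2 (hS.spaced s hs t ht hst)
    simpa using this

lemma IsGaussianShift.exists_isAdaptiveConstruction {a : E.Idx → Lp ℝ 2 E.ref} (hn : 0 < n)
    (h : IsGaussianShift n E a) (hz : 0 < upperQuantile (α / 2)) (hk : 1 ≤ k)
    (hL2 : ∀ j, 1 ≤ j → j ≤ k → ∀ f ∈ F j, MemLp f 2 E.ref)
    (hconv : ∀ j, 1 ≤ j → j ≤ k → Convex ℝ (F j))
    (hnest : ∀ i j, 1 ≤ i → i ≤ j → j ≤ k → F i ⊆ F j)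
    (htop : k = ⊤ → F ⊤ = ⋃ (i : ℕ) (_ : 1 ≤ i), F i)
    (hpos : 0 < xi E T n α k F 1)
    (hfin : ∀ j, 1 ≤ j → j ≤ k → j ≠ ⊤ → xi E T n α k F j ≠ ∞) :
    ∃ (τ : ℕ∞ → ℕ∞ → E.Fn → ℝ) (S : Set ℕ∞) (J : E.Fn → ℕ∞),
      IsAdaptiveConstruction E T n α k F τ S J := by
  classical
  have hmono := xi_mono (E := E) (T := T) (n := n) (α := α) hnest
  have hpos' : ∀ j, 1 ≤ j → j ≤ k → 0 < xi E T n α k F j := fun j h1 h2 =>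
    hpos.trans_le (hmono 1 j le_rfl h1 h2)
  obtain ⟨S, hS⟩ := exists_isDoublingSubsequence hk hmono hpos hfin fun hk' =>
    xi_top_le (htop hk')
  let τ : ℕ∞ → ℕ∞ → E.Fn → ℝ := fun i l =>
    if hex : ∃ t, IsOrderedEstimator E T n α (F i) (F l) t then hex.choose else 0
  have hτ : ∀ i l, (∃ t, IsOrderedEstimator E T n α (F i) (F l) t) →
      IsOrderedEstimator E T n α (F i) (F l) (τ i l) := by
    intro i l hex
    simp only [τ, dif_pos hex]
    exact hex.choose_spec
  have hest : ∀ j, 1 ≤ j → j ≤ k → xi E T n α k F j ≠ ∞ →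
      IsOrderedEstimator E T n α (F j) (F k) (τ j k) ∧
      IsOrderedEstimator E T n α (F k) (F j) (τ k j) := by
    intro j h1 h2 h3
    obtain ⟨f₀, hf₀⟩ := nonempty_of_xi_pos (hpos' j h1 h2)
    have hf₀k := hnest j k h1 h2 le_rfl hf₀
    have h4 : betweenModulus E T (upperQuantile (α / 2) / √n) (F k) (F j) ≠ ∞ := by
      rw [betweenModulus_comm]
      exact h3
    exact ⟨hτ _ _ (h.exists_isOrderedEstimator hn hz T (hconv j h1 h2) (hconv k hk le_rfl)
        (hL2 j h1 h2) (hL2 k hk le_rfl) ⟨f₀, hf₀, hf₀k⟩ (orderedModulus_ne_top h3)),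
      hτ _ _ (h.exists_isOrderedEstimator hn hz T (hconv k hk le_rfl) (hconv j h1 h2)
        (hL2 k hk le_rfl) (hL2 j h1 h2) ⟨f₀, hf₀k, hf₀⟩ (orderedModulus_ne_top h4))⟩
  have hestS : ∀ s ∈ S, IsOrderedEstimator E T n α (F s) (F k) (τ s k) ∧
      IsOrderedEstimator E T n α (F k) (F s) (τ k s) := fun s hs =>
    hest s (hS.mem_range s hs).1 (hS.mem_range s hs).2.1 (hS.mem_range s hs).2.2
  obtain ⟨b, hb, -⟩ := (hS.cofinal 1 le_rfl hk) (hfin 1 le_rfl hk (by simp))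
  obtain ⟨hx, hd⟩ := hS.toReal hpos'
  obtain ⟨J, hJm, hJS, hJ⟩ := exists_measurable_argmin (S := S)
    (L := fun s y => (ciStep E T n α k F τ s).length y)
    (fun s hs => by
      obtain ⟨hlo, hhi⟩ := measurable_ciStep (T := T) (n := n) (α := α) (F := F)
        (hestS s hs).1.linear.1 (hestS s hs).2.linear.1
      exact (hhi.sub hlo).ennreal_ofReal)
    (fun y => by
      obtain ⟨l, hl, hmin⟩ := exists_forall_le_of_doubling hx hd ⟨b, hb⟩
        (φ := fun s => 2 * (xi E T n α k F s).toReal + max (τ s k y - τ k s y) 0)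
        (fun s hs => by linarith [hx s hs, le_max_right (τ s k y - τ k s y) 0])
      exact ⟨l, hl, fun t ht => (ciStep_length_le_iff l t y).2 (hmin t ht)⟩)
  exact ⟨τ, S, J, hest, hS, hJm, hJS, hJ⟩


namespace IsAdaptiveConstruction

lemma estimators_of_mem (hC : IsAdaptiveConstruction E T n α k F τ S J) {s : ℕ∞} (hs : s ∈ S) :
    IsOrderedEstimator E T n α (F s) (F k) (τ s k) ∧
      IsOrderedEstimator E T n α (F k) (F s) (τ k s) :=
  hC.estimators s (hC.subsequence.mem_range s hs).1 (hC.subsequence.mem_range s hs).2.1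
    (hC.subsequence.mem_range s hs).2.2

lemma isBracketingPair (hC : IsAdaptiveConstruction E T n α k F τ S J)
    {a : E.Idx → Lp ℝ 2 E.ref} (h : IsGaussianShift n E a) (hz : 0 < upperQuantile (α / 2))
    (hnest : ∀ i j, 1 ≤ i → i ≤ j → j ≤ k → F i ⊆ F j) (hpos : 0 < xi E T n α k F 1)
    {s : ℕ∞} (hs : s ∈ S) {f : E.Fn} (hf : f ∈ F k) (hf2 : MemLp f 2 E.ref) :
    IsBracketingPair (E.law f) (upperQuantile (α / 2)) (T f) (xi E T n α k F s).toReal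
      (τ s k) (τ k s) := by
  obtain ⟨h1, h2, h3⟩ := hC.subsequence.mem_range s hs
  have h4 := hpos.trans_le (xi_mono (E := E) (T := T) (n := n) (α := α) hnest 1 s le_rfl h1 h2)
  obtain ⟨hA, hB⟩ := hC.estimators_of_mem hs
  exact h.isBracketingPair hz (hnest s k h1 h2 le_rfl) (nonempty_of_xi_pos h4) hA hB h4 h3 hf hf2

theorem mem_confidenceIntervals (hC : IsAdaptiveConstruction E T n α k F τ S J)
    {a : E.Idx → Lp ℝ 2 E.ref} (h : IsGaussianShift n E a) (hα₀ : 0 < α) (hα : α ≤ 1 / 5)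
    (hL2 : ∀ f ∈ F k, MemLp f 2 E.ref)
    (hnest : ∀ i j, 1 ≤ i → i ≤ j → j ≤ k → F i ⊆ F j) (hpos : 0 < xi E T n α k F 1) :
    ciStar E T n α k F τ J ∈ confidenceIntervals E T α (F k) := by
  have hz := five_fourths_le_upperQuantile (half_pos hα₀) (by linarith)
  have hm := fun s (hs : s ∈ S) => measurable_ciStep (T := T) (n := n) (α := α) (F := F)
    (hC.estimators_of_mem hs).1.linear.1 (hC.estimators_of_mem hs).2.linear.1
  refine ⟨measurable_apply_index hC.measurable_index hC.index_mem fun s hs => (hm s hs).1,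
    measurable_apply_index hC.measurable_index hC.index_mem fun s hs => (hm s hs).2,
    fun f hf => ?_⟩
  have := h.isProbabilityMeasure f (hL2 f hf)
  obtain ⟨-, hd⟩ := hC.subsequence.toReal fun j h1 h2 =>
    hpos.trans_le (xi_mono (E := E) (T := T) (n := n) (α := α) hnest 1 j le_rfl h1 h2)
  obtain ⟨y₀⟩ := (inferInstance : Nonempty E.Fn)
  have hmiss := measure_selectedMiss_le (P := E.law f) (θ := T f) (J := J)
    (A := fun s => τ s k) (B := fun s => τ k s) hz ⟨J y₀, hC.index_mem y₀⟩
    (fun s hs => hC.isBracketingPair h (by linarith) hnest hpos hs hf (hL2 f hf)) hd hC.index_mem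
    (fun y l hl => (ciStep_length_le_iff _ _ y).1 (hC.shortest y l hl))
  rw [gaussianTail_upperQuantile (half_pos hα₀) (by linarith),
    show 2 * (α / 2) = α by ring] at hmiss
  rw [ENNReal.ofReal_sub _ hα₀.le, ENNReal.ofReal_one, tsub_le_iff_right]
  calc 1 = E.law f Set.univ := measure_univ.symm
    _ ≤ E.law f ({y | T f ∈ Set.Icc ((ciStar E T n α k F τ J).lo y)
          ((ciStar E T n α k F τ J).hi y)} ∪
          {y | y ∈ missSet (T f) (xi E T n α k F (J y)).toReal (τ (J y) k) (τ k (J y))}) := by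
        refine measure_mono fun y _ => ?_
        by_cases hy : T f ∈ Set.Icc ((ciStar E T n α k F τ J).lo y) ((ciStar E T n α k F τ J).hi y)
        · exact Or.inl hy
        · exact Or.inr hy
    _ ≤ _ := (measure_union_le _ _).trans (add_le_add_right hmiss _)

theorem maxLength_le_of_mem (hC : IsAdaptiveConstruction E T n α k F τ S J)
    {a : E.Idx → Lp ℝ 2 E.ref} (h : IsGaussianShift n E a) (hα₀ : 0 < α) (hα : α ≤ 1 / 5)
    (hL2 : ∀ f ∈ F k, MemLp f 2 E.ref)
    (hnest : ∀ i j, 1 ≤ i → i ≤ j → j ≤ k → F i ⊆ F j) (hpos : 0 < xi E T n α k F 1)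
    {s : ℕ∞} (hs : s ∈ S) :
    maxLength (ciStar E T n α k F τ J) (F s) ≤ 8 * xi E T n α k F s := by
  have hz := five_fourths_le_upperQuantile (half_pos hα₀) (by linarith)
  obtain ⟨h1, h2, h3⟩ := hC.subsequence.mem_range s hs
  refine iSup₂_le fun f hf => ?_
  have hfk := hnest s k h1 h2 le_rfl hf
  have hf2 := hL2 f hfk
  have := h.isProbabilityMeasure f hf2
  have hpair := hC.isBracketingPair h (by linarith) hnest hpos hs hfk hf2
  obtain ⟨hA, hB⟩ := hC.estimators_of_mem hs
  have hne : (F s ∩ F k).Nonempty := ⟨f, hf, hfk⟩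
  have hω := toReal_orderedModulus_le (T := T) hne h3
  have h3' : betweenModulus E T (upperQuantile (α / 2) / √n) (F k) (F s) ≠ ∞ := by
    rw [betweenModulus_comm]
    exact h3
  have hω' := toReal_orderedModulus_le (Set.inter_comm _ _ ▸ hne) h3'
  rw [betweenModulus_comm] at hω'
  have hd : ∫ y, τ s k y ∂(E.law f) - ∫ y, τ k s y ∂(E.law f) ≤ (xi E T n α k F s).toReal := by
    have hA' := hA.bias_le f hf
    have hB' := hB.bias_ge f hf
    change _ ≤ (xi E T n α k F s).toReal at hω hω'
    linarith
  calc ∫⁻ y, (ciStar E T n α k F τ J).length y ∂(E.law f)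
      ≤ ∫⁻ y, (ciStep E T n α k F τ s).length y ∂(E.law f) :=
        lintegral_mono fun y => hC.shortest y s hs
    _ ≤ ENNReal.ofReal (8 * (xi E T n α k F s).toReal) := by
        simp_rw [ciStep_length]
        exact hpair.lintegral_length_le hz hd
    _ = 8 * xi E T n α k F s := by
        rw [ENNReal.ofReal_mul (by norm_num), ENNReal.ofReal_toReal h3]
        norm_num

/-- An index outside the subsequence is compared with the next index of the subsequence, whose
modulus is less than twice as large. -/
theorem maxLength_le (hC : IsAdaptiveConstruction E T n α k F τ S J)
    {a : E.Idx → Lp ℝ 2 E.ref} (h : IsGaussianShift n E a) (hα₀ : 0 < α) (hα : α ≤ 1 / 5)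
    (hL2 : ∀ f ∈ F k, MemLp f 2 E.ref)
    (hnest : ∀ i j, 1 ≤ i → i ≤ j → j ≤ k → F i ⊆ F j) (hpos : 0 < xi E T n α k F 1)
    {j : ℕ∞} (hj1 : 1 ≤ j) (hjk : j ≤ k) :
    maxLength (ciStar E T n α k F τ J) (F j) ≤ 16 * xi E T n α k F j := by
  by_cases hfin : xi E T n α k F j = ∞
  · rw [hfin, ENNReal.mul_top (by norm_num)]
    exact le_top
  obtain ⟨b, ⟨hbS, hjb⟩, hbmin⟩ := WellFounded.has_min (wellFounded_lt (α := ℕ∞))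
    {b | b ∈ S ∧ j ≤ b} (hC.subsequence.cofinal j hj1 hjk hfin)
  have hb := hC.maxLength_le_of_mem h hα₀ hα hL2 hnest hpos hbS
  rcases hjb.eq_or_lt with rfl | hlt
  · exact hb.trans (mul_le_mul_left (by norm_num) _)
  · have h1 := hC.subsequence.between b hbS j hj1 hlt fun a ha hab => by
      by_contra hcon
      exact hbmin a ⟨ha, not_lt.1 hcon⟩ hab
    calc maxLength (ciStar E T n α k F τ J) (F j)
        ≤ maxLength (ciStar E T n α k F τ J) (F b) :=
          biSup_mono (hnest j b hj1 hjb (hC.subsequence.mem_range b hbS).2.1)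
      _ ≤ 8 * (2 * xi E T n α k F j) := hb.trans (mul_le_mul_right h1.le _)
      _ = 16 * xi E T n α k F j := by rw [← mul_assoc]; norm_num

end IsAdaptiveConstruction

end Adaptive

theorem theorem2 (n α : ℝ) (hn : 0 < n) (hα₀ : 0 < α) (hα : α ≤ 1 / 5)
    (E : Experiment) (hE : IsGaussianModel n E) (T : E.Fn →ₗ[ℝ] ℝ)
    (k : ℕ∞) (hk : 1 ≤ k) (F : ℕ∞ → Set E.Fn)
    (hL2 : ∀ j, 1 ≤ j → j ≤ k → ∀ f ∈ F j, MemLp f 2 E.ref)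
    (hconv : ∀ j, 1 ≤ j → j ≤ k → Convex ℝ (F j))
    (hnest : ∀ i j, 1 ≤ i → i ≤ j → j ≤ k → F i ⊆ F j)
    (htop : k = ⊤ → F ⊤ = ⋃ (i : ℕ) (_ : 1 ≤ i), F i)
    (hpos : 0 < xi E T n α k F 1)
    (hfin : ∀ j, 1 ≤ j → j ≤ k → j ≠ ⊤ → xi E T n α k F j ≠ ∞) :
    (∃ (τ : ℕ∞ → ℕ∞ → E.Fn → ℝ) (S : Set ℕ∞) (J : E.Fn → ℕ∞),
      IsAdaptiveConstruction E T n α k F τ S J) ∧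
    ∀ (τ : ℕ∞ → ℕ∞ → E.Fn → ℝ) (S : Set ℕ∞) (J : E.Fn → ℕ∞),
      IsAdaptiveConstruction E T n α k F τ S J →
      ciStar E T n α k F τ J ∈ confidenceIntervals E T α (F k) ∧
      (∀ j, 1 ≤ j → j ≤ k →
        optimalLength E T α (F j) (F k) ≤ maxLength (ciStar E T n α k F τ J) (F j) ∧
        maxLength (ciStar E T n α k F τ J) (F j) ≤
          ENNReal.ofReal (16 * upperQuantile (α / 2) / ((1 / 2 - α) * upperQuantile α)) *
            optimalLength E T α (F j) (F k)) ∧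
      (∀ j ∈ S, maxLength (ciStar E T n α k F τ J) (F j) ≤
        8 * betweenModulus E T (upperQuantile (α / 2) / √n) (F j) (F k)) ∧
      (∀ j, 1 ≤ j → j ≤ k → maxLength (ciStar E T n α k F τ J) (F j) ≤
        16 * betweenModulus E T (upperQuantile (α / 2) / √n) (F j) (F k)) := by
  have hz := five_fourths_le_upperQuantile (half_pos hα₀) (by linarith)
  obtain ⟨a, h⟩ := hE.exists_isGaussianShift hn
  refine ⟨h.exists_isAdaptiveConstruction hn (by linarith) hk hL2 hconv hnest htop hpos hfin,
    fun τ S J hC => ?_⟩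
  have hcov := hC.mem_confidenceIntervals h hα₀ hα (hL2 k hk le_rfl) hnest hpos
  have hlen := fun j (hj1 : 1 ≤ j) (hjk : j ≤ k) =>
    hC.maxLength_le h hα₀ hα (hL2 k hk le_rfl) hnest hpos hj1 hjk
  refine ⟨hcov, fun j hj1 hjk => ⟨iInf₂_le _ hcov, (hlen j hj1 hjk).trans ?_⟩,
    fun j hj => hC.maxLength_le_of_mem h hα₀ hα (hL2 k hk le_rfl) hnest hpos hj, hlen⟩
  calc 16 * xi E T n α k F j
      ≤ 16 * (ENNReal.ofReal (upperQuantile (α / 2) / ((1 / 2 - α) * upperQuantile α)) *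
        optimalLength E T α (F j) (F k)) :=
        mul_le_mul_right (h.betweenModulus_le_optimalLength hn hα₀ (by linarith) T
          (hnest j k hj1 hjk le_rfl) (hconv k hk le_rfl) (hL2 k hk le_rfl)) _
    _ = _ := by
        rw [mul_div_assoc, ENNReal.ofReal_mul (by norm_num), mul_assoc]
        norm_num
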